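/- **Theorem 4.4.** Let $k$ be an algebraically closed field. A tensor category over $k$ is a locally finite $k$-linear abelian rigid monoidal category $\mathcal C$ whose tensor product is $k$-bilinear on morphisms and such that $\operatorname{End}_{\mathcal C}(\mathbf 1)=k$; the bounded derived category $\mathbf D^b(\mathcal C)$ then carries the monoidal structure induced by the tensor product of complexes. Let $\mathcal C,\mathcal D$ be tensor categories over $k$, and let $\mathcal A\subset\mathcal C$, $\mathcal B\subset\mathcal D$ be (not necessarily full) subcategories, i.e. $k$-linear abelian categories with faithful exact $k$-linear inclusion functors $i_{\mathcal A}:\mathcal A\to\mathcal C$, $i_{\mathcal B}:\mathcal B\to\mathcal D$, both with finitely many isomorphism classes of simple objects. Assume that $\mathbf D^b(\mathcal A)$ and $\mathbf D^b(\mathcal B)$ are left triangulated tensor ideals of $\mathbf D^b(\mathcal C)$ and $\mathbf D^b(\mathcal D)$: the functors induced by $i_{\mathcal A}$ and $i_{\mathcal B}$ on bounded derived categories (again denoted $i_{\mathcal A}$, $i_{\mathcal B}$) are faithful, and the left tensor multiplication of $\mathbf D^b(\mathcal C)$ (resp. $\mathbf D^b(\mathcal D)$) restricts to $\mathbf D^b(\mathcal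 A)$ (resp. $\mathbf D^b(\mathcal B)$), i.e. $\mathbf D^b(\mathcal A)$ is a left $\mathbf D^b(\mathcal C)$-module category with module product $X\otimes K$ such that the inclusion is a module functor, and likewise for $\mathbf D^b(\mathcal B)$ over $\mathbf D^b(\mathcal D)$. Let $F:\mathbf D^b(\mathcal C)\to\mathbf D^b(\mathcal D)$ be a (strong) monoidal triangulated functor which restricts to a triangulated functor $F|:=F|_{\mathbf D^b(\mathcal A)}:\mathbf D^b(\mathcal A)\to\mathbf D^b(\mathcal B)$, that is, $F\circ i_{\mathcal A}\cong i_{\mathcal B}\circ F|$, in such a way that the canonical isomorphisms $F(X\otimes K)\cong F(X)\otimes F(K)$, for $X\in\mathbf D^b(\mathcal C)$ and $K\in\mathbf D^b(\mathcal A)$, are isomorphisms $F|(X\otimes K)\cong F(X)\otimes F|(K)$ in $\mathbf D^b(\mathcal B)$ (so $F|$ is a $\mathbf D^b(\mathcal C)$-module functor, where $\mathbf D^b(\mathcal C)$ acts on $\mathbf D^b(\mathcal B)$ through $F$). Assume that $F|$ is full and dense (essentially surjective). Consider $\mathcal A,\mathcal B,\mathcal C$ as the complexes concentrated in degree $0$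 in $\mathbf D^b(\mathcal A),\mathbf D^b(\mathcal B),\mathbf D^b(\mathcal C)$. Then: 1. The $\mathbf D^b(\mathcal C)$-actions restrict to left $\mathcal C$-module structures on $\mathcal A$ (with module product $X\otimes M$, exact in each variable and $k$-bilinear) and on $\mathcal B$ (with module product $F(X)\otimes N$, exact in each variable). Moreover $F|(\mathcal A)\subseteq\mathcal B$: there is a functor $F|_{\mathcal A}:\mathcal A\to\mathcal B$ which is isomorphic to the restriction of $F|$ to $\mathcal A$; it is exact, and it is a $\mathcal C$-module functor, with module structure induced by that of $F|$. If $F$ is $k$-linear, then the $\mathcal C$-action on $\mathcal B$ is $k$-bilinear and $F|_{\mathcal A}$ is $k$-linear. 2. $\ker(F|_{\mathcal A})=\{M\in\mathcal A: F(M)\cong 0\}$ is a Serre subcategory of $\mathcal A$, and the Serre quotient $\mathcal A/\ker(F|_{\mathcal A})$ carries a left $\mathcal C$-module structure, exact in each variable and $k$-bilinear, for which the quotient functor $Q:\mathcal A\to\mathcal A/\ker(F|_{\mathcal A})$ is a $\mathcal C$-module functor. There is an equivalence of categories $E:\mathcal A/\ker(F|_{\mathcal A})\to\mathcal B$ which is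 a $\mathcal C$-module functor, together with an isomorphism $E\circ Q\cong F|_{\mathcal A}$ of $\mathcal C$-module functors. If $F$ is $k$-linear, then so is $E$. 3. An object $K$ of $\mathbf D^b(\mathcal A)$ satisfies $F|(K)\cong 0$ if and only if $H^n(K)\in\ker(F|_{\mathcal A})$ for all $n\in\mathbb Z$; that is, $\ker(F|_{\mathbf D^b(\mathcal A)})=\mathbf D^b_{\ker(F|_{\mathcal A})}(\mathcal A)$. -/

import Mathlib

open CategoryTheory Category Limits MonoidalCategory Pretriangulated Triangulated
universe w v u

namespace DerivedModule

section FiniteSupport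

variable {C D : Type*} [Category C] [Category D] [HasZeroMorphisms C] [HasZeroMorphisms D]

/-- A cofan is colimiting if its restriction to a set of indices outside of which the family
vanishes is colimiting. -/
noncomputable def isColimitOfRestrict {J : Type*} {f : J → C} (c : Cofan f) (S : Set J)
    (hS : ∀ j, j ∉ S → IsZero (f j))
    (hc : IsColimit (Cofan.mk (f := fun s : S => f s) c.pt (fun s => c.inj s))) :
    IsColimit c :=
  Cofan.IsColimit.mk c
    (fun t => Cofan.IsColimit.desc hc (fun s => t.inj s))
    (fun t j => by
      classical
      by_cases hj : j ∈ S
      · exact Cofan.IsColimit.fac hc (fun s => t.inj s) ⟨j, hj⟩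
      · exact (hS j hj).eq_of_src _ _)
    (fun t m hm => by
      apply Cofan.IsColimit.hom_ext hc
      intro s
      rw [Cofan.IsColimit.fac]
      exact hm s)

/-- The restriction of a colimiting cofan to a set of indices outside of which the family
vanishes is colimiting. -/
noncomputable def isColimitRestrict {J : Type*} {f : J → C} (c : Cofan f) (S : Set J)
    (hS : ∀ j, j ∉ S → IsZero (f j)) (hc : IsColimit c) :
    IsColimit (Cofan.mk (f := fun s : S => f s) c.pt (fun s => c.inj s)) := by
  classical
  exact Cofan.IsColimit.mk _
    (fun t => Cofan.IsColimit.desc hc (fun j => if h : j ∈ S then t.inj ⟨j, h⟩ else 0))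
    (fun t j => by
      refine (Cofan.IsColimit.fac hc _ _).trans ?_
      rw [dif_pos j.2])
    (fun t m hm => by
      apply Cofan.IsColimit.hom_ext hc
      intro j
      rw [Cofan.IsColimit.fac]
      by_cases hj : j ∈ S
      · rw [dif_pos hj]
        exact hm ⟨j, hj⟩
      · exact (hS j hj).eq_of_src _ _)

lemma hasCoproduct_of_finite_support [HasFiniteCoproducts C] {J : Type*} (f : J → C)
    (h : {j | ¬ IsZero (f j)}.Finite) : HasCoproduct f := by
  classical
  have := h.to_subtype
  let S := {j | ¬ IsZero (f j)}
  let c : Cofan f := Cofan.mk (∐ (fun s : S => f s))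
    (fun j => if hj : j ∈ S then Sigma.ι (fun s : S => f s) ⟨j, hj⟩ else 0)
  refine ⟨⟨c, isColimitOfRestrict c S (fun j hj => by simpa [S] using hj) ?_⟩⟩
  refine IsColimit.ofIsoColimit (coproductIsCoproduct (fun s : S => f s)) ?_
  refine Cofan.ext (Iso.refl _) (fun s => ?_)
  simp only [Iso.refl_hom, comp_id]
  change _ = dite _ _ _
  rw [dif_pos s.2]
  rfl

lemma preservesColimit_of_finite_support (F : C ⥤ D) [F.PreservesZeroMorphisms]
    [PreservesFiniteCoproducts F] {J : Type*} (f : J → C)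
    (h : {j | ¬ IsZero (f j)}.Finite) : PreservesColimit (Discrete.functor f) F where
  preserves {c} hc := by
    have := h.to_subtype
    let S := {j | ¬ IsZero (f j)}
    have hS : ∀ j, j ∉ S → IsZero (f j) := fun j hj => by simpa [S] using hj
    have h1 := isColimitRestrict (f := f) c S hS hc
    have h2 := (isColimitMapCoconeCofanMkEquiv F (fun s : S => f s)
      (fun s => Cofan.inj (f := f) c s)) (isColimitOfPreserves F h1)
    have h3 : IsColimit (Cofan.mk (F.obj c.pt) fun j => F.map (Cofan.inj (f := f) c j)) :=
      isColimitOfRestrict _ S (fun j hj => F.map_isZero (hS j hj)) h2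
    exact ⟨(Cofan.isColimitMapCoconeEquiv F f c).symm h3⟩

end FiniteSupport

section GradedFinite

variable {C : Type*} [Category C] [Abelian C] [MonoidalCategory C] [MonoidalPreadditive C]

/-- A graded object which is zero in all but finitely many degrees. -/
class FinSupp {I : Type*} (X : GradedObject I C) : Prop where
  finite : {i | ¬ IsZero (X i)}.Finite

lemma isZero_tensor_left {X : C} (h : IsZero X) (Y : C) : IsZero (X ⊗ Y) :=
  (tensorRight Y).map_isZero h

lemma isZero_tensor_right (X : C) {Y : C} (h : IsZero Y) : IsZero (X ⊗ Y) :=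
  (tensorLeft X).map_isZero h

instance finSupp_map₂ {I : Type*} (X₁ X₂ : GradedObject I C) [FinSupp X₁] [FinSupp X₂] :
    FinSupp (((GradedObject.mapBifunctor (curriedTensor C) I I).obj X₁).obj X₂) where
  finite := by
    refine ((FinSupp.finite (X := X₁)).prod (FinSupp.finite (X := X₂))).subset ?_
    rintro ⟨i, j⟩ h
    exact ⟨fun h' => h (isZero_tensor_left h' _), fun h' => h (isZero_tensor_right _ h')⟩

instance finSupp_map₃ {I : Type*} (X₁ X₂ X₃ : GradedObject I C)
    [FinSupp X₁] [FinSupp X₂] [FinSupp X₃] :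
    FinSupp ((((GradedObject.mapTrifunctor (bifunctorComp₂₃ (curriedTensor C)
      (curriedTensor C)) I I I).obj X₁).obj X₂).obj X₃) where
  finite := by
    refine ((FinSupp.finite (X := X₁)).prod
      ((FinSupp.finite (X := X₂)).prod (FinSupp.finite (X := X₃)))).subset ?_
    rintro ⟨i, j, k⟩ h
    exact ⟨fun h' => h (isZero_tensor_left h' _),
      fun h' => h (isZero_tensor_right _ (isZero_tensor_left h' _)),
      fun h' => h (isZero_tensor_right _ (isZero_tensor_right _ h'))⟩

lemma finite_support_comp {I J : Type*} (X : GradedObject I C) [FinSupp X] (p : J → I)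
    (hp : Function.Injective p) : {j | ¬ IsZero (X (p j))}.Finite :=
  (FinSupp.finite (X := X)).preimage hp.injOn

lemma hasMap_of_finSupp {I J : Type*} (X : GradedObject I C) [FinSupp X] (p : I → J) :
    GradedObject.HasMap X p := fun _ =>
  hasCoproduct_of_finite_support _ (finite_support_comp X _ Subtype.val_injective)

variable {I : Type*} [AddMonoid I]

instance (X₁ X₂ : GradedObject I C) [FinSupp X₁] [FinSupp X₂] :
    GradedObject.HasTensor X₁ X₂ := hasMap_of_finSupp _ _

instance (X₁ X₂ X₃ : GradedObject I C) [FinSupp X₁] [FinSupp X₂] :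
    GradedObject.HasGoodTensor₁₂Tensor X₁ X₂ X₃ := fun _ _ =>
  preservesColimit_of_finite_support _ _ (finite_support_comp
    (((GradedObject.mapBifunctor (curriedTensor C) I I).obj X₁).obj X₂) _ Subtype.val_injective)

instance (X₁ X₂ X₃ : GradedObject I C) [FinSupp X₂] [FinSupp X₃] :
    GradedObject.HasGoodTensorTensor₂₃ X₁ X₂ X₃ := fun _ _ =>
  preservesColimit_of_finite_support _ _ (finite_support_comp
    (((GradedObject.mapBifunctor (curriedTensor C) I I).obj X₂).obj X₃) _ Subtype.val_injective)

instance (X₁ X₂ X₃ X₄ : GradedObject I C) [FinSupp X₂] [FinSupp X₃] [FinSupp X₄] :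
    GradedObject.HasTensor₄ObjExt X₁ X₂ X₃ X₄ := fun _ _ =>
  preservesColimit_of_finite_support _ _ (finite_support_comp
    ((((GradedObject.mapTrifunctor (bifunctorComp₂₃ (curriedTensor C)
      (curriedTensor C)) I I I).obj X₂).obj X₃).obj X₄) _ Subtype.val_injective)

lemma isZero_mapObj {I J : Type*} (X : GradedObject I C) (p : I → J) [X.HasMap p] (j : J)
    (h : ∀ i, p i = j → IsZero (X i)) : IsZero (X.mapObj p j) := by
  rw [IsZero.iff_id_eq_zero]
  apply GradedObject.mapObj_ext
  intro i hi
  exact (h i hi).eq_of_src _ _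

instance finSupp_mapObj {I J : Type*} (X : GradedObject I C) (p : I → J) [X.HasMap p]
    [FinSupp X] : FinSupp (X.mapObj p) where
  finite := by
    refine ((FinSupp.finite (X := X)).image p).subset ?_
    intro j hj
    by_contra h
    apply hj
    apply isZero_mapObj
    intro i hi
    by_contra hi'
    exact h ⟨i, hi', hi⟩

instance (X₁ X₂ : GradedObject I C) [FinSupp X₁] [FinSupp X₂] :
    FinSupp (GradedObject.Monoidal.tensorObj X₁ X₂) :=
  inferInstanceAs (FinSupp (GradedObject.mapObj
    (((GradedObject.mapBifunctor (curriedTensor C) I I).obj X₁).obj X₂) _))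

instance [DecidableEq I] (X : C) : FinSupp ((GradedObject.single₀ I).obj X) where
  finite := by
    refine (Set.finite_singleton (0 : I)).subset ?_
    intro i hi
    by_contra h
    apply hi
    rw [IsZero.iff_id_eq_zero]
    exact (GradedObject.isInitialSingleObjApply (0 : I) X i h).hom_ext _ _

end GradedFinite

section BoundedComplexes

variable (C : Type u) [Category.{v} C] [Abelian C]

/-- The property of being a bounded cochain complex. -/
def isBoundedCx : ObjectProperty (CochainComplex C ℤ) :=
  fun K => ∃ a b : ℤ, K.IsStrictlyGE a ∧ K.IsStrictlyLE b

/-- The category of bounded cochain complexes in `C`. -/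
abbrev Cb : Type (max u v) := (isBoundedCx C).FullSubcategory

variable {C}

lemma isBoundedCx_iff (K : CochainComplex C ℤ) :
    isBoundedCx C K ↔ {n | ¬ IsZero (K.X n)}.Finite := by
  constructor
  · rintro ⟨a, b, ha, hb⟩
    refine (Set.finite_Icc a b).subset (fun n hn => ⟨?_, ?_⟩)
    · by_contra! h
      exact hn (K.isZero_of_isStrictlyGE a n h)
    · by_contra! h
      exact hn (K.isZero_of_isStrictlyLE b n h)
  · intro h
    obtain ⟨a, ha⟩ := h.bddBelow
    obtain ⟨b, hb⟩ := h.bddAbove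
    refine ⟨a, b, ?_, ?_⟩
    · rw [CochainComplex.isStrictlyGE_iff]
      intro i hi
      by_contra h'
      have := ha h'
      lia
    · rw [CochainComplex.isStrictlyLE_iff]
      intro i hi
      by_contra h'
      have := hb h'
      lia

instance (K : Cb C) : FinSupp K.obj.X := ⟨(isBoundedCx_iff _).1 K.2⟩

lemma isBoundedCx_of_finSupp (K : CochainComplex C ℤ) [h : FinSupp K.X] : isBoundedCx C K :=
  (isBoundedCx_iff _).2 h.finite

end BoundedComplexes

section MonoidalBounded

variable (C : Type u) [Category.{v} C] [Abelian C] [MonoidalCategory C] [MonoidalPreadditive C]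

/-- Graded objects with finitely many nonzero components. -/
def isFinGr : ObjectProperty (GradedObject ℤ C) := fun X => FinSupp X

/-- The category of graded objects with finitely many nonzero components. -/
abbrev GrFin : Type u := (isFinGr C).FullSubcategory

instance (X : GrFin C) : FinSupp X.obj := X.2

end MonoidalBounded
section MonoidalBounded

variable (C : Type u) [Category.{v} C] [Abelian C] [MonoidalCategory C] [MonoidalPreadditive C]

instance finSupp_tensorUnit : FinSupp (GradedObject.Monoidal.tensorUnit : GradedObject ℤ C) :=
  inferInstanceAs (FinSupp ((GradedObject.single₀ ℤ).obj (𝟙_ C)))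

noncomputable instance grFinStruct : MonoidalCategoryStruct (GrFin C) where
  tensorObj X Y := ⟨GradedObject.Monoidal.tensorObj X.obj Y.obj,
    (inferInstance : FinSupp _)⟩
  tensorHom f g := ⟨GradedObject.Monoidal.tensorHom f.hom g.hom⟩
  whiskerLeft X _ _ φ := ⟨GradedObject.Monoidal.whiskerLeft X.obj φ.hom⟩
  whiskerRight {_ _} φ Y := ⟨GradedObject.Monoidal.whiskerRight φ.hom Y.obj⟩
  tensorUnit := ⟨GradedObject.Monoidal.tensorUnit,
    (inferInstance : FinSupp ((GradedObject.single₀ ℤ).obj (𝟙_ C)))⟩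
  associator X₁ X₂ X₃ := ObjectProperty.isoMk _
    (GradedObject.Monoidal.associator X₁.obj X₂.obj X₃.obj)
  leftUnitor X := ObjectProperty.isoMk _ (GradedObject.Monoidal.leftUnitor X.obj)
  rightUnitor X := ObjectProperty.isoMk _ (GradedObject.Monoidal.rightUnitor X.obj)

noncomputable instance grFinMonoidal : MonoidalCategory (GrFin C) where
  tensorHom_def f g := by
    ext1
    exact GradedObject.Monoidal.tensorHom_def f.hom g.hom
  id_tensorHom_id X Y := by
    ext1
    exact GradedObject.Monoidal.id_tensorHom_id X.obj Y.obj
  tensorHom_comp_tensorHom f₁ f₂ g₁ g₂ := by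
    ext1
    exact GradedObject.Monoidal.tensorHom_comp_tensorHom f₁.hom g₁.hom f₂.hom g₂.hom
  whiskerLeft_id X Y := by
    ext1
    exact GradedObject.Monoidal.id_tensorHom_id X.obj Y.obj
  id_whiskerRight X Y := by
    ext1
    exact GradedObject.Monoidal.id_tensorHom_id X.obj Y.obj
  associator_naturality f₁ f₂ f₃ := by
    ext1
    exact GradedObject.Monoidal.associator_naturality f₁.hom f₂.hom f₃.hom
  leftUnitor_naturality f := by
    ext1
    exact GradedObject.Monoidal.leftUnitor_naturality f.hom
  rightUnitor_naturality f := by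
    ext1
    exact GradedObject.Monoidal.rightUnitor_naturality f.hom
  pentagon X₁ X₂ X₃ X₄ := by
    ext1
    exact GradedObject.Monoidal.pentagon X₁.obj X₂.obj X₃.obj X₄.obj
  triangle X₁ X₂ := by
    ext1
    exact GradedObject.Monoidal.triangle X₁.obj X₂.obj

variable {C} in
lemma finSupp_of_iso {X Y : GradedObject ℤ C} (e : X ≅ Y) [FinSupp X] : FinSupp Y where
  finite := (FinSupp.finite (X := X)).subset
    (fun i hi hi' => hi (hi'.of_iso ((GradedObject.eval i).mapIso e).symm))

lemma isBoundedCx_tensorUnit :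
    isBoundedCx C (HomologicalComplex.tensorUnit C (ComplexShape.up ℤ)) := by
  have : FinSupp (HomologicalComplex.tensorUnit C (ComplexShape.up ℤ)).X :=
    finSupp_of_iso (X := (GradedObject.single₀ ℤ).obj (𝟙_ C))
      (HomologicalComplex.tensorUnitIso C (ComplexShape.up ℤ))
  exact isBoundedCx_of_finSupp _

instance (K L : CochainComplex C ℤ) [FinSupp K.X] [FinSupp L.X] :
    FinSupp (HomologicalComplex.tensorObj K L).X :=
  inferInstanceAs (FinSupp (GradedObject.Monoidal.tensorObj K.X L.X))

lemma isBoundedCx_tensorObj (K L : Cb C) :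
    isBoundedCx C (HomologicalComplex.tensorObj K.obj L.obj) :=
  isBoundedCx_of_finSupp _

/-- The tensor product of bounded complexes is the total complex of the double complex `K ⊗ L`
(with the usual signs); the unit is the unit object placed in degree zero. -/
noncomputable instance cbStruct : MonoidalCategoryStruct (Cb C) where
  tensorObj K L := ⟨HomologicalComplex.tensorObj K.obj L.obj, isBoundedCx_tensorObj C K L⟩
  tensorHom f g := ⟨HomologicalComplex.tensorHom f.hom g.hom⟩
  whiskerLeft _ _ _ g := ⟨HomologicalComplex.tensorHom (𝟙 _) g.hom⟩
  whiskerRight f _ := ⟨HomologicalComplex.tensorHom f.hom (𝟙 _)⟩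
  tensorUnit := ⟨HomologicalComplex.tensorUnit C _, isBoundedCx_tensorUnit C⟩
  associator K₁ K₂ K₃ := ObjectProperty.isoMk _
    (HomologicalComplex.associator K₁.obj K₂.obj K₃.obj)
  leftUnitor K := ObjectProperty.isoMk _ (HomologicalComplex.leftUnitor K.obj)
  rightUnitor K := ObjectProperty.isoMk _ (HomologicalComplex.rightUnitor K.obj)

/-- The functor sending a bounded complex to its graded object of components. -/
def cbForget : Cb C ⥤ GrFin C :=
  ObjectProperty.lift _ ((isBoundedCx C).ι ⋙ HomologicalComplex.forget C (ComplexShape.up ℤ))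
    (fun K => (inferInstance : FinSupp K.obj.X))

instance : (cbForget C).Faithful where
  map_injective {K L f g} h := by
    ext n
    exact congr_fun (congr_arg InducedCategory.Hom.hom h) n

lemma associator_aux {M : Type*} [Category* M] [MonoidalCategory M] (X Y Z : M) :
    (((Iso.refl ((X ⊗ Y) ⊗ Z)).symm ≪≫ ((Iso.refl (X ⊗ Y)).symm ⊗ᵢ Iso.refl Z)) ≪≫ α_ X Y Z ≪≫
      ((Iso.refl X ⊗ᵢ Iso.refl (Y ⊗ Z)) ≪≫ Iso.refl (X ⊗ (Y ⊗ Z)))).hom = (α_ X Y Z).hom := by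
  simp

noncomputable def cbInducingFunctorData : Monoidal.InducingFunctorData (cbForget C) where
  μIso _ _ := Iso.refl _
  εIso := ObjectProperty.isoMk _ (HomologicalComplex.tensorUnitIso C (ComplexShape.up ℤ))
  whiskerLeft_eq K₁ K₂ L₂ g := by
    erw [id_comp, comp_id]
    rfl
  whiskerRight_eq {K₁ L₁} f K₂ := by
    erw [id_comp, comp_id]
    rfl
  tensorHom_eq {K₁ L₁ K₂ L₂} f g := by
    erw [id_comp, comp_id]
    rfl
  associator_eq K₁ K₂ K₃ := (associator_aux ((cbForget C).obj K₁) ((cbForget C).obj K₂)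
    ((cbForget C).obj K₃)).symm
  leftUnitor_eq K := by
    dsimp
    erw [id_comp]
    rfl
  rightUnitor_eq K := by
    dsimp
    erw [id_comp]
    rfl

/-- The monoidal category of bounded complexes. -/
noncomputable instance cbMonoidal : MonoidalCategory (Cb C) :=
  Monoidal.induced _ (cbInducingFunctorData C)

end MonoidalBounded

section BoundedLocalization

open scoped ZeroObject

variable (C : Type u) [Category.{v} C] [Abelian C]

variable {C} in
/-- A bounded complex, as an object of the category of bounded below complexes. -/
def cbToPlus : Cb C ⥤ CochainComplex.Plus C :=
  ObjectProperty.lift _ (isBoundedCx C).ι (by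
    rintro ⟨K, a, b, ha, hb⟩
    exact ⟨a, ha⟩)

/-- The property of being isomorphic to a bounded complex, in the bounded below homotopy
category. -/
def isBoundedK : ObjectProperty (HomotopyCategory.Plus C) :=
  fun X => ∃ K : Cb C, Nonempty (X ≅ (HomotopyCategory.Plus.quotient C).obj (cbToPlus.obj K))

/-- The homotopy category of bounded complexes. -/
abbrev Kb := (isBoundedK C).FullSubcategory

instance : (isBoundedK C).IsClosedUnderIsomorphisms where
  of_iso := by
    rintro X Y e ⟨K, ⟨e'⟩⟩
    exact ⟨K, ⟨e.symm ≪≫ e'⟩⟩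

instance : (isBoundedK C).ContainsZero where
  exists_zero := by
    refine ⟨(HomotopyCategory.Plus.quotient C).obj (cbToPlus.obj ⟨0, 0, 0, inferInstance,
      inferInstance⟩), ?_, _, ⟨Iso.refl _⟩⟩
    have h := (HomotopyCategory.quotient C (ComplexShape.up ℤ)).map_isZero (isZero_zero _)
    rw [IsZero.iff_id_eq_zero] at h ⊢
    ext
    exact h

instance : (isBoundedK C).IsStableUnderShift ℤ where
  isStableUnderShiftBy n :=
    { le_shift X hX := by
        obtain ⟨⟨K, a, b, ha, hb⟩, ⟨e⟩⟩ := hX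
        refine ⟨⟨K⟦n⟧, a - n, b - n, K.isStrictlyGE_shift a n _ (by lia),
          K.isStrictlyLE_shift b n _ (by lia)⟩, ⟨(HomotopyCategory.Plus.ι C).preimageIso ?_⟩⟩
        exact (((HomotopyCategory.Plus.ι C).commShiftIso n).app X) ≪≫
          (shiftFunctor _ n).mapIso ((HomotopyCategory.Plus.ι C).mapIso e) ≪≫
          (((HomotopyCategory.quotient C (ComplexShape.up ℤ)).commShiftIso n).app K).symm }

lemma isStrictlyLE_mappingCone {K L : CochainComplex C ℤ} (f : K ⟶ L)
    (n₁ n₂ n : ℤ) [K.IsStrictlyLE n₁] [L.IsStrictlyLE n₂] (hn₁ : n₁ - 1 ≤ n)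
    (hn₂ : n₂ ≤ n) :
    (CochainComplex.mappingCone f).IsStrictlyLE n := by
  rw [CochainComplex.isStrictlyLE_iff]
  intro i hi
  simp only [CochainComplex.mappingCone.isZero_X_iff]
  exact ⟨K.isZero_of_isStrictlyLE n₁ _, L.isZero_of_isStrictlyLE n₂ _⟩

lemma isBoundedCx_mappingCone {K L : Cb C} (f : K ⟶ L) :
    isBoundedCx C (CochainComplex.mappingCone f.hom) := by
  obtain ⟨K, a, b, ha, hb⟩ := K
  obtain ⟨L, a', b', ha', hb'⟩ := L
  exact ⟨min (a - 1) a', max (b - 1) b',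
    CochainComplex.isStrictlyGE_mappingCone f.hom a a' _ (by simp) (by simp),
    isStrictlyLE_mappingCone C f.hom b b' _ (by simp) (by simp)⟩

instance : (isBoundedK C).IsTriangulatedClosed₃ where
  ext₃' T hT h₁ h₂ := by
    obtain ⟨K, ⟨e₁⟩⟩ := h₁
    obtain ⟨L, ⟨e₂⟩⟩ := h₂
    obtain ⟨f : K.obj ⟶ L.obj, hf⟩ :=
      (HomotopyCategory.quotient _ _).map_surjective (e₁.inv ≫ T.mor₁ ≫ e₂.hom).hom
    have hT' := (HomotopyCategory.Plus.ι C).map_distinguished _ hT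
    let e := Triangle.π₃.mapIso (isoTriangleOfIso₁₂ _ _ hT'
      (HomotopyCategory.mappingCone_triangleh_distinguished f)
        ((HomotopyCategory.Plus.ι C).mapIso e₁) ((HomotopyCategory.Plus.ι C).mapIso e₂) (by
          have h : (HomotopyCategory.Plus.ι C).map (T.mor₁ ≫ e₂.hom) =
            (HomotopyCategory.Plus.ι C).map e₁.hom ≫
              (HomotopyCategory.Plus.ι C).map (e₁.inv ≫ T.mor₁ ≫ e₂.hom) := by
            rw [← Functor.map_comp, Iso.hom_inv_id_assoc]
          exact h.trans (congr_arg (fun g => (HomotopyCategory.Plus.ι C).map e₁.hom ≫ g)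
            hf.symm)))
    exact ObjectProperty.le_isoClosure _ _ ⟨⟨_, isBoundedCx_mappingCone C (K := K) (L := L) ⟨f⟩⟩,
      ⟨(HomotopyCategory.Plus.ι C).preimageIso e⟩⟩

instance : (isBoundedK C).IsTriangulated where
  toIsTriangulatedClosed₂ := .of_isTriangulatedClosed₃

lemma acyclic_truncLE {K : CochainComplex C ℤ} (hK : K.Acyclic) (n : ℤ) :
    (K.truncLE n).Acyclic := by
  rw [CochainComplex.acyclic_truncLE_iff K n (n + 1)]
  rw [CochainComplex.isGE_iff]
  intro i _
  exact hK i

lemma exists_factor_truncLE {L K : CochainComplex C ℤ} (n : ℤ) [L.IsStrictlyLE n] (ψ : L ⟶ K) :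
    ∃ r : L ⟶ K.truncLE n, r ≫ K.ιTruncLE n = ψ :=
  ⟨inv (L.ιTruncLE n) ≫ CochainComplex.truncLEMap ψ n, by simp⟩

instance : (isBoundedK C).IsVerdierLeftLocalizing
    (HomotopyCategory.Plus.subcategoryAcyclic C) where
  fac {X K} φ hX hK := by
    obtain ⟨⟨L, a, n, ha, hn⟩, ⟨e⟩⟩ := hX
    obtain ⟨K, rfl⟩ := HomotopyCategory.Plus.quotient_obj_surjective K
    obtain ⟨ψ, hψ⟩ := (HomotopyCategory.Plus.quotient _).map_surjective (e.inv ≫ φ)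
    replace hK : K.obj.Acyclic := by
      rw [← HomotopyCategory.quotient_obj_mem_subcategoryAcyclic_iff_acyclic]
      exact hK
    have hn' : L.IsStrictlyLE n := hn
    obtain ⟨r, hr⟩ := exists_factor_truncLE C (L := L) (K := K.obj) n ψ.hom
    let T : Cb C := ⟨K.obj.truncLE n, by
      obtain ⟨a, _⟩ := K.property
      exact ⟨a, n, inferInstance, inferInstance⟩⟩
    let a : cbToPlus.obj ⟨L, a, n, ha, hn⟩ ⟶ cbToPlus.obj T :=
⟨r⟩
    let b : cbToPlus.obj T ⟶ K := ⟨K.obj.ιTruncLE n⟩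
    refine ⟨(HomotopyCategory.Plus.quotient _).obj (cbToPlus.obj T),
      e.hom ≫ (HomotopyCategory.Plus.quotient _).map a,
      (HomotopyCategory.Plus.quotient _).map b, ⟨T, ⟨Iso.refl _⟩⟩, ?_, ?_⟩
    · change HomotopyCategory.subcategoryAcyclic C ((HomotopyCategory.quotient _ _).obj _)
      rw [HomotopyCategory.quotient_obj_mem_subcategoryAcyclic_iff_acyclic]
      exact acyclic_truncLE C hK n
    · have hab : a ≫ b = ψ := by
        ext1
        exact hr
      rw [assoc, ← Functor.map_comp, hab, hψ, Iso.hom_inv_id_assoc]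

/-- The functor from bounded complexes to the homotopy category of bounded complexes. -/
def cbToKb : Cb C ⥤ Kb C :=
  ObjectProperty.lift _ (cbToPlus ⋙ HomotopyCategory.Plus.quotient C)
    (fun K => ⟨K, ⟨Iso.refl _⟩⟩)

instance : (cbToKb C).EssSurj where
  mem_essImage X := by
    obtain ⟨K, ⟨e⟩⟩ := X.property
    exact ⟨K, ⟨(isBoundedK C).ι.preimageIso e.symm⟩⟩

instance : (cbToKb C).Full where
  map_surjective {K L} f := by
    obtain ⟨g, hg⟩ := (HomotopyCategory.quotient _ _).map_surjective f.hom.hom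
    refine ⟨⟨g⟩, ?_⟩
    ext
    exact hg

/-- The class of quasi-isomorphisms between bounded complexes. -/
def quasiIsoCb : MorphismProperty (Cb C) :=
  (HomologicalComplex.quasiIso C (ComplexShape.up ℤ)).inverseImage (isBoundedCx C).ι

lemma isBoundedCx_cylinder (K : Cb C) : isBoundedCx C K.obj.cylinder := by
  obtain ⟨K, a, b, ha, hb⟩ := K
  refine ⟨a - 1, b + 1, ?_, ?_⟩
  · rw [CochainComplex.isStrictlyGE_iff]
    intro i hi
    refine HomologicalComplex.homotopyCofiber.isZero_X (biprod.lift (𝟙 K) (-𝟙 K)) _ ?_ (fun j hj ↦ ?_)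
    · refine IsZero.of_iso ?_ ((HomologicalComplex.eval C (.up ℤ) i).mapBiprod _ _)
      simpa using K.isZero_of_isStrictlyGE a i
    · simp only [ComplexShape.up_Rel] at hj
      exact K.isZero_of_isStrictlyGE a _ (by lia)
  · rw [CochainComplex.isStrictlyLE_iff]
    intro i hi
    refine HomologicalComplex.homotopyCofiber.isZero_X (biprod.lift (𝟙 K) (-𝟙 K)) _ ?_ (fun j hj ↦ ?_)
    · refine IsZero.of_iso ?_ ((HomologicalComplex.eval C (.up ℤ) i).mapBiprod _ _)
      simpa using K.isZero_of_isStrictlyLE b i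
    · simp only [ComplexShape.up_Rel] at hj
      exact K.isZero_of_isStrictlyLE b _ (by lia)

instance cbToKb_isLocalization : (cbToKb C).IsLocalization
    ((HomologicalComplex.homotopyEquivalences C (.up ℤ)).inverseImage (isBoundedCx C).ι) :=
  Functor.isLocalization_of_essSurj_of_full_of_exists_cylinders _ _
    (fun K L f hf ↦ by
      have h : IsIso ((HomotopyCategory.quotient C (.up ℤ)).map f.hom) := by
        have := HomotopyCategory.inverseImage_quotient_isomorphisms C (.up ℤ)
        have h2 : ((MorphismProperty.isomorphisms _).inverseImage
          (HomotopyCategory.quotient C (.up ℤ))) f.hom := by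
          rw [this]; exact hf
        exact h2
      have h' : IsIso (((isBoundedK C).ι ⋙ HomotopyCategory.Plus.ι C).map
        ((cbToKb C).map f)) := h
      exact isIso_of_reflects_iso _ ((isBoundedK C).ι ⋙ HomotopyCategory.Plus.ι C)) (by
    rintro K L f₀ f₁ hf
    obtain ⟨f₀, rfl⟩ := ObjectProperty.homMk_surjective f₀
    obtain ⟨f₁, rfl⟩ := ObjectProperty.homMk_surjective f₁
    replace hf := HomotopyCategory.homotopyOfEq f₀ f₁
      (((isBoundedK C).ι ⋙ HomotopyCategory.Plus.ι C).congr_map hf)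
    exact ⟨(HomologicalComplex.precylinder K.obj).toFullSubcategory (isBoundedCx_cylinder C K),
      HomotopicalAlgebra.Precylinder.LeftHomotopy.fullSubcategoryEquiv.symm
      { h := HomologicalComplex.cylinder.desc _ _ hf
        h₀ := HomologicalComplex.cylinder.ι₀_desc _ _ _
        h₁ := HomologicalComplex.cylinder.ι₁_desc _ _ _ },
      ⟨HomologicalComplex.cylinder.homotopyEquiv _ (fun n ↦ ⟨n - 1, by simp⟩), rfl⟩⟩)

variable [HasDerivedCategory.{w} C]

/-- The bounded derived category. -/
abbrev Db := DerivedCategory.Bounded C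

/-- The functor from the homotopy category of bounded complexes to the bounded derived category. -/
noncomputable def kbToDb : Kb C ⥤ Db C :=
  ObjectProperty.lift _
    ((isBoundedK C).ι ⋙ HomotopyCategory.Plus.ι C ⋙ DerivedCategory.Qh) (by
    rintro ⟨X, ⟨⟨K, a, b, ha, hb⟩, ⟨e⟩⟩⟩
    have hb' : (DerivedCategory.Q.obj K).IsLE b := inferInstance
    have ha' : (DerivedCategory.Q.obj K).IsGE a := inferInstance
    let e' := (DerivedCategory.Qh.mapIso ((HomotopyCategory.Plus.ι C).mapIso e) ≪≫
      (DerivedCategory.quotientCompQhIso C).app K).symm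
    exact ⟨⟨a, DerivedCategory.TStructure.t.isGE_of_iso e' a⟩,
      ⟨b, DerivedCategory.TStructure.t.isLE_of_iso e' b⟩⟩)

/-- The functor from bounded complexes to the bounded derived category. -/
noncomputable def cbToDb : Cb C ⥤ Db C :=
  ObjectProperty.lift _ ((isBoundedCx C).ι ⋙ DerivedCategory.Q) (by
    rintro ⟨K, a, b, ha, hb⟩
    replace hb : K.IsStrictlyLE b := hb
    exact ⟨⟨a, (inferInstance : (DerivedCategory.Q.obj K).IsGE a)⟩,
      ⟨b, (inferInstance : (DerivedCategory.Q.obj K).IsLE b)⟩⟩)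

instance : (cbToDb C).EssSurj where
  mem_essImage := by
    rintro ⟨X, ⟨a, ha⟩, ⟨b, hb⟩⟩
    obtain ⟨K, _, _, ⟨e⟩⟩ := X.exists_iso_Q_obj_of_isGE_of_isLE a b
    exact ⟨⟨K, a, b, inferInstance, inferInstance⟩,
      ⟨DerivedCategory.Bounded.ι.preimageIso e.symm⟩⟩

/-- The functor on bounded complexes factors through the homotopy category. -/
noncomputable def cbToKbCompIso : cbToKb C ⋙ kbToDb C ≅ cbToDb C :=
  ((ObjectProperty.fullyFaithfulι _).whiskeringRight _).preimageIso
    (Functor.isoWhiskerLeft (isBoundedCx C).ι (DerivedCategory.quotientCompQhIso C))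

instance : (kbToDb C).EssSurj :=
  have : (cbToKb C ⋙ kbToDb C).EssSurj := Functor.essSurj_of_iso (cbToKbCompIso C).symm
  ⟨fun X => ⟨(cbToKb C).obj ((cbToKb C ⋙ kbToDb C).objPreimage X),
    ⟨(cbToKb C ⋙ kbToDb C).objObjPreimageIso X⟩⟩⟩

/-- The inclusion of the bounded derived category in the bounded below derived category. -/
noncomputable def dbToPlus : Db C ⥤ DerivedCategory.Plus C :=
  ObjectProperty.lift _ DerivedCategory.Bounded.ι (fun X => X.property.1)

instance : (dbToPlus C).Full := by dsimp [dbToPlus]; infer_instance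
instance : (dbToPlus C).Faithful := by dsimp [dbToPlus]; infer_instance

instance kbToDb_isLocalization : (kbToDb C).IsLocalization
    ((HomotopyCategory.Plus.subcategoryAcyclic C).inverseImage (isBoundedK C).ι).trW :=
  ((isBoundedK C).triangulatedLocalizerMorphism
    (HomotopyCategory.Plus.subcategoryAcyclic C)).isLocalization_of_isLocalizedFullyFaithful
      (L₂ := DerivedCategory.Plus.Qh) (F := dbToPlus C) (Iso.refl _)

lemma cbToDb_inverts : (quasiIsoCb C).IsInvertedBy (cbToDb C) := fun K L f hf => by
  have : IsIso (DerivedCategory.Bounded.ι.map ((cbToDb C).map f)) := by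
    change IsIso (DerivedCategory.Q.map f.hom)
    rw [DerivedCategory.isIso_Q_map_iff_quasiIso]
    exact hf
  exact isIso_of_reflects_iso _ DerivedCategory.Bounded.ι

instance cbToDb_isLocalization : (cbToDb C).IsLocalization (quasiIsoCb C) := by
  have : (cbToKb C ⋙ kbToDb C).IsLocalization (quasiIsoCb C) := by
    refine Functor.IsLocalization.comp (cbToKb C) (kbToDb C)
      ((HomologicalComplex.homotopyEquivalences C (.up ℤ)).inverseImage (isBoundedCx C).ι)
      ((HomotopyCategory.Plus.subcategoryAcyclic C).inverseImage (isBoundedK C).ι).trW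
      (quasiIsoCb C) ?_ ?_ ?_
    · rw [MorphismProperty.IsInvertedBy.iff_of_iso _ (cbToKbCompIso C)]
      exact cbToDb_inverts C
    · rintro K L f hf
      exact homotopyEquivalences_le_quasiIso _ _ _ hf
    · intro K L f hf
      have hf' : IsIso ((kbToDb C).map f) := Localization.inverts (kbToDb C) _ f hf
      let eK := (cbToKb C).objObjPreimageIso K
      let eL := (cbToKb C).objObjPreimageIso L
      obtain ⟨g, hg⟩ := (cbToKb C).map_surjective (eK.hom ≫ f ≫ eL.inv)
      refine ⟨_, _, g, ?_, ⟨Arrow.isoMk eK eL ?_⟩⟩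
      · have h1 : IsIso ((cbToDb C).map g) := by
          rw [← NatIso.isIso_map_iff (cbToKbCompIso C)]
          change IsIso ((kbToDb C).map ((cbToKb C).map g))
          rw [hg, Functor.map_comp, Functor.map_comp]
          infer_instance
        have h2 : IsIso (DerivedCategory.Bounded.ι.map ((cbToDb C).map g)) := inferInstance
        exact (DerivedCategory.isIso_Q_map_iff_quasiIso (φ := g.hom)).1 h2
      · change eK.hom ≫ f = (cbToKb C).map g ≫ eL.hom
        rw [hg]
        simp
  exact Functor.IsLocalization.of_iso _ (cbToKbCompIso C)

end BoundedLocalization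

section CoproductExact

variable {D : Type*} [Category* D] [Abelian D] {J : Type*}

open Classical in
/-- The projection from a coproduct to one of its summands. -/
noncomputable def cofanProj {f : J → D} {c : Cofan f} (hc : IsColimit c) (t : J) : c.pt ⟶ f t :=
  Cofan.IsColimit.desc hc (fun s => if h : s = t then eqToHom (by rw [h]) else 0)

lemma inj_cofanProj_self {f : J → D} {c : Cofan f} (hc : IsColimit c) (t : J) :
    c.inj t ≫ cofanProj hc t = 𝟙 _ := by
  simp [cofanProj]

lemma inj_cofanProj_ne {f : J → D} {c : Cofan f} (hc : IsColimit c) (s t : J) (h : s ≠ t) :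
    c.inj s ≫ cofanProj hc t = 0 := by
  simp [cofanProj, h]

lemma sum_cofanProj {f : J → D} {c : Cofan f} (hc : IsColimit c) (T : Finset J)
    (hT : ∀ t, t ∉ T → IsZero (f t)) :
    ∑ t ∈ T, cofanProj hc t ≫ c.inj t = 𝟙 _ := by
  classical
  apply Cofan.IsColimit.hom_ext hc
  intro s
  rw [Preadditive.comp_sum, comp_id]
  by_cases hs : s ∈ T
  · rw [Finset.sum_eq_single_of_mem s hs, ← assoc, inj_cofanProj_self, id_comp]
    intro t _ hts
    rw [← assoc, inj_cofanProj_ne hc s t hts.symm, zero_comp]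
  · exact (hT s hs).eq_of_src _ _

lemma isIso_inj {f : J → D} {c : Cofan f} (hc : IsColimit c) (t : J)
    (ht : ∀ s, s ≠ t → IsZero (f s)) : IsIso (c.inj t) :=
  ⟨cofanProj hc t, inj_cofanProj_self hc t, by
    have := sum_cofanProj hc {t} (fun s hs => ht s (by simpa using hs))
    simpa using this⟩

lemma shortExact_of_cofan {X Y Z : J → D} {f : ∀ j, X j ⟶ Y j} {g : ∀ j, Y j ⟶ Z j}
    (w : ∀ j, f j ≫ g j = 0) (h : ∀ j, (ShortComplex.mk (f j) (g j) (w j)).ShortExact)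
    {cX : Cofan X} {cY : Cofan Y} {cZ : Cofan Z} (hX : IsColimit cX) (hY : IsColimit cY)
    (hZ : IsColimit cZ) (φ : cX.pt ⟶ cY.pt) (ψ : cY.pt ⟶ cZ.pt) (hφψ : φ ≫ ψ = 0)
    (hf : ∀ j, cX.inj j ≫ φ = f j ≫ cY.inj j) (hg : ∀ j, cY.inj j ≫ ψ = g j ≫ cZ.inj j)
    (hfin : {j | ¬ IsZero (Y j)}.Finite) : (ShortComplex.mk φ ψ hφψ).ShortExact := by
  have hmono : ∀ j, Mono (f j) := fun j => (h j).mono_f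
  have hepi : ∀ j, Epi (g j) := fun j => (h j).epi_g
  let T := hfin.toFinset
  have hT : ∀ t, t ∉ T → IsZero (Y t) := fun t ht => by simpa [T] using ht
  have hTX : ∀ t, t ∉ T → IsZero (X t) := fun t ht => by
    rw [IsZero.iff_id_eq_zero, ← cancel_mono (f t)]
    exact (hT t ht).eq_of_tgt _ _
  have hφ : ∀ t, φ ≫ cofanProj hY t = cofanProj hX t ≫ f t := fun t => by
    apply Cofan.IsColimit.hom_ext hX
    intro s
    rw [← assoc, hf, assoc, ← assoc (cX.inj s)]
    by_cases hst : s = t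
    · subst hst
      rw [inj_cofanProj_self, inj_cofanProj_self, id_comp, comp_id]
    · rw [inj_cofanProj_ne hX s t hst, inj_cofanProj_ne hY s t hst, comp_zero, zero_comp]
  have hψ : ∀ t, ψ ≫ cofanProj hZ t = cofanProj hY t ≫ g t := fun t => by
    apply Cofan.IsColimit.hom_ext hY
    intro s
    rw [← assoc, hg, assoc, ← assoc (cY.inj s)]
    by_cases hst : s = t
    · subst hst
      rw [inj_cofanProj_self, inj_cofanProj_self, id_comp, comp_id]
    · rw [inj_cofanProj_ne hY s t hst, inj_cofanProj_ne hZ s t hst, comp_zero, zero_comp]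
  have m : Mono φ := by
    rw [Preadditive.mono_iff_cancel_zero]
    intro W x hx
    rw [← comp_id x, ← sum_cofanProj hX T hTX, Preadditive.comp_sum]
    refine Finset.sum_eq_zero (fun t _ => ?_)
    have : x ≫ cofanProj hX t = 0 := by
      rw [← cancel_mono (f t), assoc, ← hφ, ← assoc, hx, zero_comp, zero_comp]
    rw [← assoc, this, zero_comp]
  have e : Epi ψ := by
    rw [Preadditive.epi_iff_cancel_zero]
    intro W x hx
    apply Cofan.IsColimit.hom_ext hZ
    intro s
    rw [comp_zero, ← cancel_epi (g s), ← assoc, ← hg, assoc, hx, comp_zero, comp_zero]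
  have hex : (ShortComplex.mk φ ψ hφψ).Exact := by
    apply ShortComplex.exact_of_f_is_kernel
    refine KernelFork.IsLimit.ofι _ _
      (fun {W} x hx => ∑ t ∈ T, ((h t).exact.lift (x ≫ cofanProj hY t) (by
        change (x ≫ cofanProj hY t) ≫ g t = 0
        rw [assoc, ← hψ, ← assoc, hx, zero_comp])) ≫ cX.inj t)
      (fun {W} x hx => by
        rw [Preadditive.sum_comp]
        conv_rhs => rw [← comp_id x, ← sum_cofanProj hY T hT, Preadditive.comp_sum]
        refine Finset.sum_congr rfl (fun t _ => ?_)
        rw [assoc]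
        change _ ≫ cX.inj t ≫ φ = _
        rw [hf]
        refine (assoc _ _ _).symm.trans (Eq.trans ?_ (assoc _ _ _))
        congr 1
        exact (h t).exact.lift_f _ _)
      (fun {W} x hx m' hm' => by
        rw [← cancel_mono φ]
        refine Eq.trans hm' ?_
        rw [Preadditive.sum_comp]
        conv_lhs => rw [← comp_id x, ← sum_cofanProj hY T hT, Preadditive.comp_sum]
        refine Finset.sum_congr rfl (fun t _ => ?_)
        rw [assoc, hf]
        refine (assoc _ _ _).symm.trans (Eq.trans ?_ (assoc _ _ _))
        congr 1
        exact ((h t).exact.lift_f _ _).symm)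
  exact { exact := hex }

end CoproductExact

section FiveLemma

open HomologicalComplex HomologySequence ComposableArrows Abelian

variable {D : Type*} [Category* D] [Abelian D]

lemma quasiIso_τ₂ {S₁ S₂ : ShortComplex (CochainComplex D ℤ)} (φ : S₁ ⟶ S₂)
    (hS₁ : S₁.ShortExact) (hS₂ : S₂.ShortExact) (h₁ : QuasiIso φ.τ₁) (h₃ : QuasiIso φ.τ₃) :
    QuasiIso φ.τ₂ := by
  rw [quasiIso_iff]
  intro i
  rw [quasiIsoAt_iff_isIso_homologyMap]
  have hmono : Mono (homologyMap φ.τ₂ i) := by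
    have hij : (ComplexShape.up ℤ).Rel (i - 1) i := by simp
    refine mono_of_epi_of_mono_of_mono
      ((δ₀Functor ⋙ δ₀Functor).map (mapComposableArrows₅ φ hS₁ hS₂ (i - 1) i hij))
      (composableArrows₅_exact hS₁ _ i hij).δ₀.δ₀ (composableArrows₅_exact hS₂ _ i hij).δ₀.δ₀
      ?_ ?_ ?_
    · exact inferInstanceAs (Epi (homologyMap φ.τ₃ (i - 1)))
    · exact inferInstanceAs (Mono (homologyMap φ.τ₁ i))
    · exact inferInstanceAs (Mono (homologyMap φ.τ₃ i))
  have hepi : Epi (homologyMap φ.τ₂ i) := by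
    have hij : (ComplexShape.up ℤ).Rel i (i + 1) := by simp
    refine epi_of_epi_of_epi_of_mono
      ((δlastFunctor ⋙ δlastFunctor).map (mapComposableArrows₅ φ hS₁ hS₂ i (i + 1) hij))
      (composableArrows₅_exact hS₁ i _ hij).δlast.δlast
      (composableArrows₅_exact hS₂ i _ hij).δlast.δlast ?_ ?_ ?_
    · exact inferInstanceAs (Epi (homologyMap φ.τ₁ i))
    · exact inferInstanceAs (Epi (homologyMap φ.τ₃ i))
    · exact inferInstanceAs (Mono (homologyMap φ.τ₁ (i + 1)))
  exact isIso_of_mono_of_epi _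

end FiveLemma

section Bifunctor

variable {C₁ C₂ D : Type*} [Category* C₁] [Category* C₂] [Category* D]
  [Abelian C₁] [Abelian C₂] [Abelian D] (F : C₁ ⥤ C₂ ⥤ D) [F.Additive]
  [∀ X, (F.obj X).Additive]

instance hasMapBifunctor_of_finSupp (K : CochainComplex C₁ ℤ) (L : CochainComplex C₂ ℤ)
    [FinSupp K.X] [FinSupp L.X] :
    HomologicalComplex.HasMapBifunctor K L F (ComplexShape.up ℤ) := fun j =>
  hasCoproduct_of_finite_support _ <| by
    refine ((Set.Finite.prod (FinSupp.finite (X := K.X))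
      (FinSupp.finite (X := L.X))).preimage
      (f := fun (s : (ComplexShape.π (.up ℤ) (.up ℤ) (.up ℤ)) ⁻¹' {j}) => s.1)
      Subtype.val_injective.injOn).subset ?_
    rintro ⟨⟨i, k⟩, h⟩ h'
    refine ⟨fun h'' => h' ?_, fun h'' => h' ?_⟩
    · exact (F.flip.obj (L.X k)).map_isZero h''
    · exact (F.obj (K.X i)).map_isZero h''

lemma finite_support_fiber (K : CochainComplex C₁ ℤ) (L : CochainComplex C₂ ℤ)
    [FinSupp K.X] [FinSupp L.X] (j : ℤ) :
    {s : (ComplexShape.π (.up ℤ) (.up ℤ) (.up ℤ)) ⁻¹' {j} |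
      ¬ IsZero ((F.obj (K.X s.1.1)).obj (L.X s.1.2))}.Finite := by
  refine ((Set.Finite.prod (FinSupp.finite (X := K.X))
    (FinSupp.finite (X := L.X))).preimage
    (f := fun (s : (ComplexShape.π (.up ℤ) (.up ℤ) (.up ℤ)) ⁻¹' {j}) => s.1)
    Subtype.val_injective.injOn).subset ?_
  rintro ⟨⟨i, k⟩, h⟩ h'
  refine ⟨fun h'' => h' ?_, fun h'' => h' ?_⟩
  · exact (F.flip.obj (L.X k)).map_isZero h''
  · exact (F.obj (K.X i)).map_isZero h''

/-- The degree `j` part of the total complex is a coproduct. -/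
noncomputable def isColimitMapBifunctor (K : CochainComplex C₁ ℤ) (L : CochainComplex C₂ ℤ)
    [FinSupp K.X] [FinSupp L.X] (j : ℤ) :
    IsColimit (Cofan.mk (f := fun (s : (ComplexShape.π (.up ℤ) (.up ℤ) (.up ℤ)) ⁻¹' {j}) =>
        (F.obj (K.X s.1.1)).obj (L.X s.1.2))
      ((HomologicalComplex.mapBifunctor K L F (.up ℤ)).X j)
      (fun s => HomologicalComplex.ιMapBifunctor K L F (.up ℤ) s.1.1 s.1.2 j s.2)) :=
  GradedObject.isColimitCofanMapObj
    (((F.mapBifunctorHomologicalComplex (.up ℤ) (.up ℤ)).obj K).obj L).toGradedObject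
    (ComplexShape.π (.up ℤ) (.up ℤ) (.up ℤ)) j

lemma shortExact_mapBifunctor (S : ShortComplex (CochainComplex C₁ ℤ)) (hS : S.ShortExact)
    (L : CochainComplex C₂ ℤ) [FinSupp S.X₁.X] [FinSupp S.X₂.X] [FinSupp S.X₃.X] [FinSupp L.X]
    [∀ Y, PreservesFiniteLimits (F.flip.obj Y)] [∀ Y, PreservesFiniteColimits (F.flip.obj Y)]
    (w : HomologicalComplex.mapBifunctorMap S.f (𝟙 L) F (.up ℤ) ≫
      HomologicalComplex.mapBifunctorMap S.g (𝟙 L) F (.up ℤ) = 0) :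
    (ShortComplex.mk (HomologicalComplex.mapBifunctorMap S.f (𝟙 L) F (.up ℤ))
      (HomologicalComplex.mapBifunctorMap S.g (𝟙 L) F (.up ℤ)) w).ShortExact := by
  apply HomologicalComplex.shortExact_of_degreewise_shortExact
  intro j
  have hS' : ∀ (i k : ℤ), (S.map (HomologicalComplex.eval C₁ (.up ℤ) i ⋙
      F.flip.obj (L.X k))).ShortExact := fun i k => hS.map_of_exact _
  have hw : ∀ (s : (ComplexShape.π (.up ℤ) (.up ℤ) (.up ℤ)) ⁻¹' {j}),
      (F.map (S.f.f s.1.1)).app (L.X s.1.2) ≫ (F.map (S.g.f s.1.1)).app (L.X s.1.2) = 0 :=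
    fun s => (S.map (HomologicalComplex.eval C₁ (.up ℤ) s.1.1 ⋙ F.flip.obj (L.X s.1.2))).zero
  exact shortExact_of_cofan hw (fun s => hS' s.1.1 s.1.2)
    (isColimitMapBifunctor F S.X₁ L j) (isColimitMapBifunctor F S.X₂ L j)
    (isColimitMapBifunctor F S.X₃ L j) _ _ _
    (fun s => (HomologicalComplex.ι_mapBifunctorMap S.f (𝟙 L) F (.up ℤ) _ _ _ _).trans (by simp))
    (fun s => (HomologicalComplex.ι_mapBifunctorMap S.g (𝟙 L) F (.up ℤ) _ _ _ _).trans (by simp))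
    (finite_support_fiber F S.X₂ L j)

instance (X : C₁) (n : ℤ) :
    FinSupp ((HomologicalComplex.single C₁ (ComplexShape.up ℤ) n).obj X).X where
  finite := by
    refine (Set.finite_singleton n).subset (fun i hi => ?_)
    by_contra h
    exact hi (HomologicalComplex.isZero_single_obj_X _ _ _ _ h)

section Single

variable (n : ℤ) (X : C₁) (L : CochainComplex C₂ ℤ) [FinSupp L.X]

/-- Auxiliary isomorphism in degree `i`. -/
noncomputable def singleMapBifunctorIsoX (i : ℤ) :
    (F.obj X).obj (L.X (i + -n)) ⟶ (HomologicalComplex.mapBifunctor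
      ((HomologicalComplex.single C₁ (ComplexShape.up ℤ) n).obj X) L F (.up ℤ)).X i :=
  (F.map (HomologicalComplex.singleObjXSelf (.up ℤ) n X).inv).app _ ≫
    HomologicalComplex.ιMapBifunctor _ L F (.up ℤ) n (i + -n) i (by
      change n + (i + -n) = i
      lia)

instance (i : ℤ) : IsIso (singleMapBifunctorIsoX F n X L i) := by
  have h : IsIso (HomologicalComplex.ιMapBifunctor
      ((HomologicalComplex.single C₁ (ComplexShape.up ℤ) n).obj X) L F (.up ℤ) n (i + -n) i (by
      change n + (i + -n) = i
      lia)) := by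
    refine isIso_inj (isColimitMapBifunctor F
      ((HomologicalComplex.single C₁ (ComplexShape.up ℤ) n).obj X) L i) ⟨(n, i + -n), by
        change n + (i + -n) = i
        lia⟩ ?_
    rintro ⟨⟨a, b⟩, hab⟩ hne
    refine (F.flip.obj (L.X b)).map_isZero
      (HomologicalComplex.isZero_single_obj_X _ _ _ _ (fun h => hne ?_))
    replace hab : a + b = i := hab
    subst h
    ext
    · rfl
    · dsimp
      lia
  dsimp only [singleMapBifunctorIsoX]
  infer_instance

lemma singleMapBifunctorIsoX_comm (i j : ℤ) (hij : i + 1 = j) :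
    singleMapBifunctorIsoX F n X L i ≫ (HomologicalComplex.mapBifunctor
      ((HomologicalComplex.single C₁ (ComplexShape.up ℤ) n).obj X) L F (.up ℤ)).d i j =
    ((-n).negOnePow • (F.obj X).map (L.d (i + -n) (j + -n))) ≫
      singleMapBifunctorIsoX F n X L j := by
  dsimp only [singleMapBifunctorIsoX]
  rw [assoc, HomologicalComplex.mapBifunctor.d_eq, Preadditive.comp_add,
    HomologicalComplex.mapBifunctor.ι_D₁, HomologicalComplex.mapBifunctor.ι_D₂,
    HomologicalComplex.mapBifunctor.d₁_eq _ _ _ _ (i₁ := n) (i₁' := n + 1) (by simp) _ _ (by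
      change n + 1 + (i + -n) = j
      lia),
    HomologicalComplex.mapBifunctor.d₂_eq _ _ _ _ _ (i₂ := i + -n) (i₂' := j + -n) (by
      change i + -n + 1 = j + -n
      lia) _ (by
      change n + (j + -n) = j
      lia), HomologicalComplex.single_obj_d, Functor.map_zero, zero_app, zero_comp, smul_zero,
      zero_add]
  have hs : ComplexShape.ε₂ (.up ℤ) (.up ℤ) (.up ℤ) (n, i + -n) = (-n).negOnePow := by
    rw [Int.negOnePow_neg]
    rfl
  rw [hs, Linear.comp_units_smul, Linear.units_smul_comp, ← assoc, ← assoc]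
  congr 2
  exact ((F.map (HomologicalComplex.singleObjXSelf (.up ℤ) n X).inv).naturality _).symm

/-- The total complex attached to a complex concentrated in one degree. -/
noncomputable def singleMapBifunctorIso :
    (((F.obj X).mapHomologicalComplex (ComplexShape.up ℤ)).obj L)⟦-n⟧ ≅
      HomologicalComplex.mapBifunctor
        ((HomologicalComplex.single C₁ (ComplexShape.up ℤ) n).obj X) L F (.up ℤ) :=
  HomologicalComplex.Hom.isoOfComponents (fun i =>
    @asIso D _ ((F.obj X).obj (L.X (i + -n))) _ (singleMapBifunctorIsoX F n X L i) inferInstance)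
    (fun i j hij => singleMapBifunctorIsoX_comm F n X L i j hij)

lemma singleMapBifunctorIso_naturality {L L' : CochainComplex C₂ ℤ} [FinSupp L.X] [FinSupp L'.X]
    (f : L ⟶ L') :
    (singleMapBifunctorIso F n X L).hom ≫
      HomologicalComplex.mapBifunctorMap (𝟙 _) f F (.up ℤ) =
    (((F.obj X).mapHomologicalComplex (ComplexShape.up ℤ)).map f)⟦-n⟧' ≫
      (singleMapBifunctorIso F n X L').hom := by
  ext i
  change singleMapBifunctorIsoX F n X L i ≫ _ =
    (F.obj X).map (f.f (i + -n)) ≫ singleMapBifunctorIsoX F n X L' i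
  dsimp only [singleMapBifunctorIsoX]
  rw [assoc, HomologicalComplex.ι_mapBifunctorMap]
  simp

lemma quasiIso_single {L L' : CochainComplex C₂ ℤ} [FinSupp L.X] [FinSupp L'.X]
    (f : L ⟶ L') [PreservesFiniteLimits (F.obj X)] [PreservesFiniteColimits (F.obj X)]
    (hf : QuasiIso f) :
    QuasiIso (HomologicalComplex.mapBifunctorMap
      (𝟙 ((HomologicalComplex.single C₁ (ComplexShape.up ℤ) n).obj X)) f F (.up ℤ)) := by
  have h1 : QuasiIso (((F.obj X).mapHomologicalComplex (ComplexShape.up ℤ)).map f) :=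
    HomologicalComplex.quasiIso_map_of_preservesHomology _ _
  have h2 : QuasiIso ((singleMapBifunctorIso F n X L).hom ≫
      HomologicalComplex.mapBifunctorMap (𝟙 _) f F (.up ℤ)) := by
    rw [singleMapBifunctorIso_naturality]
    infer_instance
  exact (quasiIso_iff_comp_left _ _).1 h2

end Single

section Induction

variable {L L' : CochainComplex C₂ ℤ} [FinSupp L.X] [FinSupp L'.X]
    (f : L ⟶ L') [∀ Y, PreservesFiniteLimits (F.flip.obj Y)] [∀ Y, PreservesFiniteColimits (F.flip.obj Y)]

lemma quasiIso_of_shortExact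
    (S : ShortComplex (CochainComplex C₁ ℤ)) (hS : S.ShortExact)
    [FinSupp S.X₁.X] [FinSupp S.X₂.X] [FinSupp S.X₃.X]
    (h₁ : QuasiIso (HomologicalComplex.mapBifunctorMap (𝟙 S.X₁) f F (.up ℤ)))
    (h₃ : QuasiIso (HomologicalComplex.mapBifunctorMap (𝟙 S.X₃) f F (.up ℤ))) :
    QuasiIso (HomologicalComplex.mapBifunctorMap (𝟙 S.X₂) f F (.up ℤ)) := by
  have w : ∀ (M : CochainComplex C₂ ℤ) [FinSupp M.X],
      HomologicalComplex.mapBifunctorMap S.f (𝟙 M) F (.up ℤ) ≫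
      HomologicalComplex.mapBifunctorMap S.g (𝟙 M) F (.up ℤ) = 0 := by
    intro M _
    ext j i k h
    have : (F.map (S.f.f i)).app (M.X k) ≫ (F.map (S.g.f i)).app (M.X k) = 0 :=
      (S.map (HomologicalComplex.eval C₁ (.up ℤ) i ⋙ F.flip.obj (M.X k))).zero
    simp [reassoc_of% this]
  let φ : ShortComplex.mk _ _ (w L) ⟶ ShortComplex.mk _ _ (w L') :=
    { τ₁ := HomologicalComplex.mapBifunctorMap (𝟙 S.X₁) f F (.up ℤ)
      τ₂ := HomologicalComplex.mapBifunctorMap (𝟙 S.X₂) f F (.up ℤ)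
      τ₃ := HomologicalComplex.mapBifunctorMap (𝟙 S.X₃) f F (.up ℤ)
      comm₁₂ := by
        ext j i k h
        simp
      comm₂₃ := by
        ext j i k h
        simp }
  exact quasiIso_τ₂ φ (shortExact_mapBifunctor F S hS L (w L))
    (shortExact_mapBifunctor F S hS L' (w L')) h₁ h₃

lemma isZero_of_f_mono_single {M : CochainComplex C₁ ℤ} (b : ℤ)
    (φ : (HomologicalComplex.single C₁ (ComplexShape.up ℤ) b).obj (M.X b) ⟶ M)
    (hφ : IsIso (φ.f b)) : Mono φ ∧ IsZero ((cokernel φ).X b) := by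
  constructor
  · have : ∀ i, Mono (φ.f i) := fun i => by
      by_cases hi : i = b
      · subst hi
        infer_instance
      · rw [Preadditive.mono_iff_cancel_zero]
        intro W g _
        exact (HomologicalComplex.isZero_single_obj_X _ _ _ _ hi).eq_of_tgt _ _
    exact HomologicalComplex.mono_of_mono_f _ inferInstance
  · have h1 : φ.f b ≫ (cokernel.π φ).f b = 0 := by
      rw [← HomologicalComplex.comp_f, cokernel.condition, HomologicalComplex.zero_f]
    have h2 : (cokernel.π φ).f b = 0 := by
      rw [← cancel_epi (φ.f b), h1, comp_zero]
    rw [IsZero.iff_id_eq_zero, ← cancel_epi ((cokernel.π φ).f b), h2, zero_comp, zero_comp]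

lemma isZero_cokernel_X {K M : CochainComplex C₁ ℤ} (φ : K ⟶ M) (i : ℤ) (h : IsZero (M.X i)) :
    IsZero ((cokernel φ).X i) := by
  rw [IsZero.iff_id_eq_zero, ← cancel_epi ((cokernel.π φ).f i)]
  exact h.eq_of_src _ _

lemma finSupp_of_isStrictly (K : CochainComplex C₁ ℤ) (a b : ℤ) [ha : K.IsStrictlyGE a]
    [hb : K.IsStrictlyLE b] : FinSupp K.X :=
  ⟨(isBoundedCx_iff K).1 ⟨a, b, ha, hb⟩⟩

lemma quasiIso_mapBifunctorMap_aux [∀ X, PreservesFiniteLimits (F.obj X)]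
    [∀ X, PreservesFiniteColimits (F.obj X)] (hf : QuasiIso f) (a : ℤ) (m : ℕ) :
    ∀ (M : CochainComplex C₁ ℤ) [FinSupp M.X] [M.IsStrictlyGE a] [M.IsStrictlyLE (a + m - 1)],
    QuasiIso (HomologicalComplex.mapBifunctorMap (𝟙 M) f F (.up ℤ)) := by
  induction m with
  | zero =>
    intro M _ _ _
    have hM : ∀ i, IsZero (M.X i) := fun i => by
      by_cases hi : i < a
      · exact M.isZero_of_isStrictlyGE a i hi
      · exact M.isZero_of_isStrictlyLE (a + (0 : ℕ) - 1) i (by simp; lia)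
    have h0 : ∀ (N : CochainComplex C₂ ℤ) [FinSupp N.X] (j : ℤ),
        IsZero ((HomologicalComplex.mapBifunctor M N F (.up ℤ)).X j) := fun N _ j => by
      rw [IsZero.iff_id_eq_zero]
      ext i k h
      exact ((F.flip.obj (N.X k)).map_isZero (hM i)).eq_of_src _ _
    have : IsIso (HomologicalComplex.mapBifunctorMap (𝟙 M) f F (.up ℤ)) :=
      ⟨0, by ext j : 1; exact (h0 L j).eq_of_src _ _, by ext j : 1; exact (h0 L' j).eq_of_src _ _⟩
    infer_instance
  | succ m ih =>
    intro M _ _ _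
    let b : ℤ := a + m
    have hb : ∀ i, b < i → IsZero (M.X i) := fun i hi =>
      M.isZero_of_isStrictlyLE (a + (m + 1 : ℕ) - 1) i (by push_cast; lia)
    let φ : (HomologicalComplex.single C₁ (ComplexShape.up ℤ) b).obj (M.X b) ⟶ M :=
      HomologicalComplex.mkHomFromSingle (𝟙 _) (fun k hk => by
        exact (hb k (by simp only [ComplexShape.up_Rel] at hk; lia)).eq_of_tgt _ _)
    have hφ : IsIso (φ.f b) := by
      dsimp only [φ]
      rw [HomologicalComplex.mkHomFromSingle_f]
      infer_instance
    obtain ⟨h1, h2⟩ := isZero_of_f_mono_single b φ hφ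
    have : CochainComplex.IsStrictlyGE (cokernel φ) a := by
      rw [CochainComplex.isStrictlyGE_iff]
      exact fun i hi => isZero_cokernel_X φ i (M.isZero_of_isStrictlyGE a i hi)
    have : CochainComplex.IsStrictlyLE (cokernel φ) (a + m - 1) := by
      rw [CochainComplex.isStrictlyLE_iff]
      intro i hi
      by_cases hib : i = b
      · subst hib
        exact h2
      · exact isZero_cokernel_X φ i (hb i (by lia))
    have := finSupp_of_isStrictly (cokernel φ) a (a + m - 1)
    exact quasiIso_of_shortExact F f (ShortComplex.mk φ (cokernel.π φ) (cokernel.condition φ))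
      { exact := ShortComplex.exact_cokernel φ } (quasiIso_single F b (M.X b) f hf)
      (ih (cokernel φ))

lemma quasiIso_mapBifunctorMap [∀ X, PreservesFiniteLimits (F.obj X)]
    [∀ X, PreservesFiniteColimits (F.obj X)] (hf : QuasiIso f)
    (M : CochainComplex C₁ ℤ) [FinSupp M.X] :
    QuasiIso (HomologicalComplex.mapBifunctorMap (𝟙 M) f F (.up ℤ)) := by
  obtain ⟨a, b, ha, hb⟩ := (isBoundedCx_iff M).2 FinSupp.finite
  have : M.IsStrictlyLE (a + (b - a + 1).toNat - 1) :=
    M.isStrictlyLE_of_le b _ (by have := Int.self_le_toNat (b - a + 1); lia)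
  exact quasiIso_mapBifunctorMap_aux F f hf a (b - a + 1).toNat M

end Induction

section Flip

variable [∀ X, PreservesFiniteLimits (F.obj X)] [∀ X, PreservesFiniteColimits (F.obj X)]
    [∀ Y, PreservesFiniteLimits (F.flip.obj Y)] [∀ Y, PreservesFiniteColimits (F.flip.obj Y)]

lemma quasiIso_mapBifunctorMap' {L L' : CochainComplex C₁ ℤ} [FinSupp L.X] [FinSupp L'.X]
    (f : L ⟶ L') (hf : QuasiIso f) (M : CochainComplex C₂ ℤ) [FinSupp M.X] :
    QuasiIso (HomologicalComplex.mapBifunctorMap f (𝟙 M) F (.up ℤ)) := by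
  have : ∀ X, PreservesFiniteLimits (F.flip.flip.obj X) := fun X =>
    inferInstanceAs (PreservesFiniteLimits (F.obj X))
  have : ∀ X, PreservesFiniteColimits (F.flip.flip.obj X) := fun X =>
    inferInstanceAs (PreservesFiniteColimits (F.obj X))
  have : F.flip.Additive := ⟨fun {X Y f g} => by ext Z; exact (F.obj Z).map_add⟩
  have : ∀ X, (F.flip.obj X).Additive := fun X => ⟨fun {Y Z f g} => by
    change (F.map (f + g)).app X = (F.map f).app X + (F.map g).app X
    rw [F.map_add, NatTrans.app_add]⟩
  have h := quasiIso_mapBifunctorMap F.flip f hf M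
  have h2 := HomologicalComplex.mapBifunctorFlipIso_hom_naturality f (𝟙 M) F (ComplexShape.up ℤ)
  have h3 : QuasiIso ((HomologicalComplex.mapBifunctorFlipIso L M F (ComplexShape.up ℤ)).hom ≫
      HomologicalComplex.mapBifunctorMap f (𝟙 M) F (.up ℤ)) := by
    rw [← h2]
    infer_instance
  exact (quasiIso_iff_comp_left _ _).1 h3

end Flip


end Bifunctor

section MonoidalDerived

/-- The tensor product is exact in both variables. -/
class BiexactTensor (C : Type u) [Category.{v} C] [MonoidalCategory C] : Prop where
  left_lim (X : C) : PreservesFiniteLimits (tensorLeft X)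
  left_colim (X : C) : PreservesFiniteColimits (tensorLeft X)
  right_lim (X : C) : PreservesFiniteLimits (tensorRight X)
  right_colim (X : C) : PreservesFiniteColimits (tensorRight X)

instance (C : Type u) [Category.{v} C] [MonoidalCategory C] [RigidCategory C] :
    BiexactTensor C where
  left_lim X :=
    have : PreservesLimitsOfSize.{v, v} _ := (tensorLeftAdjunction X (Xᘁ)).rightAdjoint_preservesLimits
    PreservesLimits.preservesFiniteLimits _
  left_colim X :=
    have : PreservesColimitsOfSize.{v, v} _ := (tensorLeftAdjunction (ᘁX) X).leftAdjoint_preservesColimits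
    PreservesColimits.preservesFiniteColimits _
  right_lim X :=
    have : PreservesLimitsOfSize.{v, v} _ := (tensorRightAdjunction (ᘁX) X).rightAdjoint_preservesLimits
    PreservesLimits.preservesFiniteLimits _
  right_colim X :=
    have : PreservesColimitsOfSize.{v, v} _ := (tensorRightAdjunction X (Xᘁ)).leftAdjoint_preservesColimits
    PreservesColimits.preservesFiniteColimits _

variable (C : Type u) [Category.{v} C] [Abelian C] [MonoidalCategory C] [MonoidalPreadditive C]
  [BiexactTensor C]

instance : (quasiIsoCb C).IsMultiplicative := by dsimp only [quasiIsoCb]; infer_instance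

instance (X : C) : PreservesFiniteLimits ((curriedTensor C).obj X) := BiexactTensor.left_lim X
instance (X : C) : PreservesFiniteColimits ((curriedTensor C).obj X) := BiexactTensor.left_colim X
instance (X : C) : PreservesFiniteLimits ((curriedTensor C).flip.obj X) :=
  BiexactTensor.right_lim X
instance (X : C) : PreservesFiniteColimits ((curriedTensor C).flip.obj X) :=
  BiexactTensor.right_colim X

instance : (quasiIsoCb C).IsMonoidal where
  whiskerLeft K _ _ g hg := quasiIso_mapBifunctorMap (curriedTensor C) g.hom hg K.obj
  whiskerRight f hf K := quasiIso_mapBifunctorMap' (curriedTensor C) f.hom hf K.obj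

variable [HasDerivedCategory.{w} C]

/-- The monoidal structure on the bounded derived category: since the tensor product of `C` is exact
in both variables, the tensor product of bounded complexes preserves quasi-isomorphisms in both
variables, and it descends to the localization `Db C` of the category of bounded complexes. -/
noncomputable instance dbMonoidal : MonoidalCategory (Db C) :=
  inferInstanceAs (MonoidalCategory
    (LocalizedMonoidal (cbToDb C) (quasiIsoCb C) (Iso.refl ((cbToDb C).obj (𝟙_ (Cb C))))))

/-- The localization functor from bounded complexes to `Db C` is monoidal. -/
noncomputable instance cbToDbMonoidal : (cbToDb C).Monoidal :=
  inferInstanceAs (Localization.Monoidal.toMonoidalCategory (cbToDb C) (quasiIsoCb C)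
    (Iso.refl ((cbToDb C).obj (𝟙_ (Cb C))))).Monoidal

end MonoidalDerived

section SingleMonoidal

open HomologicalComplex

variable {C : Type u} [Category.{v} C] [Abelian C]

lemma isBoundedCx_single (X : C) : isBoundedCx C ((single C (ComplexShape.up ℤ) 0).obj X) :=
  isBoundedCx_of_finSupp _

variable (C) in
/-- The functor sending an object to the bounded complex concentrated in degree zero. -/
noncomputable def singleCb : C ⥤ Cb C :=
  ObjectProperty.lift _ (single C (ComplexShape.up ℤ) 0) isBoundedCx_single

variable [MonoidalCategory C] [MonoidalPreadditive C]

lemma ιTensorObj_tensorHom {K₁ K₂ L₁ L₂ : CochainComplex C ℤ} [FinSupp K₁.X] [FinSupp K₂.X]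
    [FinSupp L₁.X] [FinSupp L₂.X] (f : K₁ ⟶ L₁) (g : K₂ ⟶ L₂) (i j n : ℤ) (h : i + j = n) :
    ιTensorObj K₁ K₂ i j n h ≫ (HomologicalComplex.tensorHom f g).f n =
      (f.f i ⊗ₘ g.f j) ≫ ιTensorObj L₁ L₂ i j n h := by
  refine (ι_mapBifunctorMap f g (curriedTensor C) (.up ℤ) i j n h).trans ?_
  rw [MonoidalCategory.tensorHom_def, assoc]
  rfl

/-- The inclusion of the tensor product in the degree zero part of a tensor product of complexes
concentrated in degree zero. -/
noncomputable def singleTensorX (X Y : C) : X ⊗ Y ⟶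
    (HomologicalComplex.tensorObj ((single C (ComplexShape.up ℤ) 0).obj X)
      ((single C (ComplexShape.up ℤ) 0).obj Y)).X 0 :=
  ((singleObjXSelf (ComplexShape.up ℤ) 0 X).inv ⊗ₘ (singleObjXSelf (ComplexShape.up ℤ) 0 Y).inv) ≫
    ιTensorObj _ _ 0 0 0 (add_zero 0)

lemma isZero_single_tensorObj_X (X Y : C) (n : ℤ) (hn : n ≠ 0) :
    IsZero ((HomologicalComplex.tensorObj ((single C (ComplexShape.up ℤ) 0).obj X)
      ((single C (ComplexShape.up ℤ) 0).obj Y)).X n) := by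
  rw [IsZero.iff_id_eq_zero]
  apply Cofan.IsColimit.hom_ext (isColimitMapBifunctor (curriedTensor C)
    ((single C (ComplexShape.up ℤ) 0).obj X) ((single C (ComplexShape.up ℤ) 0).obj Y) n)
  rintro ⟨⟨i, j⟩, hij⟩
  replace hij : i + j = n := hij
  refine IsZero.eq_of_src ?_ _ _
  by_cases hi : i = 0
  · exact isZero_tensor_right _ (isZero_single_obj_X (ComplexShape.up ℤ) 0 Y j (by lia))
  · exact isZero_tensor_left (isZero_single_obj_X (ComplexShape.up ℤ) 0 X i hi) _

instance (X Y : C) : IsIso (singleTensorX X Y) := by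
  have : IsIso (ιTensorObj ((single C (ComplexShape.up ℤ) 0).obj X)
      ((single C (ComplexShape.up ℤ) 0).obj Y) 0 0 0 (add_zero 0)) := by
    refine isIso_inj (isColimitMapBifunctor (curriedTensor C)
      ((single C (ComplexShape.up ℤ) 0).obj X) ((single C (ComplexShape.up ℤ) 0).obj Y) 0)
      ⟨(0, 0), add_zero 0⟩ ?_
    rintro ⟨⟨i, j⟩, hij⟩ hne
    replace hij : i + j = 0 := hij
    by_cases hi : i = 0
    · refine (hne ?_).elim
      ext
      · exact hi
      · change j = 0
        lia
    · exact isZero_tensor_left (isZero_single_obj_X (ComplexShape.up ℤ) 0 X i hi) _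
  dsimp only [singleTensorX]
  infer_instance

/-- The comparison morphism for the tensor product of complexes concentrated in degree zero. -/
noncomputable def singleTensor (X Y : C) : (single C (ComplexShape.up ℤ) 0).obj (X ⊗ Y) ⟶
    HomologicalComplex.tensorObj ((single C (ComplexShape.up ℤ) 0).obj X)
      ((single C (ComplexShape.up ℤ) 0).obj Y) :=
  mkHomFromSingle (singleTensorX X Y) (fun k hk =>
    (isZero_single_tensorObj_X X Y k (by simp at hk; lia)).eq_of_tgt _ _)

lemma singleTensor_f (X Y : C) : (singleTensor X Y).f 0 =
    (singleObjXSelf (ComplexShape.up ℤ) 0 (X ⊗ Y)).hom ≫ singleTensorX X Y :=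
  mkHomFromSingle_f _ _

instance (X Y : C) : IsIso (singleTensor X Y) := by
  have : ∀ n, IsIso ((singleTensor X Y).f n) := fun n => by
    by_cases hn : n = 0
    · subst hn
      rw [singleTensor_f]
      infer_instance
    · exact (isZero_single_obj_X (ComplexShape.up ℤ) 0 (X ⊗ Y) n hn).isIso
        (isZero_single_tensorObj_X X Y n hn) _
  exact HomologicalComplex.Hom.isIso_of_components _

lemma singleTensorX_tensorHom {X X' Y Y' : C} (f : X ⟶ X') (g : Y ⟶ Y') :
    singleTensorX X Y ≫ (HomologicalComplex.tensorHom
      ((single C (ComplexShape.up ℤ) 0).map f) ((single C (ComplexShape.up ℤ) 0).map g)).f 0 =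
    (f ⊗ₘ g) ≫ singleTensorX X' Y' := by
  dsimp only [singleTensorX]
  rw [assoc, ιTensorObj_tensorHom, tensorHom_comp_tensorHom_assoc, tensorHom_comp_tensorHom_assoc]
  simp [single_map_f_self]

lemma singleTensor_natural {X X' Y Y' : C} (f : X ⟶ X') (g : Y ⟶ Y') :
    singleTensor X Y ≫ HomologicalComplex.tensorHom
      ((single C (ComplexShape.up ℤ) 0).map f) ((single C (ComplexShape.up ℤ) 0).map g) =
    (single C (ComplexShape.up ℤ) 0).map (f ⊗ₘ g) ≫ singleTensor X' Y' := by
  apply from_single_hom_ext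
  rw [comp_f, comp_f, singleTensor_f, singleTensor_f, assoc, singleTensorX_tensorHom]
  simp [single_map_f_self]

lemma singleTensor_assoc (X Y Z : C) :
    singleTensor (X ⊗ Y) Z ≫ HomologicalComplex.tensorHom (singleTensor X Y) (𝟙 _) ≫
      (HomologicalComplex.associator _ _ _).hom =
    (single C (ComplexShape.up ℤ) 0).map (α_ X Y Z).hom ≫ singleTensor X (Y ⊗ Z) ≫
      HomologicalComplex.tensorHom (𝟙 _) (singleTensor Y Z) := by
  apply from_single_hom_ext
  have key : ∀ (K₁ K₂ K₃ : CochainComplex C ℤ) [FinSupp K₁.X] [FinSupp K₂.X] [FinSupp K₃.X],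
      (ιTensorObj K₁ K₂ 0 0 0 (add_zero 0) ⊗ₘ 𝟙 (K₃.X 0)) ≫
        ιTensorObj (HomologicalComplex.tensorObj K₁ K₂) K₃ 0 0 0 (add_zero 0) ≫
          (HomologicalComplex.associator K₁ K₂ K₃).hom.f 0 =
      (α_ _ _ _).hom ≫ (𝟙 (K₁.X 0) ⊗ₘ ιTensorObj K₂ K₃ 0 0 0 (add_zero 0)) ≫
        ιTensorObj K₁ (HomologicalComplex.tensorObj K₂ K₃) 0 0 0 (add_zero 0) := by
    intro K₁ K₂ K₃ _ _ _
    have h := GradedObject.Monoidal.ιTensorObj₃'_associator_hom K₁.X K₂.X K₃.X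
      0 0 0 0 (by simp)
    rw [GradedObject.Monoidal.ιTensorObj₃'_eq _ _ _ _ _ _ _ _ 0 (add_zero 0),
      GradedObject.Monoidal.ιTensorObj₃_eq _ _ _ _ _ _ _ _ 0 (add_zero 0)] at h
    rw [assoc] at h
    rw [tensorHom_id, id_tensorHom]
    exact h
  simp only [comp_f, singleTensor_f, singleTensorX, assoc]
  rw [reassoc_of% (ιTensorObj_tensorHom (singleTensor X Y) (𝟙 _) 0 0 0 (add_zero 0)),
    ιTensorObj_tensorHom (𝟙 _) (singleTensor Y Z) 0 0 0 (add_zero 0),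
    tensorHom_comp_tensorHom_assoc, tensorHom_comp_tensorHom_assoc]
  simp only [single_map_f_self, singleTensor_f, singleTensorX, assoc, id_f, comp_id,
    Iso.inv_hom_id_assoc, Iso.cancel_iso_hom_left]
  have h1 : ∀ {A B A' B' T : C} (f : A ⟶ B) (g : B ⟶ A') (h : B' ⟶ T),
      (f ≫ g) ⊗ₘ h = (f ⊗ₘ h) ≫ (g ⊗ₘ 𝟙 _) := by
    intros
    rw [tensorHom_comp_tensorHom, comp_id]
  have h2 : ∀ {A B A' B' T : C} (f : A ⟶ B) (g : B ⟶ A') (h : B' ⟶ T),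
      h ⊗ₘ (f ≫ g) = (h ⊗ₘ f) ≫ (𝟙 _ ⊗ₘ g) := by
    intros
    rw [tensorHom_comp_tensorHom, comp_id]
  rw [h1, h2, assoc, assoc, key, associator_naturality_assoc]

lemma singleTensor_left_unit (X : C) :
    (HomologicalComplex.leftUnitor ((single C (ComplexShape.up ℤ) 0).obj X)).inv =
      (single C (ComplexShape.up ℤ) 0).map (λ_ X).inv ≫ singleTensor (𝟙_ C) X := by
  apply from_single_hom_ext
  rw [comp_f, singleTensor_f, singleTensorX]
  refine (leftUnitor'_inv ((single C (ComplexShape.up ℤ) 0).obj X) 0).trans ?_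
  simp only [single_map_f_self, assoc, Iso.inv_hom_id_assoc]
  rw [MonoidalCategory.tensorHom_def', assoc, ← leftUnitor_inv_naturality_assoc]
  erw [Iso.hom_inv_id_assoc]

lemma singleTensor_right_unit (X : C) :
    (HomologicalComplex.rightUnitor ((single C (ComplexShape.up ℤ) 0).obj X)).inv =
      (single C (ComplexShape.up ℤ) 0).map (ρ_ X).inv ≫ singleTensor X (𝟙_ C) := by
  apply from_single_hom_ext
  rw [comp_f, singleTensor_f, singleTensorX]
  refine (rightUnitor'_inv ((single C (ComplexShape.up ℤ) 0).obj X) 0).trans ?_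
  simp only [single_map_f_self, assoc, Iso.inv_hom_id_assoc]
  rw [MonoidalCategory.tensorHom_def, assoc, ← rightUnitor_inv_naturality_assoc]
  erw [Iso.hom_inv_id_assoc]

/-- The comparison morphism for the tensor product of complexes concentrated in degree zero. -/
noncomputable def singleCbTensor (X Y : C) :
    (singleCb C).obj (X ⊗ Y) ⟶ (singleCb C).obj X ⊗ (singleCb C).obj Y :=
  ⟨singleTensor X Y⟩

lemma singleCbTensor_natural {X X' Y Y' : C} (f : X ⟶ X') (g : Y ⟶ Y') :
    singleCbTensor X Y ≫ ((singleCb C).map f ⊗ₘ (singleCb C).map g) =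
      (singleCb C).map (f ⊗ₘ g) ≫ singleCbTensor X' Y' := by
  ext1
  exact singleTensor_natural f g

noncomputable instance singleCbOplax : (singleCb C).OplaxMonoidal where
  η := 𝟙 ((singleCb C).obj (𝟙_ C))
  δ := singleCbTensor
  δ_natural_left f Y := by
    have h := singleCbTensor_natural f (𝟙 Y)
    rwa [CategoryTheory.Functor.map_id, tensorHom_id, tensorHom_id] at h
  δ_natural_right Y f := by
    have h := singleCbTensor_natural (𝟙 Y) f
    rwa [CategoryTheory.Functor.map_id, id_tensorHom, id_tensorHom] at h
  oplax_associativity X Y Z := by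
    ext1
    exact singleTensor_assoc X Y Z
  oplax_left_unitality X := by
    have h : 𝟙 ((singleCb C).obj (𝟙_ C)) ▷ (singleCb C).obj X = 𝟙 _ := id_whiskerRight _ _
    refine Eq.trans ?_ (congr_arg (fun t => (singleCb C).map (λ_ X).inv ≫
      singleCbTensor (𝟙_ C) X ≫ t) h.symm)
    refine Eq.trans ?_ (congr_arg (fun t => (singleCb C).map (λ_ X).inv ≫ t)
      (comp_id (singleCbTensor (𝟙_ C) X)).symm)
    ext1
    exact singleTensor_left_unit X
  oplax_right_unitality X := by
    have h : (singleCb C).obj X ◁ 𝟙 ((singleCb C).obj (𝟙_ C)) = 𝟙 _ :=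
      MonoidalCategory.whiskerLeft_id _ _
    refine Eq.trans ?_ (congr_arg (fun t => (singleCb C).map (ρ_ X).inv ≫
      singleCbTensor X (𝟙_ C) ≫ t) h.symm)
    refine Eq.trans ?_ (congr_arg (fun t => (singleCb C).map (ρ_ X).inv ≫ t)
      (comp_id (singleCbTensor X (𝟙_ C))).symm)
    ext1
    exact singleTensor_right_unit X

instance : IsIso (Functor.OplaxMonoidal.η (singleCb C)) :=
  inferInstanceAs (IsIso (𝟙 ((singleCb C).obj (𝟙_ C))))

instance (X Y : C) : IsIso (Functor.OplaxMonoidal.δ (singleCb C) X Y) := by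
  have : IsIso ((isBoundedCx C).ι.map (Functor.OplaxMonoidal.δ (singleCb C) X Y)) :=
    inferInstanceAs (IsIso (singleTensor X Y))
  exact isIso_of_reflects_iso _ (isBoundedCx C).ι

noncomputable instance singleCbMonoidal : (singleCb C).Monoidal :=
  Functor.Monoidal.ofOplaxMonoidal _

end SingleMonoidal

section DerivedFunctors

/-- The functor sending an object of an abelian category to the corresponding complex
concentrated in degree zero, as an object of the bounded derived category. -/
noncomputable def singleDb (A : Type*) [Category* A] [Abelian A] [HasDerivedCategory.{w} A] :
    A ⥤ Db A :=
  singleCb A ⋙ cbToDb A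

noncomputable instance singleDbMonoidal (C : Type*) [Category* C] [Abelian C] [MonoidalCategory C]
    [MonoidalPreadditive C] [BiexactTensor C] [HasDerivedCategory.{w} C] :
    (singleDb C).Monoidal :=
  inferInstanceAs (singleCb C ⋙ cbToDb C).Monoidal

/-- The cohomology functors on the bounded derived category. -/
noncomputable def cohomologyDb (A : Type*) [Category* A] [Abelian A] [HasDerivedCategory.{w} A]
    (n : ℤ) : Db A ⥤ A :=
  DerivedCategory.Bounded.ι ⋙ DerivedCategory.homologyFunctor A n

section

variable {A C : Type*} [Category* A] [Category* C] [Abelian A] [Abelian C]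
  [HasDerivedCategory A] [HasDerivedCategory C]
  (i : A ⥤ C) [i.Additive] [PreservesFiniteLimits i] [PreservesFiniteColimits i]

/-- The functor induced by an exact functor on bounded derived categories. -/
noncomputable def mapDb : Db A ⥤ Db C :=
  ObjectProperty.lift _ (DerivedCategory.Bounded.ι ⋙ i.mapDerivedCategory) (by
    rintro ⟨X, ⟨a, ha⟩, ⟨b, hb⟩⟩
    obtain ⟨K, hKa, hKb, ⟨e⟩⟩ := X.exists_iso_Q_obj_of_isGE_of_isLE a b
    let L : CochainComplex C ℤ := (i.mapHomologicalComplex (ComplexShape.up ℤ)).obj K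
    have hLa : L.IsStrictlyGE a := by
      rw [CochainComplex.isStrictlyGE_iff]
      exact fun n hn => i.map_isZero (K.isZero_of_isStrictlyGE a n hn)
    have hLb : L.IsStrictlyLE b := by
      rw [CochainComplex.isStrictlyLE_iff]
      exact fun n hn => i.map_isZero (K.isZero_of_isStrictlyLE b n hn)
    have hb' : (DerivedCategory.Q.obj L).IsLE b := inferInstance
    have ha' : (DerivedCategory.Q.obj L).IsGE a := inferInstance
    let e' := (i.mapDerivedCategory.mapIso e ≪≫ i.mapDerivedCategoryFactors.app K).symm
    exact ⟨⟨a, DerivedCategory.TStructure.t.isGE_of_iso (X := DerivedCategory.Q.obj L) e' a⟩,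
      ⟨b, DerivedCategory.TStructure.t.isLE_of_iso (X := DerivedCategory.Q.obj L) e' b⟩⟩)

end

end DerivedFunctors

section Modules

open scoped MonoidalLeftAction

/-- A module structure on a functor `G : K ⥤ K'` between left module categories over monoidal
categories `T` and `T'`, relative to a monoidal functor `Φ : T ⥤ T'`. For `Φ = 𝟭 T`, this is the
usual notion of a module functor; in general, it is a `T`-module functor from `K` to the
`T`-module category obtained from `K'` by restriction along `Φ`. -/
structure ModuleFunctorOver {T T' K K' : Type*} [Category* T] [Category* T'] [Category* K]
    [Category* K'] [MonoidalCategory T] [MonoidalCategory T'] [MonoidalLeftAction T K]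
    [MonoidalLeftAction T' K'] (Φ : T ⥤ T') [Φ.Monoidal] (G : K ⥤ K') where
  /-- the compatibility isomorphisms -/
  iso (X : T) (M : K) : G.obj (X ⊙ₗ M) ≅ Φ.obj X ⊙ₗ G.obj M
  naturality_left {X Y : T} (f : X ⟶ Y) (M : K) :
    G.map (f ⊵ₗ M) ≫ (iso Y M).hom = (iso X M).hom ≫ Φ.map f ⊵ₗ G.obj M
  naturality_right (X : T) {M N : K} (g : M ⟶ N) :
    G.map (X ⊴ₗ g) ≫ (iso X N).hom = (iso X M).hom ≫ Φ.obj X ⊴ₗ G.map g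
  associativity (X Y : T) (M : K) :
    (iso (X ⊗ Y) M).hom ≫ Functor.OplaxMonoidal.δ Φ X Y ⊵ₗ G.obj M ≫ (αₗ _ _ (G.obj M)).hom =
      G.map (αₗ X Y M).hom ≫ (iso X (Y ⊙ₗ M)).hom ≫ Φ.obj X ⊴ₗ (iso Y M).hom
  unitality (M : K) :
    (iso (𝟙_ T) M).hom ≫ Functor.OplaxMonoidal.η Φ ⊵ₗ G.obj M ≫ (λₗ (G.obj M)).hom =
      G.map (λₗ M).hom

/-- The action of `T` on `K` is exact in each variable. -/
def IsBiexactAction (T K : Type*) [Category* T] [Category* K] [MonoidalCategory T]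
    [MonoidalLeftAction T K] : Prop :=
  (∀ X : T, PreservesFiniteLimits (MonoidalLeftAction.actionLeft K X) ∧
    PreservesFiniteColimits (MonoidalLeftAction.actionLeft K X)) ∧
  (∀ M : K, PreservesFiniteLimits (MonoidalLeftAction.actionRight T M) ∧
    PreservesFiniteColimits (MonoidalLeftAction.actionRight T M))

/-- The action of `T` on `K` is `k`-bilinear on morphisms. -/
def IsBilinearAction (k T K : Type*) [Ring k] [Category* T] [Category* K] [Preadditive T]
    [Preadditive K] [Linear k T] [Linear k K] [MonoidalCategory T]
    [MonoidalLeftAction T K] : Prop :=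
  (∀ X : T, (MonoidalLeftAction.actionLeft K X).Additive ∧
    (MonoidalLeftAction.actionLeft K X).Linear k) ∧
  (∀ M : K, (MonoidalLeftAction.actionRight T M).Additive ∧
    (MonoidalLeftAction.actionRight T M).Linear k)

end Modules

section TensorCategories

/-- Beyond being `k`-linear abelian, rigid monoidal with bilinear tensor product, a tensor category
over `k` is locally finite (finite dimensional morphism spaces, objects of finite length), and
the endomorphisms of its unit object are the scalars. -/
class IsTensorCategory (k C : Type*) [Field k] [Category* C] [Abelian C] [Linear k C]
    [MonoidalCategory C] [MonoidalPreadditive C] [MonoidalLinear k C] [RigidCategory C] :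
    Prop where
  finite_hom (X Y : C) : Module.Finite k (X ⟶ Y)
  noetherian (X : C) : IsNoetherianObject X
  artinian (X : C) : IsArtinianObject X
  bijective_unit : Function.Bijective (fun c : k => c • 𝟙 (𝟙_ C))

/-- There are only finitely many simple objects up to isomorphism. -/
def HasFinitelyManySimples (A : Type*) [Category* A] [Abelian A] : Prop :=
  ∃ (n : ℕ) (S : Fin n → A), ∀ X : A, Simple X → ∃ j, Nonempty (X ≅ S j)

/-- The kernel of a functor: the objects which are sent to zero. -/
def kernelOf {A B : Type*} [Category* A] [Category* B] (G : A ⥤ B) : ObjectProperty A :=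
  ObjectProperty.inverseImage IsZero G

instance {A B : Type*} [Category* A] [Category* B] [Abelian A] [Abelian B] (G : A ⥤ B)
    [PreservesFiniteLimits G] [PreservesFiniteColimits G] : (kernelOf G).IsSerreClass := by
  dsimp only [kernelOf]
  infer_instance

end TensorCategories

section Restriction

open scoped MonoidalLeftAction

variable {T T' K K' : Type*} [Category* T] [Category* T'] [Category* K]
    [Category* K'] [MonoidalCategory T] [MonoidalCategory T'] [MonoidalLeftAction T K]
    [MonoidalLeftAction T' K']

/-- Let `ι : K ⥤ T` and `ι' : K' ⥤ T'` be module functors, `Φ : T ⥤ T'` a monoidal functor and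
`Ψ : K ⥤ K'` a functor which `Φ` extends. This is the canonical isomorphism
`ι' (Ψ (X ⊙ M)) ≅ Φ (ι (X ⊙ M)) ≅ Φ (X ⊗ ι M) ≅ Φ X ⊗ Φ (ι M) ≅ Φ X ⊗ ι' (Ψ M) ≅ ι' (Φ X ⊙ Ψ M)`
in `T'`. -/
noncomputable def restrictionIso {ι : K ⥤ T} {ι' : K' ⥤ T'} (j : ModuleFunctorOver (𝟭 T) ι)
    (j' : ModuleFunctorOver (𝟭 T') ι') (Φ : T ⥤ T') [Φ.Monoidal] {Ψ : K ⥤ K'}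
    (φ : ι ⋙ Φ ≅ Ψ ⋙ ι') (X : T) (M : K) :
    ι'.obj (Ψ.obj (X ⊙ₗ M)) ≅ ι'.obj (Φ.obj X ⊙ₗ Ψ.obj M) :=
  (φ.app (X ⊙ₗ M)).symm ≪≫ Φ.mapIso (j.iso X M) ≪≫
    (Functor.Monoidal.μIso Φ X (ι.obj M)).symm ≪≫
      whiskerLeftIso (Φ.obj X) (φ.app M) ≪≫ (j'.iso (Φ.obj X) (Ψ.obj M)).symm

end Restriction

end DerivedModule

open DerivedModule
open scoped MonoidalLeftAction

/-! Everything reduces to one assertion: unless `B` is zero, `F(X)` for `X` in `C` and `FA(M)` for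
`M` in `A` have cohomology in degree `0` only.

Objects of `A` have finite length, since chain conditions can be tested in `C` through the faithful
exact inclusion, and `A` has finitely many simple objects. So one integer bounds above the
cohomology of all the `FA(M)`. If `FA` does not kill `A`, let `b` be the largest degree in which
some `H^b(FA(M))` is nonzero, and let `q` be the highest degree in which `F(X)` has nonzero
cohomology. The product `X ⊙ M` again lies in `A`, and in `Db D` its image is `F(X) ⊗ FA(M)`. The
cohomology of that complex in degree `q + b` is `H^q(F(X)) ⊗ H^b(FA(M))`, because both factors are
in top degree (`isZero_tensorObj_cohomologyDb`). It is nonzero, because the unit of a tensor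
category is simple and hence products of nonzero objects are nonzero (`isZero_of_isZero_tensorObj`).
Maximality of `b` forces `q ≤ 0`. The same bound for the dual of `X` excludes negative degrees
(`isZero_cohomologyDb_of_exactPairing`). This is `essImage_singleDb_map`; it carries over to `FA(M)`
because the inclusion of `B` is exact and faithful. If `FA` kills `A`, it kills `Db A` by dévissage,
density gives `B = 0`, and all claims about `B` are trivial.

The actions on the hearts are then transported along the fully faithful `singleDb`, and `FA`
restricts to a module functor `G : A ⥤ B`. A triangulated functor that preserves the hearts is exact
on them and commutes with cohomology (`cohomologyDb_map`). This describes the kernel of `FA`, and it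
shows that `G` is dense: if `FA(K)` is isomorphic to `N`, then `N` is isomorphic to `G(H^0(K))`.
Fullness of `G` comes from that of `FA`. Finally, a full dense exact functor identifies its target
with the Serre quotient by its kernel, and the action of `C` is carried to the quotient along this
equivalence. -/

namespace DerivedModule

/-! ### Module categories and module functors -/

section ModuleFunctors

open MonoidalLeftAction Functor.OplaxMonoidal

variable {T T' T'' K K' K'' : Type*} [Category* T] [Category* T'] [Category* T'']
  [Category* K] [Category* K'] [Category* K'']
  [MonoidalCategory T] [MonoidalCategory T'] [MonoidalCategory T'']

/-- The action of an object on an isomorphism. -/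
@[simps]
def actionRightIso [MonoidalLeftAction T K] (X : T) {M N : K} (e : M ≅ N) : X ⊙ₗ M ≅ X ⊙ₗ N where
  hom := X ⊴ₗ e.hom
  inv := X ⊴ₗ e.inv

/-- The action of an isomorphism on an object. -/
@[simps]
def actionLeftIso [MonoidalLeftAction T K] {X Y : T} (e : X ≅ Y) (M : K) : X ⊙ₗ M ≅ Y ⊙ₗ M where
  hom := e.hom ⊵ₗ M
  inv := e.inv ⊵ₗ M

/-! ### Transport of an action along a functor -/

section Induced

variable [MonoidalLeftAction T' K'] (Φ : T ⥤ T') [Φ.Monoidal] (ι : K ⥤ K')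

/-- An action structure which is compatible with a module structure along a faithful functor
satisfies the axioms of an action. -/
@[reducible]
noncomputable def actionOfFaithful [S : MonoidalLeftActionStruct T K] [ι.Faithful]
    (e : ∀ (X : T) (M : K), ι.obj (X ⊙ₗ M) ≅ Φ.obj X ⊙ₗ ι.obj M)
    (hl : ∀ {X Y : T} (f : X ⟶ Y) (M : K),
      ι.map (f ⊵ₗ M) = (e _ M).hom ≫ Φ.map f ⊵ₗ ι.obj M ≫ (e _ M).inv)
    (hr : ∀ (X : T) {M N : K} (g : M ⟶ N),
      ι.map (X ⊴ₗ g) = (e X _).hom ≫ Φ.obj X ⊴ₗ ι.map g ≫ (e X _).inv)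
    (hh : ∀ {X Y : T} (f : X ⟶ Y) {M N : K} (g : M ⟶ N),
      ι.map (f ⊙ₗₘ g) = (e _ _).hom ≫ (Φ.map f ⊙ₗₘ ι.map g) ≫ (e _ _).inv)
    (ha : ∀ (X Y : T) (M : K), ι.map (αₗ X Y M).hom =
      (e (X ⊗ Y) M).hom ≫ δ Φ X Y ⊵ₗ ι.obj M ≫ (αₗ _ _ _).hom ≫
        Φ.obj X ⊴ₗ (e Y M).inv ≫ (e X _).inv)
    (hu : ∀ M : K, ι.map (λₗ[T] M).hom =
      (e (𝟙_ T) M).hom ≫ η Φ ⊵ₗ ι.obj M ≫ (λₗ _).hom) :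
    MonoidalLeftAction T K where
  actionHom_def f g := ι.map_injective (by simp [hl, hr, hh, actionHom_def])
  actionHomRight_id X M := ι.map_injective (by simp [hr])
  id_actionHomLeft X M := ι.map_injective (by simp [hl])
  actionHom_comp f₁ f₂ g₁ g₂ := ι.map_injective (by simp [hh])
  actionAssocIso_hom_naturality {c₁ c₂ c₃ c₄ d₁ d₂} f g h := ι.map_injective (by
    have h₁ : (Φ.map (f ⊗ₘ g) ⊙ₗₘ ι.map h) ≫ δ Φ c₂ c₄ ⊵ₗ ι.obj d₂ =
        δ Φ c₁ c₃ ⊵ₗ ι.obj d₁ ≫ ((Φ.map f ⊗ₘ Φ.map g) ⊙ₗₘ ι.map h) := by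
      rw [← actionHom_id, ← actionHom_id, ← actionHom_comp, ← actionHom_comp, δ_natural,
        id_comp, comp_id]
    simp only [Functor.map_comp, hh, ha, assoc, Iso.inv_hom_id_assoc, reassoc_of% h₁,
      actionAssocIso_hom_naturality_assoc]
    simp only [actionHom_def _ (_ ≫ _), actionHom_def (Φ.map f) (_ ⊙ₗₘ _), actionHomRight_comp,
      assoc, action_exchange_assoc, actionHomRight_inv_hom_assoc])
  actionUnitIso_hom_naturality f := ι.map_injective (by
    simp only [Functor.map_comp, hr, hu, assoc, Iso.inv_hom_id_assoc]
    rw [action_exchange_assoc, actionUnitIso_hom_naturality])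
  whiskerLeft_actionHomLeft X Y Z f M := by
    -- `ha` describes `ι` on the forward associator only, so the inverse is first moved to the other
    -- side.
    rw [← assoc, Iso.eq_comp_inv]
    apply ι.map_injective
    have h₁ : Φ.map (X ◁ f) ⊵ₗ ι.obj M ≫ δ Φ X Z ⊵ₗ ι.obj M =
        δ Φ X Y ⊵ₗ ι.obj M ≫ (Φ.obj X ◁ Φ.map f) ⊵ₗ ι.obj M := by
      rw [← comp_actionHomLeft, ← comp_actionHomLeft, δ_natural_right]
    simp only [Functor.map_comp, hr, hl, ha, assoc, Iso.inv_hom_id_assoc, reassoc_of% h₁,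
      actionHomRight_comp, actionHomRight_inv_hom_assoc, whiskerLeft_actionHomLeft]
  whiskerRight_actionHomLeft {X Y} Z f M := by
    rw [← assoc, Iso.eq_comp_inv]
    apply ι.map_injective
    have h₁ : Φ.map (f ▷ Z) ⊵ₗ ι.obj M ≫ δ Φ Y Z ⊵ₗ ι.obj M =
        δ Φ X Z ⊵ₗ ι.obj M ≫ (Φ.map f ▷ Φ.obj Z) ⊵ₗ ι.obj M := by
      rw [← comp_actionHomLeft, ← comp_actionHomLeft, δ_natural_left]
    simp only [Functor.map_comp, hl, ha, assoc, Iso.inv_hom_id_assoc, reassoc_of% h₁,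
      action_exchange_assoc, whiskerRight_actionHomLeft]
  associator_actionHom X Y Z M := ι.map_injective (by
    -- Once the isomorphisms `e` have been pushed to the ends, the pentagon is this coherence of `δ`
    -- followed by the pentagon of the action on `K'`.
    have h₁ : δ Φ (X ⊗ Y) Z ⊵ₗ ι.obj M ≫ (δ Φ X Y ▷ Φ.obj Z) ⊵ₗ ι.obj M ≫
        (α_ (Φ.obj X) (Φ.obj Y) (Φ.obj Z)).hom ⊵ₗ ι.obj M =
        Φ.map (α_ X Y Z).hom ⊵ₗ ι.obj M ≫ δ Φ X (Y ⊗ Z) ⊵ₗ ι.obj M ≫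
          (Φ.obj X ◁ δ Φ Y Z) ⊵ₗ ι.obj M := by
      simp only [← comp_actionHomLeft, associativity]
    have h₂ : ∀ {A B : K'} (f : A ⟶ B), (Φ.obj X ⊗ Φ.obj Y) ⊴ₗ f ≫ (αₗ _ _ _).hom =
        (αₗ _ _ _).hom ≫ Φ.obj X ⊴ₗ Φ.obj Y ⊴ₗ f := by simp
    have h₃ : (δ Φ X Y ▷ Φ.obj Z) ⊵ₗ ι.obj M ≫ (αₗ _ _ _).hom =
        (αₗ _ _ _).hom ≫ δ Φ X Y ⊵ₗ (Φ.obj Z ⊙ₗ ι.obj M) := by simp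
    have h₄ : (Φ.obj X ◁ δ Φ Y Z) ⊵ₗ ι.obj M ≫ (αₗ _ _ _).hom =
        (αₗ _ _ _).hom ≫ Φ.obj X ⊴ₗ δ Φ Y Z ⊵ₗ ι.obj M := by simp
    simp only [Functor.map_comp, hr, hl, ha, assoc, Iso.inv_hom_id_assoc, actionHomRight_comp,
      actionHomRight_inv_hom_assoc]
    rw [action_exchange_assoc, reassoc_of% h₂, ← reassoc_of% h₃, ← reassoc_of% h₄,
      ← reassoc_of% h₁, associator_actionHom_assoc])
  leftUnitor_actionHom X M := ι.map_injective (by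
    have h₁ : Φ.map (λ_ X).hom ⊵ₗ ι.obj M =
        δ Φ (𝟙_ T) X ⊵ₗ ι.obj M ≫ (η Φ ▷ Φ.obj X) ⊵ₗ ι.obj M ≫ (λ_ _).hom ⊵ₗ ι.obj M := by
      simp only [← comp_actionHomLeft, Functor.Monoidal.map_leftUnitor]
    have h₃ : (η Φ ▷ Φ.obj X) ⊵ₗ ι.obj M ≫ (αₗ _ _ _).hom =
        (αₗ _ _ _).hom ≫ η Φ ⊵ₗ (Φ.obj X ⊙ₗ ι.obj M) := by simp
    simp only [Functor.map_comp, hl, hu, ha, assoc, Iso.inv_hom_id_assoc, h₁,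
      leftUnitor_actionHom, reassoc_of% h₃, action_exchange_assoc, ← actionUnitIso_hom_naturality])
  rightUnitor_actionHom X M := ι.map_injective (by
    have h₁ : Φ.map (ρ_ X).hom ⊵ₗ ι.obj M =
        δ Φ X (𝟙_ T) ⊵ₗ ι.obj M ≫ (Φ.obj X ◁ η Φ) ⊵ₗ ι.obj M ≫ (ρ_ _).hom ⊵ₗ ι.obj M := by
      simp only [← comp_actionHomLeft, Functor.Monoidal.map_rightUnitor]
    have h₃ : (Φ.obj X ◁ η Φ) ⊵ₗ ι.obj M ≫ (αₗ _ _ _).hom =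
        (αₗ _ _ _).hom ≫ Φ.obj X ⊴ₗ η Φ ⊵ₗ ι.obj M := by simp
    simp only [Functor.map_comp, hl, hr, hu, ha, assoc, Iso.inv_hom_id_assoc, h₁,
      rightUnitor_actionHom, reassoc_of% h₃, actionHomRight_comp, actionHomRight_inv_hom_assoc])

variable [ι.Full] [ι.Faithful]
  (o : T → K → K) (e : ∀ X M, ι.obj (o X M) ≅ Φ.obj X ⊙ₗ ι.obj M)

/-- The structure morphisms of the action induced along a fully faithful functor. -/
@[reducible]
noncomputable def inducedActionStruct : MonoidalLeftActionStruct T K where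
  actionObj := o
  actionHomLeft f M := ι.preimage ((e _ M).hom ≫ Φ.map f ⊵ₗ ι.obj M ≫ (e _ M).inv)
  actionHomRight X _ _ g := ι.preimage ((e X _).hom ≫ Φ.obj X ⊴ₗ ι.map g ≫ (e X _).inv)
  actionHom f g := ι.preimage ((e _ _).hom ≫ (Φ.map f ⊙ₗₘ ι.map g) ≫ (e _ _).inv)
  actionAssocIso X Y M := ι.preimageIso
    { hom := (e (X ⊗ Y) M).hom ≫ δ Φ X Y ⊵ₗ ι.obj M ≫ (αₗ _ _ _).hom ≫
        Φ.obj X ⊴ₗ (e Y M).inv ≫ (e X _).inv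
      inv := (e X _).hom ≫ Φ.obj X ⊴ₗ (e Y M).hom ≫ (αₗ _ _ _).inv ≫
        Functor.LaxMonoidal.μ Φ X Y ⊵ₗ ι.obj M ≫ (e (X ⊗ Y) M).inv
      hom_inv_id := by simp [← comp_actionHomLeft_assoc]
      inv_hom_id := by simp [← comp_actionHomLeft_assoc] }
  actionUnitIso M := ι.preimageIso
    { hom := (e (𝟙_ T) M).hom ≫ η Φ ⊵ₗ ι.obj M ≫ (λₗ _).hom
      inv := (λₗ _).inv ≫ Functor.LaxMonoidal.ε Φ ⊵ₗ ι.obj M ≫ (e (𝟙_ T) M).inv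
      hom_inv_id := by simp [← comp_actionHomLeft_assoc]
      inv_hom_id := by simp [← comp_actionHomLeft_assoc] }

/-- The action of `T` on `K` induced along a fully faithful functor `ι : K ⥤ K'` from an
action of `T'` on `K'` and a monoidal functor `Φ : T ⥤ T'`. -/
@[reducible]
noncomputable def inducedAction : MonoidalLeftAction T K :=
  letI := inducedActionStruct Φ ι o e
  actionOfFaithful Φ ι e (fun _ _ => ι.map_preimage _) (fun _ _ _ _ => ι.map_preimage _)
    (fun _ _ _ _ => ι.map_preimage _) (fun _ _ _ => ι.map_preimage _) (fun _ => ι.map_preimage _)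

/-- The functor along which an action is induced is a module functor. -/
noncomputable def inducedModuleFunctor :
    letI := inducedAction Φ ι o e
    ModuleFunctorOver Φ ι :=
  letI := inducedAction Φ ι o e
  { iso := e
    naturality_left f M := by
      -- The induced action on morphisms is a preimage under `ι` of a conjugate by `e`, so applying
      -- `ι` unfolds it.
      refine (congr_arg (· ≫ _) (ι.map_preimage _)).trans ?_
      simp
    naturality_right X _ _ g := by
      refine (congr_arg (· ≫ _) (ι.map_preimage _)).trans ?_
      simp
    associativity X Y M := by
      refine Eq.trans ?_ (congr_arg (· ≫ _) (ι.map_preimage _).symm)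
      simp only [assoc]
      erw [Iso.inv_hom_id_assoc, actionHomRight_inv_hom, comp_id]
    unitality M := (ι.map_preimage _).symm }

end Induced

/-! ### Composition, transport and lifting of module functors -/

section Operations

variable [MonoidalLeftAction T K] [MonoidalLeftAction T' K'] [MonoidalLeftAction T'' K'']

namespace ModuleFunctorOver

section Assoc

variable {Φ : T ⥤ T'} [Φ.Monoidal] {G : K ⥤ K'} (s : ModuleFunctorOver Φ G)

lemma naturality_left_assoc {X Y : T} (f : X ⟶ Y) (M : K) {Z : K'}
    (h : Φ.obj Y ⊙ₗ G.obj M ⟶ Z) : G.map (f ⊵ₗ M) ≫ (s.iso Y M).hom ≫ h =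
      (s.iso X M).hom ≫ Φ.map f ⊵ₗ G.obj M ≫ h := by
  rw [reassoc_of% (s.naturality_left f M)]

lemma naturality_right_assoc (X : T) {M N : K} (g : M ⟶ N) {Z : K'}
    (h : Φ.obj X ⊙ₗ G.obj N ⟶ Z) : G.map (X ⊴ₗ g) ≫ (s.iso X N).hom ≫ h =
      (s.iso X M).hom ≫ Φ.obj X ⊴ₗ G.map g ≫ h := by
  rw [reassoc_of% (s.naturality_right X g)]

lemma associativity_assoc (X Y : T) (M : K) {Z : K'}
    (h : Φ.obj X ⊙ₗ Φ.obj Y ⊙ₗ G.obj M ⟶ Z) :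
    (s.iso (X ⊗ Y) M).hom ≫ δ Φ X Y ⊵ₗ G.obj M ≫ (αₗ _ _ (G.obj M)).hom ≫ h =
      G.map (αₗ X Y M).hom ≫ (s.iso X (Y ⊙ₗ M)).hom ≫ Φ.obj X ⊴ₗ (s.iso Y M).hom ≫ h := by
  rw [reassoc_of% (s.associativity X Y M)]

lemma unitality_assoc (M : K) {Z : K'} (h : G.obj M ⟶ Z) :
    (s.iso (𝟙_ T) M).hom ≫ η Φ ⊵ₗ G.obj M ≫ (λₗ (G.obj M)).hom ≫ h = G.map (λₗ M).hom ≫ h := by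
  rw [reassoc_of% (s.unitality M)]

end Assoc

/-- A monoidal functor, as a module functor over itself. -/
@[simps]
noncomputable def self (Φ : T ⥤ T') [Φ.Monoidal] : ModuleFunctorOver Φ Φ where
  iso X M := (Functor.Monoidal.μIso Φ X M).symm
  naturality_left f M := by simp
  naturality_right X _ _ g := by simp
  associativity X Y M := by simp
  unitality M := by simp

/-- The composition of module functors. -/
@[simps]
noncomputable def comp {Φ : T ⥤ T'} [Φ.Monoidal] {Ψ : T' ⥤ T''} [Ψ.Monoidal] {G : K ⥤ K'}
    {H : K' ⥤ K''} (s : ModuleFunctorOver Φ G) (t : ModuleFunctorOver Ψ H) :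
    ModuleFunctorOver (Φ ⋙ Ψ) (G ⋙ H) where
  iso X M := H.mapIso (s.iso X M) ≪≫ t.iso _ _
  naturality_left f M := by
    dsimp
    rw [assoc, ← t.naturality_left, ← H.map_comp_assoc, ← H.map_comp_assoc, s.naturality_left]
  naturality_right X _ _ g := by
    dsimp
    rw [assoc, ← t.naturality_right, ← H.map_comp_assoc, ← H.map_comp_assoc, s.naturality_right]
  associativity X Y M := by
    have h := congr_arg (fun f => H.map f) (s.associativity X Y M)
    dsimp at h ⊢
    simp only [Functor.map_comp] at h
    simp only [comp_actionHomLeft, actionHomRight_comp, assoc]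
    rw [← t.naturality_left_assoc, t.associativity, reassoc_of% h, ← t.naturality_right_assoc]
  unitality M := by
    have h := congr_arg (fun f => H.map f) (s.unitality M)
    dsimp at h ⊢
    simp only [Functor.map_comp] at h
    simp only [comp_actionHomLeft, assoc]
    rw [← t.naturality_left_assoc, t.unitality, h]

/-- Transport of module functor structures along isomorphisms of functors. -/
@[simps]
noncomputable def ofIso {Φ : T ⥤ T'} [Φ.Monoidal] {G H : K ⥤ K'} (s : ModuleFunctorOver Φ G)
    (θ : G ≅ H) : ModuleFunctorOver Φ H where
  iso X M := (θ.app _).symm ≪≫ s.iso X M ≪≫ actionRightIso (Φ.obj X) (θ.app M)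
  naturality_left f M := by
    simp only [Iso.trans_hom, Iso.symm_hom, Iso.app_hom, Iso.app_inv, actionRightIso_hom]
    rw [assoc, assoc, θ.inv.naturality_assoc, s.naturality_left_assoc, action_exchange]
  naturality_right X _ _ g := by
    simp only [Iso.trans_hom, Iso.symm_hom, Iso.app_hom, Iso.app_inv, actionRightIso_hom]
    rw [assoc, assoc, θ.inv.naturality_assoc, s.naturality_right_assoc, ← actionHomRight_comp,
      ← actionHomRight_comp, θ.hom.naturality]
  associativity X Y M := by
    have h₂ : ∀ {A B : K'} (f : A ⟶ B), (Φ.obj X ⊗ Φ.obj Y) ⊴ₗ f ≫ (αₗ _ _ _).hom =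
        (αₗ _ _ _).hom ≫ Φ.obj X ⊴ₗ Φ.obj Y ⊴ₗ f := by simp
    simp only [Iso.trans_hom, Iso.symm_hom, Iso.app_hom, Iso.app_inv, actionRightIso_hom]
    rw [assoc, assoc, action_exchange_assoc, h₂, s.associativity_assoc, assoc, assoc,
      ← θ.inv.naturality_assoc, ← actionHomRight_comp, ← actionHomRight_comp,
      Iso.hom_inv_id_app_assoc]
  unitality M := by
    simp only [Iso.trans_hom, Iso.symm_hom, Iso.app_hom, Iso.app_inv, actionRightIso_hom]
    rw [assoc, assoc, action_exchange_assoc, ← actionUnitIso_hom_naturality,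
      s.unitality_assoc, ← θ.inv.naturality_assoc, Iso.inv_hom_id_app, comp_id]

/-- Change of the base functor of a module functor along a monoidal isomorphism. -/
@[simps]
noncomputable def changeBase {Φ Φ' : T ⥤ T'} [Φ.Monoidal] [Φ'.Monoidal] {G : K ⥤ K'}
    (s : ModuleFunctorOver Φ G) (ω : Φ ≅ Φ') (hη : ω.hom.app (𝟙_ T) ≫ η Φ' = η Φ)
    (hδ : ∀ X Y, ω.hom.app (X ⊗ Y) ≫ δ Φ' X Y = δ Φ X Y ≫ (ω.hom.app X ⊗ₘ ω.hom.app Y)) :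
    ModuleFunctorOver Φ' G where
  iso X M := s.iso X M ≪≫ actionLeftIso (ω.app X) (G.obj M)
  naturality_left f M := by
    simp only [Iso.trans_hom, Iso.app_hom, actionLeftIso_hom]
    rw [assoc, s.naturality_left_assoc, ← comp_actionHomLeft, ← comp_actionHomLeft,
      ω.hom.naturality]
  naturality_right X _ _ g := by
    simp only [Iso.trans_hom, Iso.app_hom, actionLeftIso_hom]
    rw [assoc, s.naturality_right_assoc, action_exchange]
  associativity X Y M := by
    have h₁ : ∀ {A B A' B' : T'} (f : A ⟶ B) (g : A' ⟶ B') (M : K'),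
        (f ⊗ₘ g) ⊵ₗ M ≫ (αₗ B B' M).hom = (αₗ A A' M).hom ≫ (f ⊙ₗₘ g ⊵ₗ M) := fun f g M => by
      rw [← actionHom_id, actionAssocIso_hom_naturality, actionHom_id]
    simp only [Iso.trans_hom, Iso.app_hom, actionLeftIso_hom]
    rw [assoc, ← comp_actionHomLeft_assoc, hδ, comp_actionHomLeft, assoc, h₁,
      s.associativity_assoc, actionHomRight_comp, assoc, actionHom_def, action_exchange_assoc]
  unitality M := by
    simp only [Iso.trans_hom, Iso.app_hom, actionLeftIso_hom]
    rw [assoc, ← comp_actionHomLeft_assoc, hη, s.unitality]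

/-- If the composition of `G` with a faithful module functor is a module functor, then so
is `G`. -/
@[simps]
noncomputable def ofFaithful {Φ : T ⥤ T'} [Φ.Monoidal] {Ψ : T' ⥤ T''} [Ψ.Monoidal] {G : K ⥤ K'}
    {H : K' ⥤ K''} [H.Faithful] (t : ModuleFunctorOver Ψ H)
    (u : ModuleFunctorOver (Φ ⋙ Ψ) (G ⋙ H))
    (s : ∀ X M, G.obj (X ⊙ₗ M) ≅ Φ.obj X ⊙ₗ G.obj M)
    (hs : ∀ X M, H.map (s X M).hom ≫ (t.iso _ _).hom = (u.iso X M).hom) :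
    ModuleFunctorOver Φ G where
  iso := s
  naturality_left {X Y} f M := H.map_injective (by
    have h := u.naturality_left f M
    dsimp at h
    rw [← cancel_mono (t.iso _ _).hom, Functor.map_comp, assoc, hs, h, ← hs, Functor.map_comp,
      assoc, assoc, t.naturality_left])
  naturality_right X _ _ g := H.map_injective (by
    have h := u.naturality_right X g
    dsimp at h
    rw [← cancel_mono (t.iso _ _).hom, Functor.map_comp, assoc, hs, h, ← hs, Functor.map_comp,
      assoc, assoc, t.naturality_right])
  associativity X Y M := H.map_injective (by
    have h := u.associativity X Y M
    dsimp at h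
    simp only [comp_actionHomLeft, ← hs, actionHomRight_comp, assoc] at h
    rw [← t.naturality_left_assoc, t.associativity] at h
    -- Two comparison isomorphisms of `t` carry the target to the iterated action on `K''`, where
    -- `u` is known to be associative.
    rw [← cancel_mono (t.iso _ _).hom, ← cancel_mono (Ψ.obj (Φ.obj X) ⊴ₗ (t.iso _ _).hom)]
    simp only [Functor.map_comp, assoc]
    rw [h, t.naturality_right_assoc])
  unitality M := H.map_injective (by
    have h := u.unitality M
    dsimp at h
    simp only [comp_actionHomLeft, ← hs, assoc] at h
    rw [← t.naturality_left_assoc, t.unitality] at h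
    simpa using h)

/-- A module functor which factors through a fully faithful module functor. -/
noncomputable def lift {L : Type*} [Category* L] [MonoidalLeftAction T L] {Φ : T ⥤ T'} [Φ.Monoidal]
    {H : K ⥤ K'} {ι : L ⥤ K'} [ι.Full] [ι.Faithful] (t : ModuleFunctorOver Φ ι)
    (u : ModuleFunctorOver Φ H) {G : K ⥤ L} (θ : H ≅ G ⋙ ι) : ModuleFunctorOver (𝟭 T) G :=
  -- `ofFaithful` wants the base functor in the form `𝟭 T ⋙ Φ`, hence the change of base along a
  -- unitor.
  ofFaithful t ((u.ofIso θ).changeBase Φ.leftUnitor.symm (by simp) (by simp))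
    (fun X M => ι.preimageIso ((u.ofIso θ).iso X M ≪≫ (t.iso X (G.obj M)).symm))
    (fun X M => by simp)

/-- Characterizes the lifted structure, since `ι` is faithful. It is the form in which compatibility
with `FA` enters the main theorem. -/
lemma lift_iso {L : Type*} [Category* L] [MonoidalLeftAction T L] {Φ : T ⥤ T'} [Φ.Monoidal]
    {H : K ⥤ K'} {ι : L ⥤ K'} [ι.Full] [ι.Faithful] (t : ModuleFunctorOver Φ ι)
    (u : ModuleFunctorOver Φ H) {G : K ⥤ L} (θ : H ≅ G ⋙ ι) (X : T) (M : K) :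
    θ.hom.app (X ⊙ₗ M) ≫ ι.map ((lift t u θ).iso X M).hom ≫ (t.iso X (G.obj M)).hom =
      (u.iso X M).hom ≫ Φ.obj X ⊴ₗ θ.hom.app M := by
  simp [lift]

end ModuleFunctorOver

end Operations

end ModuleFunctors

/-! ### Cohomology and the heart of the bounded derived category -/

section BoundedDerived

variable {A B : Type*} [Category* A] [Category* B] [Abelian A] [Abelian B]
  [HasDerivedCategory A] [HasDerivedCategory B]

/-- The compatibility of `singleDb` with the functor to the unbounded derived category. -/
noncomputable def singleDbCompι :
    singleDb A ⋙ DerivedCategory.Bounded.ι ≅ DerivedCategory.singleFunctor A 0 :=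
  (DerivedCategory.singleFunctorIsoCompQ A 0).symm

instance : (singleDb A).Full :=
  have : (singleDb A ⋙ DerivedCategory.Bounded.ι).Full := Functor.Full.of_iso singleDbCompι.symm
  Functor.Full.of_comp_faithful (singleDb A) DerivedCategory.Bounded.ι

instance : (singleDb A).Faithful :=
  have : (singleDb A ⋙ DerivedCategory.Bounded.ι).Faithful :=
    Functor.Faithful.of_iso singleDbCompι.symm
  Functor.Faithful.of_comp (singleDb A) DerivedCategory.Bounded.ι

instance : (singleDb A).Additive :=
  have : (singleDb A ⋙ DerivedCategory.Bounded.ι).Additive :=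
    Functor.additive_of_iso singleDbCompι.symm
  ⟨fun {_ _ f g} => DerivedCategory.Bounded.ι.map_injective
    ((singleDb A ⋙ DerivedCategory.Bounded.ι).map_add.trans
      (DerivedCategory.Bounded.ι.map_add (f := (singleDb A).map f) (g := (singleDb A).map g)).symm)⟩

instance (k : Type*) [Field k] [Linear k A] : (singleDb A).Linear k where
  map_smul {X Y} f r := by
    apply DerivedCategory.Bounded.ι.map_injective
    have h (g : X ⟶ Y) := NatIso.naturality_2 (singleDbCompι (A := A)) g
    refine (h (r • f)).symm.trans ?_
    rw [Functor.map_smul, Linear.smul_comp, Linear.comp_smul]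
    exact congr_arg (fun t => r • t) (h f)

instance (n : ℤ) : (cohomologyDb A n).Additive := by
  dsimp only [cohomologyDb]; infer_instance

/-- The cohomology in degree zero of a complex concentrated in degree zero. -/
noncomputable def singleDbCompCohomologyDb : singleDb A ⋙ cohomologyDb A 0 ≅ 𝟭 A :=
  (Functor.associator _ _ _).symm ≪≫ Functor.isoWhiskerRight singleDbCompι _ ≪≫
    DerivedCategory.singleFunctorCompHomologyFunctorIso A 0

lemma isZero_cohomologyDb_singleDb (X : A) (n : ℤ) (hn : n ≠ 0) :
    IsZero ((cohomologyDb A n).obj ((singleDb A).obj X)) := by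
  refine IsZero.of_iso ?_ ((DerivedCategory.homologyFunctor A n).mapIso (singleDbCompι.app X))
  rcases lt_or_gt_of_ne hn with h | h
  · exact DerivedCategory.isZero_of_isGE _ 0 _ h
  · exact DerivedCategory.isZero_of_isLE _ 0 _ h

/-- Cohomology detects isomorphisms, and the zero endomorphism induces isomorphisms between zero
objects; an object with invertible zero endomorphism is zero. -/
lemma isZero_of_cohomologyDb {K : Db A} (h : ∀ n, IsZero ((cohomologyDb A n).obj K)) :
    IsZero K := by
  have : IsIso (0 : DerivedCategory.Bounded.ι.obj K ⟶ DerivedCategory.Bounded.ι.obj K) := by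
    rw [DerivedCategory.isIso_iff]
    exact fun n => (h n).isIso (h n) _
  have h' : IsIso (0 : K ⟶ K) := by
    have : IsIso (DerivedCategory.Bounded.ι.map (0 : K ⟶ K)) := by
      rwa [Functor.map_zero]
    exact isIso_of_reflects_iso _ DerivedCategory.Bounded.ι
  rw [IsZero.iff_id_eq_zero, ← cancel_epi (0 : K ⟶ K), zero_comp, zero_comp]

/-- The heart of the t-structure consists of the complexes in degree `0`. In this form, lying in the
heart becomes a vanishing question. -/
lemma essImage_singleDb_iff (K : Db A) :
    (singleDb A).essImage K ↔ ∀ n, n ≠ 0 → IsZero ((cohomologyDb A n).obj K) := by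
  constructor
  · rintro ⟨X, ⟨e⟩⟩ n hn
    exact (isZero_cohomologyDb_singleDb X n hn).of_iso ((cohomologyDb A n).mapIso e.symm)
  · intro h
    have : K.obj.IsLE 0 := (DerivedCategory.isLE_iff _ _).2 fun i hi => h i hi.ne'
    have : K.obj.IsGE 0 := (DerivedCategory.isGE_iff _ _).2 fun i hi => h i hi.ne
    obtain ⟨Y, ⟨e⟩⟩ := K.obj.exists_iso_singleFunctor_obj_of_isGE_of_isLE 0
    exact ⟨Y, ⟨DerivedCategory.Bounded.ι.preimageIso (singleDbCompι.app Y ≪≫ e.symm)⟩⟩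

lemma exists_bounds (K : Db A) : ∃ a b : ℤ,
    (∀ n < a, IsZero ((cohomologyDb A n).obj K)) ∧
      (∀ n, b < n → IsZero ((cohomologyDb A n).obj K)) := by
  obtain ⟨⟨a, ha⟩, ⟨b, hb⟩⟩ := K.property
  have : K.obj.IsGE a := ha
  have : K.obj.IsLE b := hb
  exact ⟨a, b, fun n hn => K.obj.isZero_of_isGE a n hn, fun n hn => K.obj.isZero_of_isLE b n hn⟩

/-- The cohomology of a shift. -/
noncomputable def cohomologyDbShift (m n : ℤ) (K : Db A) :
    (cohomologyDb A n).obj (K⟦m⟧) ≅ (cohomologyDb A (m + n)).obj K :=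
  (DerivedCategory.homologyFunctor A n).mapIso
    ((DerivedCategory.Bounded.ι.commShiftIso m).app K) ≪≫
      ((DerivedCategory.homologyFunctor A 0).shiftIso m n (m + n) rfl).app _

lemma exact_cohomologyDb (T : Triangle (Db A)) (hT : T ∈ distTriang (Db A)) (n : ℤ) :
    (ShortComplex.mk ((cohomologyDb A n).map T.mor₁) ((cohomologyDb A n).map T.mor₂) (by
      rw [← Functor.map_comp, comp_distTriang_mor_zero₁₂ _ hT, Functor.map_zero])).Exact :=
  DerivedCategory.HomologySequence.exact₂ _ (DerivedCategory.Bounded.ι.map_distinguished _ hT) n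

lemma epi_cohomologyDb (T : Triangle (Db A)) (hT : T ∈ distTriang (Db A)) (n : ℤ)
    (h : IsZero ((cohomologyDb A (n + 1)).obj T.obj₁)) :
    Epi ((cohomologyDb A n).map T.mor₂) :=
  (DerivedCategory.HomologySequence.epi_homologyMap_mor₂_iff _
    (DerivedCategory.Bounded.ι.map_distinguished _ hT) n (n + 1) rfl).2 (h.eq_of_tgt _ _)

lemma mono_cohomologyDb (T : Triangle (Db A)) (hT : T ∈ distTriang (Db A)) (n : ℤ)
    (h : IsZero ((cohomologyDb A (n - 1)).obj T.obj₃)) :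
    Mono ((cohomologyDb A n).map T.mor₁) :=
  (DerivedCategory.HomologySequence.mono_homologyMap_mor₁_iff _
    (DerivedCategory.Bounded.ι.map_distinguished _ hT) (n - 1) n (by lia)).2 (h.eq_of_src _ _)

lemma isIso_cohomologyDb_mor₁ (T : Triangle (Db A)) (hT : T ∈ distTriang (Db A)) (n : ℤ)
    (h : IsZero ((cohomologyDb A (n - 1)).obj T.obj₃))
    (h' : IsZero ((cohomologyDb A n).obj T.obj₃)) :
    IsIso ((cohomologyDb A n).map T.mor₁) := by
  have := mono_cohomologyDb T hT n h
  have : Epi ((cohomologyDb A n).map T.mor₁) :=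
    (exact_cohomologyDb T hT n).epi_f (h'.eq_of_tgt _ _)
  exact isIso_of_mono_of_epi _

lemma isIso_cohomologyDb_mor₂ (T : Triangle (Db A)) (hT : T ∈ distTriang (Db A)) (n : ℤ)
    (h : IsZero ((cohomologyDb A n).obj T.obj₁))
    (h' : IsZero ((cohomologyDb A (n + 1)).obj T.obj₁)) :
    IsIso ((cohomologyDb A n).map T.mor₂) := by
  have := epi_cohomologyDb T hT n h'
  have : Mono ((cohomologyDb A n).map T.mor₂) :=
    (exact_cohomologyDb T hT n).mono_g (h.eq_of_src _ _)
  exact isIso_of_mono_of_epi _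

/-- Only the connecting morphism needs lifting: its target is the shift taken in the unbounded
category, so it is corrected by the commutation of the inclusion with shifts. -/
lemma exists_triangle_bounded {X Y Z : Db A} (f : X ⟶ Y) (g : Y ⟶ Z)
    (h : Z.obj ⟶ X.obj⟦(1 : ℤ)⟧) (hT : Triangle.mk f.hom g.hom h ∈ distTriang _) :
    ∃ h' : Z ⟶ X⟦(1 : ℤ)⟧, Triangle.mk f g h' ∈ distTriang (Db A) := by
  refine ⟨DerivedCategory.Bounded.ι.preimage
    (h ≫ (DerivedCategory.Bounded.ι.commShiftIso (1 : ℤ)).inv.app X),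
      isomorphic_distinguished _ hT _ (Triangle.isoMk _ _ (Iso.refl _) (Iso.refl _) (Iso.refl _)
        ?_ ?_ ?_)⟩
  · exact (comp_id f.hom).trans (id_comp f.hom).symm
  · exact (comp_id g.hom).trans (id_comp g.hom).symm
  · dsimp
    erw [id_comp, CategoryTheory.Functor.map_id, comp_id]
    change DerivedCategory.Bounded.ι.map (DerivedCategory.Bounded.ι.preimage _) ≫
      (DerivedCategory.Bounded.ι.commShiftIso (1 : ℤ)).hom.app X = h
    rw [Functor.map_preimage, assoc, Iso.inv_hom_id_app]
    exact comp_id h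

lemma exists_triangle_singleDb {S : ShortComplex A} (hS : S.ShortExact) :
    ∃ h, Triangle.mk ((singleDb A).map S.f) ((singleDb A).map S.g) h ∈ distTriang (Db A) :=
  exists_triangle_bounded _ _ _ hS.singleTriangle_distinguished

/-- The truncation triangle of the t-structure, cut between `n - 1` and `n`. By the long exact
sequence, `X` has the cohomology of `K` below `n` and `Y` that from `n` on. -/
lemma exists_truncation_triangle (K : Db A) (n : ℤ) :
    ∃ (X Y : Db A) (f : X ⟶ K) (g : K ⟶ Y) (h : Y ⟶ X⟦(1 : ℤ)⟧),
      Triangle.mk f g h ∈ distTriang (Db A) ∧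
      (∀ m, n ≤ m → IsZero ((cohomologyDb A m).obj X)) ∧
      (∀ m < n, IsZero ((cohomologyDb A m).obj Y)) := by
  let t := (DerivedCategory.TStructure.t (C := A)).onBounded
  refine ⟨_, _, _, _, _, t.triangleLEGE_distinguished (n - 1) n (by lia) K, fun m hm => ?_,
    fun m hm => ?_⟩
  · have h : t.IsLE ((t.truncLE (n - 1)).obj K) (n - 1) := inferInstance
    rw [ObjectProperty.tStructure_isLE_iff] at h
    exact (DerivedCategory.isLE_iff _ _).1 h m (by lia)
  · have h : t.IsGE ((t.truncGE n).obj K) n := inferInstance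
    rw [ObjectProperty.tStructure_isGE_iff] at h
    exact (DerivedCategory.isGE_iff _ _).1 h m hm

end BoundedDerived

lemma isZero_of_faithful {A C : Type*} [Category* A] [Category* C] [HasZeroMorphisms A]
    (i : A ⥤ C) [i.Faithful] {X : A} (h : IsZero (i.obj X)) : IsZero X := by
  rw [IsZero.iff_id_eq_zero]
  exact i.map_injective (h.eq_of_src _ _)

/-! ### Derived functors of exact functors -/

section ExactFunctors

variable {A C : Type*} [Category* A] [Category* C] [Abelian A] [Abelian C]
  [HasDerivedCategory A] [HasDerivedCategory C]
  (i : A ⥤ C) [i.Additive] [PreservesFiniteLimits i] [PreservesFiniteColimits i]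

/-- The functor `mapDb i` extends `i`. -/
noncomputable def singleDbCompMapDb : singleDb A ⋙ mapDb i ≅ i ⋙ singleDb C :=
  ((ObjectProperty.fullyFaithfulι _).whiskeringRight _).preimageIso
    (Functor.isoWhiskerRight singleDbCompι _ ≪≫ i.mapDerivedCategorySingleFunctor 0 ≪≫
      Functor.isoWhiskerLeft i singleDbCompι.symm)

lemma cohomologyDb_mapDb (n : ℤ) (K : Db A) :
    Nonempty ((cohomologyDb C n).obj ((mapDb i).obj K) ≅ i.obj ((cohomologyDb A n).obj K)) := by
  let L := DerivedCategory.Q.objPreimage K.obj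
  let e : DerivedCategory.Q.obj L ≅ K.obj := DerivedCategory.Q.objObjPreimageIso K.obj
  have e₁ : i.mapDerivedCategory.obj K.obj ≅
      DerivedCategory.Q.obj ((i.mapHomologicalComplex (ComplexShape.up ℤ)).obj L) :=
    i.mapDerivedCategory.mapIso e.symm ≪≫ i.mapDerivedCategoryFactors.app L
  have e₂ : (DerivedCategory.homologyFunctor C n).obj (DerivedCategory.Q.obj
      ((i.mapHomologicalComplex (ComplexShape.up ℤ)).obj L)) ≅
      ((i.mapHomologicalComplex (ComplexShape.up ℤ)).obj L).homology n :=
    (DerivedCategory.homologyFunctorFactors C n).app _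
  have e₃ : ((i.mapHomologicalComplex (ComplexShape.up ℤ)).obj L).homology n ≅
      i.obj (L.homology n) := ShortComplex.mapHomologyIso (L.sc n) i
  have e₄ : (DerivedCategory.homologyFunctor A n).obj (DerivedCategory.Q.obj L) ≅
      L.homology n := (DerivedCategory.homologyFunctorFactors A n).app _
  exact ⟨(DerivedCategory.homologyFunctor C n).mapIso e₁ ≪≫ e₂ ≪≫ e₃ ≪≫ i.mapIso (e₄.symm ≪≫
    (DerivedCategory.homologyFunctor A n).mapIso e)⟩

/-- An exact functor commutes with cohomology and a faithful one reflects zero objects, so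
concentration in degree `0` can be tested after inclusion in the larger category. -/
lemma essImage_singleDb_of_mapDb [i.Faithful] {K : Db A}
    (h : (singleDb C).essImage ((mapDb i).obj K)) : (singleDb A).essImage K := by
  rw [essImage_singleDb_iff] at h ⊢
  intro n hn
  obtain ⟨e⟩ := cohomologyDb_mapDb i n K
  exact isZero_of_faithful i ((h n hn).of_iso e.symm)

end ExactFunctors

/-! ### Triangulated functors that preserve the hearts -/

section TriangulatedFunctors

variable {A B : Type*} [Category* A] [Category* B] [Abelian A] [Abelian B]
  [HasDerivedCategory A] [HasDerivedCategory B]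
  (Φ : Db A ⥤ Db B) [Φ.CommShift ℤ] [Φ.IsTriangulated] {G : A ⥤ B}
  (θ : singleDb A ⋙ Φ ≅ G ⋙ singleDb B)

include θ

lemma additive_of_singleDb_comp : G.Additive := by
  have : (G ⋙ singleDb B).Additive := Functor.additive_of_iso θ
  exact ⟨fun {_ _ f g} => (singleDb B).map_injective
    ((G ⋙ singleDb B).map_add.trans
      ((singleDb B).map_add (f := G.map f) (g := G.map g)).symm)⟩

/-- The sequence gives a triangle, and all three terms of its image under `Φ` lie in the heart, so
the long exact cohomology sequence collapses to a short one in degree `0`. -/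
lemma shortExact_map_of_singleDb_comp [G.Additive] (S : ShortComplex A) (hS : S.ShortExact) :
    (S.map G).ShortExact := by
  obtain ⟨h, hT⟩ := exists_triangle_singleDb hS
  have hT' := Φ.map_distinguished _ hT
  have hz : ∀ (X : A) (n : ℤ), n ≠ 0 →
      IsZero ((cohomologyDb B n).obj (Φ.obj ((singleDb A).obj X))) := fun X n hn =>
    (isZero_cohomologyDb_singleDb (G.obj X) n hn).of_iso ((cohomologyDb B n).mapIso (θ.app X))
  have h₁ := exact_cohomologyDb _ hT' 0
  have h₂ := mono_cohomologyDb _ hT' 0 (hz _ _ (by simp))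
  have h₃ := epi_cohomologyDb _ hT' 0 (hz _ _ (by simp))
  let e : singleDb A ⋙ Φ ⋙ cohomologyDb B 0 ≅ G :=
    Functor.isoWhiskerRight θ (cohomologyDb B 0) ≪≫
      Functor.isoWhiskerLeft G singleDbCompCohomologyDb
  have h₄ : (ShortComplex.mk ((singleDb A ⋙ Φ ⋙ cohomologyDb B 0).map S.f)
      ((singleDb A ⋙ Φ ⋙ cohomologyDb B 0).map S.g) (by
        have : (singleDb A ⋙ Φ ⋙ cohomologyDb B 0).Additive := inferInstance
        rw [← Functor.map_comp, S.zero, Functor.map_zero])).ShortExact :=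
    { exact := h₁, mono_f := h₂, epi_g := h₃ }
  exact ShortComplex.shortExact_of_iso (ShortComplex.isoMk (e.app _) (e.app _) (e.app _)
    (e.hom.naturality _).symm (e.hom.naturality _).symm) h₄

lemma exact_of_singleDb_comp : PreservesFiniteLimits G ∧ PreservesFiniteColimits G := by
  have := additive_of_singleDb_comp Φ θ
  exact ((Functor.exact_tfae G).out 0 3).1 (shortExact_map_of_singleDb_comp Φ θ)

/-- Induction on the width `m` of the range `[a, a + m)` that contains the cohomology of `K`.
Cutting off the top degree leaves a narrower complex and a shifted object of the heart. Their images
under `Φ` again have disjoint ranges, so the image triangle splits the cohomology of `Φ K` in the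
same way. -/
lemma cohomologyDb_map_of_bounds (a : ℤ) (m : ℕ) : ∀ (K : Db A)
    (_ : ∀ n < a, IsZero ((cohomologyDb A n).obj K))
    (_ : ∀ n, a + m ≤ n → IsZero ((cohomologyDb A n).obj K)) (n : ℤ),
    Nonempty ((cohomologyDb B n).obj (Φ.obj K) ≅ G.obj ((cohomologyDb A n).obj K)) := by
  have := additive_of_singleDb_comp Φ θ
  have hsingle : ∀ (X : A) (n : ℤ), Nonempty ((cohomologyDb B n).obj
      (Φ.obj ((singleDb A).obj X)) ≅ G.obj ((cohomologyDb A n).obj ((singleDb A).obj X))) := by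
    intro X n
    by_cases hn : n = 0
    · subst hn
      exact ⟨(cohomologyDb B 0).mapIso (θ.app X) ≪≫ singleDbCompCohomologyDb.app (G.obj X) ≪≫
        G.mapIso (singleDbCompCohomologyDb.app X).symm⟩
    · exact ⟨((isZero_cohomologyDb_singleDb (G.obj X) n hn).of_iso
        ((cohomologyDb B n).mapIso (θ.app X))).iso
          (G.map_isZero (isZero_cohomologyDb_singleDb X n hn))⟩
  induction m with
  | zero =>
    intro K h₁ h₂ n
    have hK : ∀ n, IsZero ((cohomologyDb A n).obj K) := fun n => by
      by_cases hn : n < a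
      · exact h₁ n hn
      · exact h₂ n (by simpa using hn)
    exact ⟨((cohomologyDb B n).map_isZero (Φ.map_isZero (isZero_of_cohomologyDb hK))).iso
      (G.map_isZero (hK n))⟩
  | succ m ih =>
    intro K h₁ h₂
    -- The range is now `[a, a + m]`: `X` is covered by the induction hypothesis, and `Y` has
    -- cohomology in the single degree `a + m`.
    obtain ⟨X, Y, f, g, h, hT, hX, hY⟩ := exists_truncation_triangle K (a + m)
    have hfX : ∀ n, n < a + m → IsIso ((cohomologyDb A n).map f) := fun n hn =>
      isIso_cohomologyDb_mor₁ _ hT n (hY _ (by lia)) (hY _ (by lia))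
    have hgY : ∀ n, a + m ≤ n → IsIso ((cohomologyDb A n).map g) := fun n hn =>
      isIso_cohomologyDb_mor₂ _ hT n (hX _ (by lia)) (hX _ (by lia))
    have HX := ih X (fun n hn => by
      by_cases hn' : n < a + m
      · have := hfX n hn'
        exact (h₁ n hn).of_iso (asIso ((cohomologyDb A n).map f))
      · exact hX n (by lia)) hX
    have HY : ∀ n, Nonempty ((cohomologyDb B n).obj (Φ.obj Y) ≅
        G.obj ((cohomologyDb A n).obj Y)) := by
      have hY' : (singleDb A).essImage (Y⟦a + m⟧) := by
        rw [essImage_singleDb_iff]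
        intro n hn
        refine IsZero.of_iso ?_ (cohomologyDbShift (a + m) n Y)
        rcases lt_or_gt_of_ne hn with hn | hn
        · exact hY _ (by lia)
        · have := hgY (a + m + n) (by lia)
          exact (h₂ (a + m + n) (by push_cast; lia)).of_iso
            (asIso ((cohomologyDb A (a + m + n)).map g)).symm
      obtain ⟨Z, ⟨e⟩⟩ := hY'
      intro n
      -- Degree `n` of `Y` is degree `p` of the shift by `a + m`, which is an object of the heart;
      -- `Φ` commutes with this shift.
      obtain ⟨p, rfl⟩ : ∃ p, n = a + m + p := ⟨n - (a + m), by lia⟩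
      obtain ⟨e'⟩ := hsingle Z p
      exact ⟨(cohomologyDbShift (a + m) p (Φ.obj Y)).symm ≪≫
        (cohomologyDb B p).mapIso ((Φ.commShiftIso (a + m : ℤ)).symm.app Y ≪≫ Φ.mapIso e.symm) ≪≫
        e' ≪≫ G.mapIso ((cohomologyDb A p).mapIso e ≪≫ cohomologyDbShift (a + m) p Y)⟩
    have hT' := Φ.map_distinguished _ hT
    -- `Φ X` and `Φ Y` inherit the vanishing ranges of `X` and `Y`, so the image triangle behaves
    -- like a truncation triangle for `Φ K`.
    have hX' : ∀ n, a + m ≤ n → IsZero ((cohomologyDb B n).obj (Φ.obj X)) := fun n hn =>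
      (G.map_isZero (hX n hn)).of_iso (HX n).some
    have hY' : ∀ n < a + m, IsZero ((cohomologyDb B n).obj (Φ.obj Y)) := fun n hn =>
      (G.map_isZero (hY n hn)).of_iso (HY n).some
    intro n
    by_cases hn : n < a + m
    · have := hfX n hn
      have : IsIso ((cohomologyDb B n).map (Φ.map f)) :=
        isIso_cohomologyDb_mor₁ _ hT' n (hY' _ (by lia)) (hY' _ (by lia))
      exact ⟨(asIso ((cohomologyDb B n).map (Φ.map f))).symm ≪≫ (HX n).some ≪≫
        G.mapIso (asIso ((cohomologyDb A n).map f))⟩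
    · have := hgY n (by lia)
      have : IsIso ((cohomologyDb B n).map (Φ.map g)) :=
        isIso_cohomologyDb_mor₂ _ hT' n (hX' _ (by lia)) (hX' _ (by lia))
      exact ⟨asIso ((cohomologyDb B n).map (Φ.map g)) ≪≫ (HY n).some ≪≫
        G.mapIso (asIso ((cohomologyDb A n).map g)).symm⟩

/-- A triangulated functor which restricts to the hearts commutes with cohomology. -/
lemma cohomologyDb_map (K : Db A) (n : ℤ) :
    Nonempty ((cohomologyDb B n).obj (Φ.obj K) ≅ G.obj ((cohomologyDb A n).obj K)) := by
  obtain ⟨a, b, ha, hb⟩ := exists_bounds K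
  -- The degrees from `a` to `b` are `b - a + 1` in number; `toNat` also covers an empty range.
  exact cohomologyDb_map_of_bounds Φ θ a (b - a + 1).toNat K ha (fun n hn => hb n (by lia)) n

/-- Each `H^n(Φ K)` is `G(H^n(K))`, and an object of `Db B` is zero as soon as its cohomology is. -/
lemma isZero_map_iff (K : Db A) :
    kernelOf Φ K ↔ ∀ n : ℤ, kernelOf G ((cohomologyDb A n).obj K) := by
  have := additive_of_singleDb_comp Φ θ
  constructor
  · intro h n
    exact ((cohomologyDb B n).map_isZero h).of_iso (cohomologyDb_map Φ θ K n).some.symm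
  · intro h
    exact isZero_of_cohomologyDb fun n => (h n).of_iso (cohomologyDb_map Φ θ K n).some

end TriangulatedFunctors


/-! ### Exact pairings -/

section Rigid

variable {C : Type*} [Category* C] [MonoidalCategory C]

/-- Injectivity of the duality map from `Y ⟶ W` to `𝟙_ C ⟶ X ⊗ W`: a zigzag identity recovers `f`
from its transpose. -/
lemma eq_of_coevaluation_whiskerLeft_eq {X Y W : C} [ExactPairing X Y] {f g : Y ⟶ W}
    (h : η_ X Y ≫ X ◁ f = η_ X Y ≫ X ◁ g) : f = g := by
  have key : ∀ f : Y ⟶ W, f = (ρ_ Y).inv ≫ Y ◁ (η_ X Y ≫ X ◁ f) ≫ (α_ Y X W).inv ≫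
      ε_ X Y ▷ W ≫ (λ_ W).hom := fun f => by
    rw [MonoidalCategory.whiskerLeft_comp, assoc, associator_inv_naturality_right_assoc,
      whisker_exchange_assoc, ExactPairing.coevaluation_evaluation_assoc]
    simp
  rw [key f, key g, h]

/-- By a zigzag identity the identity of `X` factors, up to unitors, through the whiskered
evaluation. -/
lemma isZero_of_evaluation_eq_zero [HasZeroMorphisms C] {X Y : C} [ExactPairing X Y]
    (hε : ε_ X Y = 0) [∀ Z : C, (tensorLeft Z).PreservesZeroMorphisms] : IsZero X := by
  have h := ExactPairing.evaluation_coevaluation X Y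
  have h' : X ◁ ε_ X Y = 0 := by
    rw [hε]
    exact (tensorLeft X).map_zero _ _
  rw [h', comp_zero, comp_zero] at h
  rw [IsZero.iff_id_eq_zero, ← cancel_epi (λ_ X).hom, ← cancel_mono (ρ_ X).inv, assoc, comp_zero,
    zero_comp, id_comp]
  exact h.symm

end Rigid

/-! ### Simplicity of the unit and products of nonzero objects -/

section TensorCategory

variable (k : Type*) [Field k] {C : Type*} [Category* C] [Abelian C] [Linear k C]
  [MonoidalCategory C] [MonoidalPreadditive C] [MonoidalLinear k C] [RigidCategory C]
  [IsTensorCategory k C]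

instance mono_whiskerLeft (Z : C) {X Y : C} (f : X ⟶ Y) [Mono f] : Mono (Z ◁ f) :=
  inferInstanceAs (Mono ((tensorLeft Z).map f))

instance epi_whiskerLeft (Z : C) {X Y : C} (f : X ⟶ Y) [Epi f] : Epi (Z ◁ f) :=
  inferInstanceAs (Epi ((tensorLeft Z).map f))

instance mono_whiskerRight (Z : C) {X Y : C} (f : X ⟶ Y) [Mono f] : Mono (f ▷ Z) :=
  inferInstanceAs (Mono ((tensorRight Z).map f))

include k in
lemma not_isZero_tensorUnit : ¬ IsZero (𝟙_ C) := fun h => by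
  have := (IsTensorCategory.bijective_unit (k := k) (C := C)).1
    (h.eq_of_src ((1 : k) • 𝟙 (𝟙_ C)) ((0 : k) • 𝟙 (𝟙_ C)))
  exact one_ne_zero this

include k in
/-- A nonzero endomorphism of the unit object is invertible. -/
lemma isIso_of_end_tensorUnit {f : 𝟙_ C ⟶ 𝟙_ C} (hf : f ≠ 0) : IsIso f := by
  obtain ⟨c, rfl⟩ := (IsTensorCategory.bijective_unit (k := k) (C := C)).2 f
  have hc : c ≠ 0 := by
    rintro rfl
    exact hf (zero_smul k _)
  exact ⟨c⁻¹ • 𝟙 _, by simp [smul_smul, hc], by simp [smul_smul, hc]⟩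

include k in
/-- The unit object of a tensor category is simple. -/
theorem simple_tensorUnit : Simple (𝟙_ C) := by
  have := IsTensorCategory.artinian k (𝟙_ C)
  -- It is shown that a simple subobject `S` of the unit is the whole unit, by producing a nonzero
  -- morphism `t : 𝟙_ C ⟶ S`.
  obtain ⟨S', hS⟩ := exists_simple_subobject (not_isZero_tensorUnit k (C := C))
  let S : C := S'
  let i : S ⟶ 𝟙_ C := S'.arrow
  have hi : Mono i := inferInstance
  have hS : Simple S := hS
  let T : C := HasRightDual.rightDual S
  -- The transpose of the inclusion `i`. It is epi because `i` remains mono after tensoring with any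
  -- object.
  let j : 𝟙_ C ⟶ T := η_ S T ≫ i ▷ T ≫ (λ_ T).hom
  have hj : Epi j := Preadditive.epi_of_cancel_zero _ (fun {W} g hg => by
    apply eq_of_coevaluation_whiskerLeft_eq (X := S)
    rw [← cancel_mono (i ▷ W), ← cancel_mono (λ_ W).hom, assoc, assoc, assoc, assoc,
      whisker_exchange_assoc, leftUnitor_naturality]
    simpa [j] using hg)
  -- If `S ⊗ T` were zero, so would be the coevaluation, hence `T`, hence the evaluation and `S`.
  have hne : ¬ IsZero (S ⊗ T) := fun h => by
    have h0 : η_ S T = 0 := h.eq_of_tgt _ _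
    have : 𝟙 T = 0 := eq_of_coevaluation_whiskerLeft_eq (X := S) (by rw [h0, zero_comp, zero_comp])
    have hT : IsZero T := (IsZero.iff_id_eq_zero T).2 this
    have hS0 : IsZero S := isZero_of_evaluation_eq_zero (Y := T)
      (((tensorRight S).map_isZero hT).eq_of_src _ _)
    exact Simple.not_isZero S hS0
  have : Simple (S ⊗ 𝟙_ C) := Simple.of_iso (ρ_ S)
  -- A nonzero epimorphism out of the simple object `S ⊗ 𝟙_ C` is invertible, so `S ⊗ T` is
  -- isomorphic to `S`; under this identification the coevaluation becomes `t`.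
  have h1 : S ◁ j ≠ 0 := fun h => hne (IsZero.of_epi_eq_zero _ h)
  have : Mono (S ◁ j) := mono_of_nonzero_from_simple h1
  have : IsIso (S ◁ j) := isIso_of_mono_of_epi _
  let t : 𝟙_ C ⟶ S := η_ S T ≫ inv (S ◁ j) ≫ (ρ_ S).hom
  have ht : t ≠ 0 := fun h => by
    have h0 : η_ S T = 0 := by
      rw [← cancel_mono (inv (S ◁ j) ≫ (ρ_ S).hom), zero_comp]
      exact h
    have : 𝟙 T = 0 := eq_of_coevaluation_whiskerLeft_eq (X := S) (by rw [h0, zero_comp, zero_comp])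
    exact hne ((tensorLeft S).map_isZero ((IsZero.iff_id_eq_zero T).2 this))
  have hti : t ≫ i ≠ 0 := fun h => ht (by rwa [← cancel_mono i, zero_comp])
  -- The nonzero endomorphism `t ≫ i` of the unit is a nonzero scalar, hence invertible; so `i` is
  -- epi as well as mono.
  have := isIso_of_end_tensorUnit k hti
  have : Epi i := epi_of_epi t i
  have : IsIso i := isIso_of_mono_of_epi _
  exact Simple.of_iso (asIso i).symm

include k in
/-- The tensor product of nonzero objects of a tensor category is nonzero. -/
theorem isZero_of_isZero_tensorObj {X Y : C} (h : IsZero (X ⊗ Y)) (hY : ¬ IsZero Y) :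
    IsZero X := by
  let Y' : C := HasLeftDual.leftDual Y
  have := simple_tensorUnit k (C := C)
  have hε : ε_ Y' Y ≠ 0 := fun h' => hY (by
    have h0 := ExactPairing.coevaluation_evaluation Y' Y
    have h1 : ε_ Y' Y ▷ Y = 0 := by
      rw [h']
      exact (tensorRight Y).map_zero _ _
    rw [h1, comp_zero, comp_zero] at h0
    rw [IsZero.iff_id_eq_zero, ← cancel_epi (ρ_ Y).hom, ← cancel_mono (λ_ Y).inv, assoc,
      comp_zero, zero_comp, id_comp]
    exact h0.symm)
  -- The evaluation is nonzero by a zigzag identity, hence epi onto the simple unit. Tensoring with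
  -- `X` presents `X` as a quotient of `X ⊗ Y ⊗ Y'`, which is zero.
  have : Epi (ε_ Y' Y) := epi_of_nonzero_to_simple hε
  have h2 : IsZero (X ⊗ Y ⊗ Y') := ((tensorRight Y').map_isZero h).of_iso (α_ X Y Y').symm
  exact (IsZero.of_epi (X ◁ ε_ Y' Y) h2).of_iso (ρ_ X).symm

end TensorCategory


/-! ### Top cohomology of a tensor product of complexes -/

section TopDegree

section

variable {C : Type*} [Category* C] [Abelian C] [HasDerivedCategory C]

/-- A cohomological bound becomes a bound on the terms of a representing complex, so tensor products
in `Db C` can be studied term by term. -/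
lemma exists_cb_isStrictlyLE (Y : Db C) (q : ℤ)
    (h : ∀ n, q < n → IsZero ((cohomologyDb C n).obj Y)) :
    ∃ K : Cb C, K.obj.IsStrictlyLE q ∧ Nonempty ((cbToDb C).obj K ≅ Y) := by
  obtain ⟨⟨a, ha⟩, -⟩ := Y.property
  have : Y.obj.IsGE a := ha
  have : Y.obj.IsLE q := (DerivedCategory.isLE_iff _ _).2 h
  obtain ⟨K, _, hK, ⟨e⟩⟩ := Y.obj.exists_iso_Q_obj_of_isGE_of_isLE a q
  exact ⟨⟨K, a, q, inferInstance, hK⟩, hK, ⟨DerivedCategory.Bounded.ι.preimageIso e.symm⟩⟩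

/-- The cohomology of a bounded complex. -/
noncomputable def cohomologyCbToDb (K : Cb C) (n : ℤ) :
    (cohomologyDb C n).obj ((cbToDb C).obj K) ≅ K.obj.homology n :=
  (DerivedCategory.homologyFunctorFactors C n).app K.obj

end

open HomologicalComplex

variable {C : Type*} [Category* C] [Abelian C] [MonoidalCategory C] [MonoidalPreadditive C]

lemma isZero_tensorObj_X (K L : CochainComplex C ℤ) [FinSupp K.X] [FinSupp L.X] (n : ℤ)
    (h : ∀ i j, i + j = n → IsZero (K.X i) ∨ IsZero (L.X j)) :
    IsZero ((HomologicalComplex.tensorObj K L).X n) := by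
  rw [IsZero.iff_id_eq_zero]
  apply Cofan.IsColimit.hom_ext (isColimitMapBifunctor (curriedTensor C) K L n)
  rintro ⟨⟨i, j⟩, hij⟩
  refine IsZero.eq_of_src ?_ _ _
  rcases h i j hij with h | h
  · exact isZero_tensor_left h _
  · exact isZero_tensor_right _ h

/-- Only one summand of the total complex survives in degree `n`. -/
lemma isIso_ιTensorObj (K L : CochainComplex C ℤ) [FinSupp K.X] [FinSupp L.X] (q r n : ℤ)
    (hn : q + r = n) (h : ∀ i j, i + j = n → i ≠ q → IsZero (K.X i) ∨ IsZero (L.X j)) :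
    IsIso (ιTensorObj K L q r n hn) := by
  refine isIso_inj (isColimitMapBifunctor (curriedTensor C) K L n) ⟨(q, r), hn⟩ ?_
  rintro ⟨⟨i, j⟩, hij⟩ hne
  replace hij : i + j = n := hij
  have hi : i ≠ q := by
    rintro rfl
    obtain rfl : j = r := by lia
    exact hne rfl
  rcases h i j hij hi with h | h
  · exact isZero_tensor_left h _
  · exact isZero_tensor_right _ h

instance (q : ℤ) (X : C) : FinSupp ((single C (ComplexShape.up ℤ) q).obj X).X where
  finite := (Set.finite_singleton q).subset fun i hi => by
    by_contra h
    exact hi (isZero_single_obj_X (ComplexShape.up ℤ) q X i h)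

lemma isZero_homology_tensorObj (K L : CochainComplex C ℤ) [FinSupp K.X] [FinSupp L.X] (q r n : ℤ)
    [K.IsStrictlyLE q] [L.IsStrictlyLE r] (hn : q + r < n) :
    IsZero ((HomologicalComplex.tensorObj K L).homology n) := by
  refine (ShortComplex.exact_iff_isZero_homology _).1 (ShortComplex.exact_of_isZero_X₂ _
    (isZero_tensorObj_X K L n fun i j hij => ?_))
  by_cases hi : q < i
  · exact Or.inl (K.isZero_of_isStrictlyLE q i hi)
  · exact Or.inr (L.isZero_of_isStrictlyLE r j (by lia))

/-- The top cohomology of a tensor product of complexes surjects to the tensor product of the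
top cohomology objects. -/
lemma isZero_tensor_homology (K L : CochainComplex C ℤ) [FinSupp K.X] [FinSupp L.X] (q r : ℤ)
    [K.IsStrictlyLE q] [L.IsStrictlyLE r]
    [∀ X : C, PreservesFiniteColimits (tensorLeft X)]
    [∀ X : C, PreservesFiniteColimits (tensorRight X)]
    (h : IsZero ((HomologicalComplex.tensorObj K L).homology (q + r))) :
    IsZero (K.homology q ⊗ L.homology r) := by
  -- In their top degrees `K` and `L` map onto their opcycles, which are there the cohomology
  -- objects. Tensoring these maps gives `t`, epi in degree `q + r` by right exactness of the tensor
  -- product.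
  let T := HomologicalComplex.tensorObj ((single C (ComplexShape.up ℤ) q).obj (K.opcycles q))
    ((single C (ComplexShape.up ℤ) r).obj (L.opcycles r))
  let f : K ⟶ (single C (ComplexShape.up ℤ) q).obj (K.opcycles q) :=
    mkHomToSingle (K.pOpcycles q) (fun i _ => K.d_pOpcycles i q)
  let g : L ⟶ (single C (ComplexShape.up ℤ) r).obj (L.opcycles r) :=
    mkHomToSingle (L.pOpcycles r) (fun i _ => L.d_pOpcycles i r)
  have hf : Epi (f.f q) := by
    rw [mkHomToSingle_f]
    infer_instance
  have hg : Epi (g.f r) := by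
    rw [mkHomToSingle_f]
    infer_instance
  have hι : IsIso (ιTensorObj ((single C (ComplexShape.up ℤ) q).obj (K.opcycles q))
    ((single C (ComplexShape.up ℤ) r).obj (L.opcycles r)) q r (q + r) rfl) :=
    isIso_ιTensorObj _ _ q r (q + r) rfl
      (fun i j _ hi => Or.inl (isZero_single_obj_X (ComplexShape.up ℤ) q _ i hi))
  let t : HomologicalComplex.tensorObj K L ⟶ T := HomologicalComplex.tensorHom f g
  have ht : Epi (t.f (q + r)) := by
    have h1 := ιTensorObj_tensorHom f g q r (q + r) rfl
    have h2 : Epi (f.f q ⊗ₘ g.f r) := by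
      rw [MonoidalCategory.tensorHom_def]
      have : Epi (f.f q ▷ L.X r) := inferInstanceAs (Epi ((tensorRight _).map _))
      have : Epi (((single C (ComplexShape.up ℤ) q).obj (K.opcycles q)).X q ◁ g.f r) :=
        inferInstanceAs (Epi ((tensorLeft _).map _))
      exact epi_comp _ _
    have h3 : Epi ((f.f q ⊗ₘ g.f r) ≫ ιTensorObj ((single C (ComplexShape.up ℤ) q).obj
      (K.opcycles q)) ((single C (ComplexShape.up ℤ) r).obj (L.opcycles r)) q r (q + r) rfl) :=
      epi_comp _ _
    rw [← h1] at h3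
    exact epi_of_epi (ιTensorObj K L q r (q + r) rfl) (t.f (q + r))
  -- The complex `K ⊗ L` vanishes above `q + r`, so vanishing of the cohomology there means that the
  -- last differential is epi.
  have hd : Epi ((HomologicalComplex.tensorObj K L).d (q + r - 1) (q + r)) := by
    have h1 := (exactAt_iff_isZero_homology _ _).2 h
    rw [exactAt_iff' _ (q + r - 1) (q + r) (q + r + 1) (by simp) (by simp)] at h1
    refine h1.epi_f (IsZero.eq_of_tgt (isZero_tensorObj_X K L _ fun i j hij => ?_) _ _)
    by_cases hi : q < i
    · exact Or.inl (K.isZero_of_isStrictlyLE q i hi)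
    · exact Or.inr (L.isZero_of_isStrictlyLE r j (by lia))
  -- `T` is zero in degree `q + r - 1`, so `t` kills the image of the differential, which is
  -- everything.
  have h0 : t.f (q + r) = 0 := by
    rw [← cancel_epi ((HomologicalComplex.tensorObj K L).d (q + r - 1) (q + r)), comp_zero,
      ← t.comm]
    have : IsZero (T.X (q + r - 1)) := isZero_tensorObj_X _ _ _ fun i j hij => by
      by_cases hi : i = q
      · exact Or.inr (isZero_single_obj_X (ComplexShape.up ℤ) r _ j (by lia))
      · exact Or.inl (isZero_single_obj_X (ComplexShape.up ℤ) q _ i hi)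
    rw [this.eq_of_tgt (t.f _) 0, zero_comp]
  have hT : IsZero (T.X (q + r)) := IsZero.of_epi_eq_zero _ h0
  -- The outgoing differential in the top degree is zero, so homology and opcycles agree.
  have e₁ := K.isoHomologyι q (q + 1) (by simp)
    ((K.isZero_of_isStrictlyLE q (q + 1) (by lia)).eq_of_tgt _ _)
  have e₂ := L.isoHomologyι r (r + 1) (by simp)
    ((L.isZero_of_isStrictlyLE r (r + 1) (by lia)).eq_of_tgt _ _)
  exact hT.of_iso ((e₁ ≪≫ (singleObjXSelf (ComplexShape.up ℤ) q _).symm ⊗ᵢ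
    e₂ ≪≫ (singleObjXSelf (ComplexShape.up ℤ) r _).symm) ≪≫
      @asIso _ _ _ _ _ hι)

variable [HasDerivedCategory C]

variable [BiexactTensor C]

lemma isZero_cohomologyDb_tensorObj {Y Z : Db C} {q r : ℤ}
    (hY : ∀ n, q < n → IsZero ((cohomologyDb C n).obj Y))
    (hZ : ∀ n, r < n → IsZero ((cohomologyDb C n).obj Z)) (n : ℤ) (hn : q + r < n) :
    IsZero ((cohomologyDb C n).obj (Y ⊗ Z)) := by
  obtain ⟨K, hK, ⟨eK⟩⟩ := exists_cb_isStrictlyLE Y q hY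
  obtain ⟨L, hL, ⟨eL⟩⟩ := exists_cb_isStrictlyLE Z r hZ
  exact (isZero_homology_tensorObj K.obj L.obj q r n hn).of_iso
    ((cohomologyDb C n).mapIso ((eK.symm ⊗ᵢ eL.symm) ≪≫ Functor.Monoidal.μIso (cbToDb C) K L) ≪≫
      cohomologyCbToDb (K ⊗ L) n)

/-- `q` and `r` are only upper bounds on the cohomological degrees; with both representatives cut
off there, the statement about complexes applies. -/
lemma isZero_tensorObj_cohomologyDb {Y Z : Db C} {q r : ℤ}
    (hY : ∀ n, q < n → IsZero ((cohomologyDb C n).obj Y))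
    (hZ : ∀ n, r < n → IsZero ((cohomologyDb C n).obj Z))
    (h : IsZero ((cohomologyDb C (q + r)).obj (Y ⊗ Z))) :
    IsZero ((cohomologyDb C q).obj Y ⊗ (cohomologyDb C r).obj Z) := by
  obtain ⟨K, hK, ⟨eK⟩⟩ := exists_cb_isStrictlyLE Y q hY
  obtain ⟨L, hL, ⟨eL⟩⟩ := exists_cb_isStrictlyLE Z r hZ
  have := BiexactTensor.left_colim (C := C)
  have := BiexactTensor.right_colim (C := C)
  refine (isZero_tensor_homology K.obj L.obj q r (h.of_iso ?_)).of_iso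
    (((cohomologyDb C q).mapIso eK.symm ≪≫ cohomologyCbToDb K q) ⊗ᵢ
      ((cohomologyDb C r).mapIso eL.symm ≪≫ cohomologyCbToDb L r))
  exact ((cohomologyDb C (q + r)).mapIso
    ((eK.symm ⊗ᵢ eL.symm) ≪≫ Functor.Monoidal.μIso (cbToDb C) K L) ≪≫
      cohomologyCbToDb (K ⊗ L) (q + r)).symm

end TopDegree

/-! ### Duality in the derived category -/

section Duality

/-- A monoidal functor preserves exact pairings. -/
@[reducible]
def exactPairingMap {C D : Type*} [Category* C] [Category* D] [MonoidalCategory C]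
    [MonoidalCategory D] (Φ : C ⥤ D) [Φ.Monoidal] (X Y : C) [ExactPairing X Y] :
    ExactPairing (Φ.obj X) (Φ.obj Y) where
  coevaluation' := Functor.LaxMonoidal.ε Φ ≫ Φ.map (η_ X Y) ≫ Functor.OplaxMonoidal.δ Φ X Y
  evaluation' := Functor.LaxMonoidal.μ Φ Y X ≫ Φ.map (ε_ X Y) ≫ Functor.OplaxMonoidal.η Φ
  coevaluation_evaluation' := by
    have h := congr_arg Φ.map (ExactPairing.coevaluation_evaluation X Y)
    -- Reassociating in the target is the image of reassociating in the source; with this the zigzag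
    -- identity of `Φ` becomes `Φ` applied to that of the source. The second identity follows in the
    -- same way.
    have h₁ : Φ.obj Y ◁ Functor.OplaxMonoidal.δ Φ X Y ≫ (α_ _ _ _).inv ≫
        Functor.LaxMonoidal.μ Φ Y X ▷ Φ.obj Y = Functor.LaxMonoidal.μ Φ Y (X ⊗ Y) ≫
          Φ.map (α_ Y X Y).inv ≫ Functor.OplaxMonoidal.δ Φ (Y ⊗ X) Y := by
      rw [← cancel_mono (Functor.LaxMonoidal.μ Φ (Y ⊗ X) Y), assoc, assoc, assoc, assoc,
        Functor.Monoidal.δ_μ, comp_id, ← Functor.LaxMonoidal.associativity_inv,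
        ← whiskerLeft_comp_assoc, Functor.Monoidal.δ_μ]
      simp
    simp only [MonoidalCategory.whiskerLeft_comp, comp_whiskerRight, assoc]
    rw [reassoc_of% h₁, Functor.LaxMonoidal.μ_natural_right_assoc,
      Functor.OplaxMonoidal.δ_natural_left_assoc, ← Functor.map_comp_assoc,
      ← Functor.map_comp_assoc, assoc, h, Functor.map_comp, assoc,
      ← Functor.OplaxMonoidal.left_unitality, ← Functor.LaxMonoidal.right_unitality_assoc]
  evaluation_coevaluation' := by
    have h := congr_arg Φ.map (ExactPairing.evaluation_coevaluation X Y)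
    have h₁ : Functor.OplaxMonoidal.δ Φ X Y ▷ Φ.obj X ≫ (α_ _ _ _).hom ≫
        Φ.obj X ◁ Functor.LaxMonoidal.μ Φ Y X = Functor.LaxMonoidal.μ Φ (X ⊗ Y) X ≫
          Φ.map (α_ X Y X).hom ≫ Functor.OplaxMonoidal.δ Φ X (Y ⊗ X) := by
      rw [← cancel_mono (Functor.LaxMonoidal.μ Φ X (Y ⊗ X)), assoc, assoc, assoc, assoc,
        Functor.Monoidal.δ_μ, comp_id, ← Functor.LaxMonoidal.associativity,
        ← comp_whiskerRight_assoc, Functor.Monoidal.δ_μ]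
      simp
    simp only [MonoidalCategory.whiskerLeft_comp, comp_whiskerRight, assoc]
    rw [reassoc_of% h₁, Functor.LaxMonoidal.μ_natural_left_assoc,
      Functor.OplaxMonoidal.δ_natural_right_assoc, ← Functor.map_comp_assoc,
      ← Functor.map_comp_assoc, assoc, h, Functor.map_comp, assoc,
      ← Functor.OplaxMonoidal.right_unitality, ← Functor.LaxMonoidal.left_unitality_assoc]

variable {D : Type*} [Category* D] [Abelian D] [HasDerivedCategory D]

/-- The orthogonality axiom of the t-structure, read in terms of cohomology. -/
lemma hom_eq_zero {X Y : Db D} (n : ℤ) (hX : ∀ m, n ≤ m → IsZero ((cohomologyDb D m).obj X))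
    (hY : ∀ m < n, IsZero ((cohomologyDb D m).obj Y)) (f : X ⟶ Y) : f = 0 := by
  have h₁ : DerivedCategory.TStructure.t.IsLE (DerivedCategory.Bounded.ι.obj X) (n - 1) :=
    (DerivedCategory.isLE_iff _ _).2 fun m hm => hX m (by lia)
  have h₂ : DerivedCategory.TStructure.t.IsGE (DerivedCategory.Bounded.ι.obj Y) n :=
    (DerivedCategory.isGE_iff _ _).2 hY
  apply DerivedCategory.Bounded.ι.map_injective
  rw [Functor.map_zero]
  exact DerivedCategory.TStructure.t.zero _ (n - 1) n (by lia)

variable [MonoidalCategory D] [MonoidalPreadditive D] [BiexactTensor D]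

/-- By duality, the map from the negative truncation `X` to `Y` corresponds to a map from `Y' ⊗ X`
to the unit. Its source lives in negative degrees and its target in degree `0`, so it vanishes, and
the negative cohomology of `Y` embeds in that of `Z`, which is zero. -/
lemma isZero_cohomologyDb_of_exactPairing {Y Y' : Db D} [ExactPairing Y Y']
    (hY' : ∀ n, 0 < n → IsZero ((cohomologyDb D n).obj Y')) (n : ℤ) (hn : n < 0) :
    IsZero ((cohomologyDb D n).obj Y) := by
  obtain ⟨X, Z, f, g, h, hT, hX, hZ⟩ := exists_truncation_triangle Y 0
  have hf : f = 0 := by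
    have h₁ : ∀ u : Y' ⊗ X ⟶ 𝟙_ (Db D), u = 0 := by
      -- `Y'` is bounded above by `0` and `X` by `-1`, so their product is bounded above by `-1`.
      refine hom_eq_zero 0 (fun m hm => isZero_cohomologyDb_tensorObj (q := 0) (r := -1) hY'
        (fun n hn => hX n (by lia)) m (by lia)) (fun m hm => ?_)
      exact (isZero_cohomologyDb_singleDb (𝟙_ D) m hm.ne).of_iso
        ((cohomologyDb D m).mapIso (Functor.Monoidal.εIso (singleDb D)))
    have h₂ : f ≫ (ρ_ Y).inv = 0 := (tensorLeftHomEquiv X Y Y' (𝟙_ (Db D))).symm.injective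
      ((h₁ _).trans (h₁ _).symm)
    rw [← cancel_mono (ρ_ Y).inv, h₂, zero_comp]
  have h₁ := exact_cohomologyDb _ hT n
  have h₂ : (cohomologyDb D n).map f = 0 := by rw [hf, Functor.map_zero]
  have : Mono ((cohomologyDb D n).map g) := h₁.mono_g h₂
  exact IsZero.of_mono ((cohomologyDb D n).map g) (hZ n hn)

end Duality


/-! ### Finite length and dévissage -/

section FiniteLength

variable {A C : Type*} [Category* A] [Category* C] [Abelian A] [Abelian C] (i : A ⥤ C)
  [i.Faithful] [PreservesFiniteLimits i] [PreservesFiniteColimits i]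

/-- A faithful functor between abelian categories is conservative, so a proper inclusion stays
proper. Chain conditions on `i.obj X` therefore descend to `X`. -/
lemma strictMono_subobject_map (X : A) :
    StrictMono (fun S : Subobject X => Subobject.mk (i.map S.arrow)) := by
  have : i.ReflectsIsomorphisms :=
    reflectsIsomorphisms_of_reflectsMonomorphisms_of_reflectsEpimorphisms i
  intro S T h
  have e : i.map S.arrow = i.map (S.ofLE T h.le) ≫ i.map T.arrow := by
    rw [← i.map_comp, Subobject.ofLE_arrow]
  refine lt_of_le_of_ne (Subobject.mk_le_mk_of_comm (i.map (S.ofLE T h.le)) e.symm) fun h' => ?_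
  let u := Subobject.isoOfMkEqMk _ _ h'
  have hu : u.hom = i.map (S.ofLE T h.le) := by
    rw [← cancel_mono (i.map T.arrow), ← e]
    exact Subobject.ofMkLEMk_comp _
  have : IsIso (i.map (S.ofLE T h.le)) := hu ▸ inferInstance
  have : IsIso (S.ofLE T h.le) := isIso_of_reflects_iso _ i
  exact h.not_ge (Subobject.le_of_comm (inv (S.ofLE T h.le)) (by simp))

lemma isNoetherianObject_of_faithful (X : A) [IsNoetherianObject (i.obj X)] :
    IsNoetherianObject X := by
  rw [isNoetherianObject_iff_not_strictMono]
  exact fun f hf => not_strictMono_of_isNoetherianObject _ ((strictMono_subobject_map i X).comp hf)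

lemma isArtinianObject_of_faithful (X : A) [IsArtinianObject (i.obj X)] :
    IsArtinianObject X := by
  rw [isArtinianObject_iff_not_strictAnti]
  exact fun f hf => not_strictAnti_of_isArtinianObject _
    ((strictMono_subobject_map i X).comp_strictAnti hf)

/-- A property of objects which holds for the zero objects and is stable under extensions by simple
objects holds for all objects of an abelian category in which objects have finite length. -/
lemma of_extensions_by_simple (P : ObjectProperty A) [P.IsClosedUnderIsomorphisms] (X : A)
    [IsNoetherianObject X]
    (hA : ∀ Y : A, IsArtinianObject Y) (h₀ : ∀ Y, IsZero Y → P Y)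
    (h : ∀ S : ShortComplex A, S.ShortExact → P S.X₁ → Simple S.X₃ → P S.X₂) : P X := by
  -- Take a maximal subobject with the property. If it is proper, pulling back a simple subobject of
  -- the quotient gives a strictly larger one.
  obtain ⟨N, hN, hmax⟩ := (wellFounded_gt (α := Subobject X)).has_min
    {N : Subobject X | P (N : A)} ⟨⊥, h₀ _ (IsZero.of_iso (isZero_zero A) Subobject.botCoeIsoZero)⟩
  let π := cokernel.π N.arrow
  have hex : (ShortComplex.mk N.arrow π (cokernel.condition _)).Exact :=
    ShortComplex.exact_cokernel N.arrow
  by_cases hQ : IsZero (cokernel N.arrow)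
  · have : Epi N.arrow := Preadditive.epi_of_isZero_cokernel _ hQ
    have : IsIso N.arrow := isIso_of_mono_of_epi _
    exact P.prop_of_iso (asIso N.arrow) hN
  · have := hA (cokernel N.arrow)
    obtain ⟨S, hS⟩ := exists_simple_subobject hQ
    let N' := pullback π S.arrow
    let u : (N : A) ⟶ N' := pullback.lift N.arrow 0 (by simp [π])
    have hu : u ≫ pullback.fst _ _ = N.arrow := pullback.lift_fst _ _ _
    have hu' : u ≫ pullback.snd _ _ = 0 := pullback.lift_snd _ _ _
    have : Mono (u ≫ pullback.fst π S.arrow) := by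
      rw [hu]
      infer_instance
    have : Mono u := mono_of_mono u (pullback.fst π S.arrow)
    have hses : (ShortComplex.mk u (pullback.snd π S.arrow) hu').ShortExact :=
      { exact := by
          refine ShortComplex.exact_of_f_is_kernel _ (KernelFork.IsLimit.ofι' _ _ fun {W} k hk => ?_)
          have hk' : (k ≫ pullback.fst π S.arrow) ≫ π = 0 := by
            rw [assoc, pullback.condition, reassoc_of% hk, zero_comp]
          refine ⟨hex.lift (k ≫ pullback.fst _ _) hk', ?_⟩
          rw [← cancel_mono (pullback.fst π S.arrow), assoc, hu]
          exact hex.lift_f _ _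
        mono_f := inferInstance
        epi_g := inferInstance }
    have hP := h _ hses hN hS
    refine (hmax (Subobject.mk (pullback.fst π S.arrow)) ?_ ?_).elim
    · exact P.prop_of_iso (Subobject.underlyingIso _).symm hP
    · refine lt_of_le_not_ge (Subobject.le_mk_of_comm u hu) fun hle => ?_
      have h₁ : pullback.fst π S.arrow = Subobject.ofMkLE _ _ hle ≫ N.arrow :=
        (Subobject.ofMkLE_arrow _).symm
      have h₂ : pullback.snd π S.arrow ≫ S.arrow = 0 := by
        rw [← pullback.condition, h₁, assoc, cokernel.condition, comp_zero]
      have h₃ : pullback.snd π S.arrow = 0 := by rwa [← cancel_mono S.arrow, zero_comp]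
      exact Simple.not_isZero (S : A) (IsZero.of_epi_eq_zero _ h₃)

end FiniteLength

/-! ### Uniform cohomological bound -/

section Bound

variable {A B : Type*} [Category* A] [Category* B] [Abelian A] [Abelian B]
  [HasDerivedCategory A] [HasDerivedCategory B] (Ψ : Db A ⥤ Db B) [Ψ.CommShift ℤ]
  [Ψ.IsTriangulated]

/-- The objects of an abelian category which are sent to complexes without cohomology
in degrees greater than `b`. -/
def cohomologyLE (b : ℤ) : ObjectProperty A := fun M =>
  ∀ n, b < n → IsZero ((cohomologyDb B n).obj (Ψ.obj ((singleDb A).obj M)))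

instance (b : ℤ) : (cohomologyLE Ψ b).IsClosedUnderIsomorphisms where
  of_iso e h n hn := (h n hn).of_iso
    ((cohomologyDb B n).mapIso (Ψ.mapIso ((singleDb A).mapIso e.symm)))

/-- The maximum of the bounds for the finitely many simple objects works for all objects, since the
long exact sequence makes the property stable under extensions. -/
lemma exists_cohomologyLE (hA : HasFinitelyManySimples A) (hN : ∀ X : A, IsNoetherianObject X)
    (hA' : ∀ X : A, IsArtinianObject X) : ∃ b, ∀ M, cohomologyLE Ψ b M := by
  obtain ⟨m, S, hS⟩ := hA
  choose a b hab using fun j => exists_bounds (Ψ.obj ((singleDb A).obj (S j)))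
  obtain ⟨c, hc⟩ := (Set.finite_range b).bddAbove
  refine ⟨c, fun M => ?_⟩
  have := hN M
  refine of_extensions_by_simple (cohomologyLE Ψ c) M hA' (fun Y hY n _ => ?_)
    (fun T hT h₁ h₃ n hn => ?_)
  · exact (cohomologyDb B n).map_isZero (Ψ.map_isZero ((singleDb A).map_isZero hY))
  · obtain ⟨j, ⟨e⟩⟩ := hS _ h₃
    obtain ⟨h, hT'⟩ := exists_triangle_singleDb hT
    have hex := exact_cohomologyDb _ (Ψ.map_distinguished _ hT') n
    refine hex.isZero_of_both_zeros ((h₁ n hn).eq_of_src _ _) (IsZero.eq_of_tgt ?_ _ _)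
    exact ((hab j).2 n (lt_of_le_of_lt (hc ⟨j, rfl⟩) hn)).of_iso
      ((cohomologyDb B n).mapIso (Ψ.mapIso ((singleDb A).mapIso e)))

lemma exists_isGreatest_cohomology (hA : HasFinitelyManySimples A)
    (hN : ∀ X : A, IsNoetherianObject X) (hA' : ∀ X : A, IsArtinianObject X)
    (h : ∃ M, ¬ IsZero (Ψ.obj ((singleDb A).obj M))) :
    ∃ b M, ¬ IsZero ((cohomologyDb B b).obj (Ψ.obj ((singleDb A).obj M))) ∧
      ∀ M, cohomologyLE Ψ b M := by
  obtain ⟨c, hc⟩ := exists_cohomologyLE Ψ hA hN hA'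
  -- The degrees where some image has cohomology are bounded above; they form a nonempty set since
  -- some image is nonzero.
  obtain ⟨b, ⟨M, hM⟩, hb⟩ := Int.exists_greatest_of_bdd
    (P := fun n => ∃ M, ¬ IsZero ((cohomologyDb B n).obj (Ψ.obj ((singleDb A).obj M))))
    ⟨c, fun n ⟨M, hM⟩ => by
      by_contra hn
      exact hM (hc M n (by lia))⟩ (by
    obtain ⟨M, hM⟩ := h
    by_contra! h'
    exact hM (isZero_of_cohomologyDb fun n => h' n M))
  refine ⟨b, M, hM, fun M' n hn => ?_⟩
  by_contra hM'
  have := hb n ⟨M', hM'⟩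
  lia

end Bound


/-! ### Objects of the heart under actions and duality -/

section Heart

variable {D B : Type*} [Category* D] [Category* B] [Abelian D] [Abelian B]
  [MonoidalCategory D] [MonoidalPreadditive D] [BiexactTensor D]
  [HasDerivedCategory D] [HasDerivedCategory B]
  (iB : B ⥤ D) [iB.Faithful] [iB.Additive] [PreservesFiniteLimits iB] [PreservesFiniteColimits iB]
  [MonoidalLeftAction (Db D) (Db B)] (jB : ModuleFunctorOver (𝟭 (Db D)) (mapDb iB))

include jB in
/-- The action of an object of the heart on the bounded derived category preserves the heart. -/
lemma essImage_singleDb_action {Y : Db D} (hY : (singleDb D).essImage Y) (N : B) :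
    (singleDb B).essImage (Y ⊙ₗ (singleDb B).obj N) := by
  obtain ⟨Z, ⟨e⟩⟩ := hY
  refine essImage_singleDb_of_mapDb iB ⟨Z ⊗ iB.obj N, ⟨?_⟩⟩
  exact (Functor.Monoidal.μIso (singleDb D) Z (iB.obj N)).symm ≪≫
    (e ⊗ᵢ (singleDbCompMapDb iB).symm.app N) ≪≫ (jB.iso Y ((singleDb B).obj N)).symm

variable {C : Type*} [Category* C] [MonoidalCategory C]

/-- If a monoidal functor from a rigid category to `Db D` takes its values in the complexes without
cohomology in positive degrees, it takes its values in the heart. -/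
lemma essImage_singleDb_of_monoidal [RigidCategory C] (Φ : C ⥤ Db D) [Φ.Monoidal]
    (h : ∀ X n, 0 < n → IsZero ((cohomologyDb D n).obj (Φ.obj X))) (X : C) :
    (singleDb D).essImage (Φ.obj X) := by
  rw [essImage_singleDb_iff]
  intro n hn
  rcases lt_or_gt_of_ne hn with hn | hn
  -- Negative degrees: `Φ` carries the dual of `X` to a dual of `Φ.obj X`, and the bound `h` applies
  -- to it too.
  · let _ := exactPairingMap Φ X (HasRightDual.rightDual X)
    exact isZero_cohomologyDb_of_exactPairing (Y' := Φ.obj (HasRightDual.rightDual X))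
      (h _) n hn
  · exact h X n hn

end Heart

/-! ### The tensor category is sent to the heart -/

section Tensor

variable {k : Type*} [Field k]
  {C : Type*} [Category* C] [Abelian C] [MonoidalCategory C]
  [MonoidalPreadditive C] [RigidCategory C]
  {D : Type*} [Category* D] [Abelian D] [Linear k D] [MonoidalCategory D]
  [MonoidalPreadditive D] [MonoidalLinear k D] [RigidCategory D] [IsTensorCategory k D]
  {A : Type*} [Category* A] [Abelian A] {B : Type*} [Category* B] [Abelian B]
  [HasDerivedCategory C] [HasDerivedCategory D] [HasDerivedCategory A] [HasDerivedCategory B]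
  (iA : A ⥤ C) [iA.Faithful] [iA.Additive] [PreservesFiniteLimits iA] [PreservesFiniteColimits iA]
  (iB : B ⥤ D) [iB.Faithful] [iB.Additive] [PreservesFiniteLimits iB] [PreservesFiniteColimits iB]
  [MonoidalLeftAction (Db C) (Db A)] (jA : ModuleFunctorOver (𝟭 (Db C)) (mapDb iA))
  (F : Db C ⥤ Db D) [F.Monoidal]
  (FA : Db A ⥤ Db B) [FA.CommShift ℤ] [FA.IsTriangulated]
  (φ : mapDb iA ⋙ F ≅ FA ⋙ mapDb iB)

include k jA φ in
/-- If the objects of `A` are not all sent to zero, then the objects of the tensor category `C` are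
sent to the heart of `Db D`. -/
theorem essImage_singleDb_map (hA : HasFinitelyManySimples A)
    (hN : ∀ X : A, IsNoetherianObject X) (hA' : ∀ X : A, IsArtinianObject X)
    (h : ∃ M, ¬ IsZero (FA.obj ((singleDb A).obj M))) (X : C) :
    (singleDb D).essImage (F.obj ((singleDb C).obj X)) := by
  -- `b` is the highest cohomological degree that occurs among all objects of `A`, and `M` attains
  -- it.
  obtain ⟨b, M, hM, hb⟩ := exists_isGreatest_cohomology FA hA hN hA' h
  refine essImage_singleDb_of_monoidal (singleDb C ⋙ F) (fun X n hn => ?_) X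
  by_contra hX
  obtain ⟨-, c, -, hc⟩ := exists_bounds (F.obj ((singleDb C).obj X))
  -- The top degree of `F(X)`; it is at least `n`, hence positive.
  obtain ⟨q, hq, hq'⟩ := Int.exists_greatest_of_bdd
    (P := fun n => ¬ IsZero ((cohomologyDb D n).obj (F.obj ((singleDb C).obj X))))
    ⟨c, fun n hn => by
      by_contra h'
      exact hn (hc n (by lia))⟩ ⟨n, hX⟩
  have hnq := hq' n hX
  -- `X ⊙ M` is again an object `M'` of `A`, so its image has no cohomology in degree `q + b > b`.
  obtain ⟨M', ⟨e⟩⟩ := essImage_singleDb_action iA jA ⟨X, ⟨Iso.refl _⟩⟩ M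
  have e' : (mapDb iB).obj (FA.obj ((singleDb A).obj M')) ≅
      F.obj ((singleDb C).obj X) ⊗ (mapDb iB).obj (FA.obj ((singleDb A).obj M)) :=
    (mapDb iB).mapIso (FA.mapIso e) ≪≫ (φ.app _).symm ≪≫ F.mapIso (jA.iso _ _) ≪≫
      (Functor.Monoidal.μIso F _ _).symm ≪≫ whiskerLeftIso _ (φ.app _)
  obtain ⟨e₁⟩ := cohomologyDb_mapDb iB (q + b) (FA.obj ((singleDb A).obj M'))
  obtain ⟨e₂⟩ := cohomologyDb_mapDb iB b (FA.obj ((singleDb A).obj M))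
  -- The vanishing in degree `q + b` kills the product of the two top cohomology objects; the one of
  -- `M` is nonzero, so the one of `F(X)` is zero, against the choice of `q`.
  refine hq (isZero_of_isZero_tensorObj k (isZero_tensorObj_cohomologyDb
    (Z := (mapDb iB).obj (FA.obj ((singleDb A).obj M))) (r := b) (fun n hn => ?_) (fun n hn => ?_)
      ?_) (fun h' => hM ?_))
  · by_contra h'
    have := hq' n h'
    lia
  · obtain ⟨e₃⟩ := cohomologyDb_mapDb iB n (FA.obj ((singleDb A).obj M))
    exact (iB.map_isZero (hb M n hn)).of_iso e₃
  · exact (iB.map_isZero (hb M' (q + b) (by lia))).of_iso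
      ((cohomologyDb D (q + b)).mapIso e'.symm ≪≫ e₁)
  · exact isZero_of_faithful iB (h'.of_iso e₂.symm)

end Tensor

/-! ### Module structures as natural isomorphisms -/

namespace ModuleFunctorOver

variable {T T' K K' : Type*} [Category* T] [Category* T'] [Category* K] [Category* K']
  [MonoidalCategory T] [MonoidalCategory T'] [MonoidalLeftAction T K] [MonoidalLeftAction T' K']
  {Φ : T ⥤ T'} [Φ.Monoidal] {G : K ⥤ K'} (s : ModuleFunctorOver Φ G)

/-- The compatibility isomorphisms of a module functor, in the second variable. -/
noncomputable def leftIso (X : T) : MonoidalLeftAction.actionLeft K X ⋙ G ≅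
    G ⋙ MonoidalLeftAction.actionLeft K' (Φ.obj X) :=
  NatIso.ofComponents (fun M => s.iso X M) (fun g => s.naturality_right X g)

/-- The compatibility isomorphisms of a module functor, in the first variable. -/
noncomputable def rightIso (M : K) : MonoidalLeftAction.actionRight T M ⋙ G ≅
    Φ ⋙ MonoidalLeftAction.actionRight T' (G.obj M) :=
  NatIso.ofComponents (fun X => s.iso X M) (fun f => s.naturality_left f M)

end ModuleFunctorOver

/-- The action of isomorphic objects. -/
noncomputable def actionLeftMapIso {T K : Type*} [Category* T] [Category* K] [MonoidalCategory T]
    [MonoidalLeftAction T K] {X Y : T} (e : X ≅ Y) :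
    MonoidalLeftAction.actionLeft K X ≅ MonoidalLeftAction.actionLeft K Y :=
  NatIso.ofComponents (fun M => actionLeftIso e M)
    (fun f => (MonoidalLeftAction.action_exchange e.hom f))

/-! ### Exactness and linearity through faithful functors -/

section Reflection

variable {T B D : Type*} [Category* T] [Category* B] [Category* D]

/-- A faithful exact functor is conservative, hence reflects the finite limits and colimits it
preserves. -/
lemma exact_of_comp_faithful [Abelian B] [Abelian D] (i : B ⥤ D)
    [i.Faithful] [PreservesFiniteLimits i] [PreservesFiniteColimits i] {P : T ⥤ B} {R : T ⥤ D}
    (e : P ⋙ i ≅ R) [PreservesFiniteLimits R] [PreservesFiniteColimits R] :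
    PreservesFiniteLimits P ∧ PreservesFiniteColimits P := by
  have : i.ReflectsIsomorphisms :=
    reflectsIsomorphisms_of_reflectsMonomorphisms_of_reflectsEpimorphisms i
  have h₁ : PreservesFiniteLimits (P ⋙ i) := preservesFiniteLimits_of_natIso e.symm
  have h₂ : PreservesFiniteColimits (P ⋙ i) := preservesFiniteColimits_of_natIso e.symm
  constructor
  · refine ⟨fun J _ _ => ⟨fun {X} => ?_⟩⟩
    have : ReflectsLimit (X ⋙ P) i := reflectsLimit_of_reflectsIsomorphisms _ _
    exact preservesLimit_of_reflects_of_preserves P i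
  · refine ⟨fun J _ _ => ⟨fun {X} => ?_⟩⟩
    have : ReflectsColimit (X ⋙ P) i := reflectsColimit_of_reflectsIsomorphisms _ _
    exact preservesColimit_of_reflects_of_preserves P i

lemma linear_of_comp_faithful {k : Type*} [Ring k] [Preadditive T] [Preadditive B] [Preadditive D]
    [Linear k T] [Linear k B] [Linear k D] (i : B ⥤ D) [i.Faithful] [i.Linear k] {P : T ⥤ B}
    {R : T ⥤ D} (e : P ⋙ i ≅ R) [R.Linear k] : P.Linear k where
  map_smul {X Y} f r := i.map_injective (by
    have h := NatIso.naturality_2 e f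
    refine (NatIso.naturality_2 e (r • f)).symm.trans ?_
    rw [R.map_smul, Linear.smul_comp, Linear.comp_smul, i.map_smul, h]
    rfl)

/-- Serves the degenerate case, in which `FA` kills `A` and therefore `B` is zero. -/
lemma exact_of_isZero (hB : ∀ N : B, IsZero N) (P : T ⥤ B) :
    PreservesFiniteLimits P ∧ PreservesFiniteColimits P :=
  ⟨⟨fun _ _ _ => ⟨fun {_} => ⟨fun {_} _ => ⟨
    { lift := fun s => (hB s.pt).to_ _
      fac := fun s _ => (hB s.pt).eq_of_src _ _
      uniq := fun s _ _ => (hB s.pt).eq_of_src _ _ }⟩⟩⟩⟩,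
    ⟨fun _ _ _ => ⟨fun {_} => ⟨fun {_} _ => ⟨
    { desc := fun s => (hB _).to_ s.pt
      fac := fun s _ => (hB s.pt).eq_of_tgt _ _
      uniq := fun s _ _ => (hB s.pt).eq_of_tgt _ _ }⟩⟩⟩⟩⟩

lemma linear_of_isZero {k : Type*} [Ring k] [Preadditive T] [Preadditive B] [Linear k T]
    [Linear k B] (hB : ∀ N : B, IsZero N) (P : T ⥤ B) : P.Additive ∧ P.Linear k :=
  ⟨⟨fun {_ _ _ _} => (hB _).eq_of_src _ _⟩, ⟨fun _ _ => (hB _).eq_of_src _ _⟩⟩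

end Reflection

/-! ### Exactness and bilinearity of the induced actions -/

section Actions

variable {T : Type*} [Category* T] [MonoidalCategory T]
  {D : Type*} [Category* D] [Abelian D] [MonoidalCategory D]
  [MonoidalPreadditive D] [BiexactTensor D]
  {B : Type*} [Category* B] [Abelian B] [HasDerivedCategory D] [HasDerivedCategory B]
  (iB : B ⥤ D) [iB.Faithful] [iB.Additive] [PreservesFiniteLimits iB] [PreservesFiniteColimits iB]
  [MonoidalLeftAction (Db D) (Db B)] (jB : ModuleFunctorOver (𝟭 (Db D)) (mapDb iB))
  [MonoidalLeftAction T B] {Ω : T ⥤ Db D} [Ω.Monoidal] (sB : ModuleFunctorOver Ω (singleDb B))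
  {Ω₀ : T ⥤ D} (ω : Ω ≅ Ω₀ ⋙ singleDb D)

include jB sB ω

-- In `Db D` the action turns into the tensor product with an object of the heart, and `singleDb D`
-- is monoidal and fully faithful; so `iB` carries the action to the tensor product of `D`, where
-- exactness is known.
omit [iB.Faithful] in
lemma nonempty_actionLeft_iso (X : T) : Nonempty (MonoidalLeftAction.actionLeft B X ⋙ iB ≅
    iB ⋙ MonoidalLeftAction.actionLeft D (Ω₀.obj X)) :=
  ⟨((Functor.FullyFaithful.ofFullyFaithful (singleDb D)).whiskeringRight _).preimageIso
    (((sB.comp jB).ofIso (singleDbCompMapDb iB)).leftIso X ≪≫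
      Functor.isoWhiskerLeft (iB ⋙ singleDb D) (actionLeftMapIso (ω.app X)) ≪≫
        Functor.isoWhiskerLeft iB
          ((ModuleFunctorOver.self (singleDb D)).leftIso (Ω₀.obj X)).symm)⟩

omit [iB.Faithful] in
lemma nonempty_actionRight_iso (N : B) : Nonempty (MonoidalLeftAction.actionRight T N ⋙ iB ≅
    Ω₀ ⋙ MonoidalLeftAction.actionRight D (iB.obj N)) :=
  ⟨((Functor.FullyFaithful.ofFullyFaithful (singleDb D)).whiskeringRight _).preimageIso
    (((sB.comp jB).ofIso (singleDbCompMapDb iB)).rightIso N ≪≫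
      Functor.isoWhiskerRight ω (MonoidalLeftAction.actionRight (Db D) _) ≪≫
        Functor.isoWhiskerLeft Ω₀
          ((ModuleFunctorOver.self (singleDb D)).rightIso (iB.obj N)).symm)⟩

lemma isBiexactAction_of_singleDb [PreservesFiniteLimits Ω₀] [PreservesFiniteColimits Ω₀] :
    IsBiexactAction T B := by
  have := BiexactTensor.left_lim (C := D)
  have := BiexactTensor.left_colim (C := D)
  have := BiexactTensor.right_lim (C := D)
  have := BiexactTensor.right_colim (C := D)
  refine ⟨fun X => ?_, fun N => ?_⟩
  · obtain ⟨e⟩ := nonempty_actionLeft_iso iB jB sB ω X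
    exact exact_of_comp_faithful iB (R := iB ⋙ tensorLeft (Ω₀.obj X)) e
  · obtain ⟨e⟩ := nonempty_actionRight_iso iB jB sB ω N
    exact exact_of_comp_faithful iB (R := Ω₀ ⋙ tensorRight (iB.obj N)) e

lemma isBilinearAction_of_singleDb (k : Type*) [Field k] [Linear k D] [Linear k B] [Abelian T]
    [Linear k T] [MonoidalLinear k D] [iB.Linear k] [PreservesFiniteLimits Ω₀]
    [PreservesFiniteColimits Ω₀] [Ω₀.Linear k] : IsBilinearAction k T B := by
  have h := isBiexactAction_of_singleDb iB jB sB ω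
  refine ⟨fun X => ⟨?_, ?_⟩, fun N => ⟨?_, ?_⟩⟩
  · have := (h.1 X).1
    -- Additivity is a consequence of left exactness; only linearity has to be compared in `D`.
    exact Functor.additive_of_preserves_binary_products _
  · obtain ⟨e⟩ := nonempty_actionLeft_iso iB jB sB ω X
    exact linear_of_comp_faithful iB (R := iB ⋙ tensorLeft (Ω₀.obj X)) e
  · have := (h.2 N).1
    exact Functor.additive_of_preserves_binary_products _
  · obtain ⟨e⟩ := nonempty_actionRight_iso iB jB sB ω N
    exact linear_of_comp_faithful iB (R := Ω₀ ⋙ tensorRight (iB.obj N)) e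

end Actions


/-- The action on isomorphic objects. -/
noncomputable def actionRightMapIso {T K : Type*} [Category* T] [Category* K] [MonoidalCategory T]
    [MonoidalLeftAction T K] {M N : K} (e : M ≅ N) :
    MonoidalLeftAction.actionRight T M ≅ MonoidalLeftAction.actionRight T N :=
  NatIso.ofComponents (fun X => actionRightIso X e)
    (fun f => (MonoidalLeftAction.action_exchange f e.hom).symm)

/-- `lift_iso` for an isomorphism given in the other direction, as is the factorization through the
Serre quotient. -/
lemma ModuleFunctorOver.lift_symm_iso {T T' K K' L : Type*} [Category* T] [Category* T']
    [Category* K] [Category* K'] [Category* L] [MonoidalCategory T] [MonoidalCategory T']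
    [MonoidalLeftAction T K] [MonoidalLeftAction T' K'] [MonoidalLeftAction T L] {Φ : T ⥤ T'}
    [Φ.Monoidal] {H : K ⥤ K'} {ι : L ⥤ K'} [ι.Full] [ι.Faithful] (t : ModuleFunctorOver Φ ι)
    (u : ModuleFunctorOver Φ H) {G : K ⥤ L} (θ : G ⋙ ι ≅ H) (X : T) (M : K) :
    θ.hom.app (X ⊙ₗ M) ≫ (u.iso X M).hom = ι.map ((lift t u θ.symm).iso X M).hom ≫
      (t.iso X (G.obj M)).hom ≫ Φ.obj X ⊴ₗ θ.hom.app M := by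
  have h := lift_iso t u θ.symm X M
  rw [← cancel_epi (θ.inv.app (X ⊙ₗ M)), Iso.inv_hom_id_app_assoc]
  rw [Iso.symm_hom] at h
  rw [reassoc_of% h, ← MonoidalLeftAction.actionHomRight_comp, Iso.inv_hom_id_app,
    MonoidalLeftAction.actionHomRight_id, comp_id]

/-! ### The Serre quotient by the kernel of a full dense exact functor -/

section SerreQuotient

variable {A B : Type*} [Category* A] [Category* B] [Abelian A] [Abelian B] (G : A ⥤ B)
  [PreservesFiniteLimits G] [PreservesFiniteColimits G]

lemma isoModSerre_isInvertedBy : (kernelOf G).isoModSerre.IsInvertedBy G :=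
  ((kernelOf G).isoModSerre_isInvertedBy_iff G).2 fun _ h => h

/-- The functor induced by an exact functor on the Serre quotient by its kernel. -/
noncomputable def serreQuotientFunctor : (kernelOf G).isoModSerre.Localization ⥤ B :=
  Localization.lift G (isoModSerre_isInvertedBy G) (kernelOf G).isoModSerre.Q

/-- The factorization of an exact functor through the Serre quotient by its kernel. -/
noncomputable def serreQuotientFac :
    (kernelOf G).isoModSerre.Q ⋙ serreQuotientFunctor G ≅ G :=
  Localization.fac _ _ _

noncomputable instance : Localization.Lifting (kernelOf G).isoModSerre.Q
    (kernelOf G).isoModSerre G (serreQuotientFunctor G) := ⟨serreQuotientFac G⟩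

instance : (serreQuotientFunctor G).Additive := by
  have := Functor.additive_of_preserves_binary_products G
  rw [Localization.functor_additive_iff (kernelOf G).isoModSerre.Q (kernelOf G).isoModSerre]
  exact Functor.additive_of_iso (serreQuotientFac G).symm

/-- An exact functor preserves the factorization of `f` into an epimorphism and a monomorphism; if
the composite is zero, so is the image. -/
lemma isZero_image_of_map_eq_zero {X Y : A} (f : X ⟶ Y) (hf : G.map f = 0) :
    kernelOf G (Abelian.image f) := by
  have h₁ : G.map (Abelian.factorThruImage f) ≫ G.map (Abelian.image.ι f) = 0 := by
    rw [← G.map_comp, Abelian.image.fac, hf]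
  have h₂ : G.map (Abelian.factorThruImage f) = 0 := by
    rwa [← cancel_mono (G.map (Abelian.image.ι f)), zero_comp]
  exact IsZero.of_epi_eq_zero _ h₂

/-- Every morphism of the quotient is isomorphic, as an arrow, to the image of one of `A`. If `G`
kills the latter, its image object lies in the kernel, so it is already zero in the quotient. -/
instance : (serreQuotientFunctor G).Faithful where
  map_injective {X Y f g} h := by
    suffices ∀ f : X ⟶ Y, (serreQuotientFunctor G).map f = 0 → f = 0 by
      rw [← sub_eq_zero]
      refine this _ ?_
      rw [Functor.map_sub, h, sub_self]
    intro f hf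
    obtain ⟨f', ⟨e⟩⟩ := (Localization.essSurj_mapArrow (kernelOf G).isoModSerre.Q
      (kernelOf G).isoModSerre).mem_essImage (Arrow.mk f)
    let a : (kernelOf G).isoModSerre.Q.obj f'.left ≅ X := Arrow.leftFunc.mapIso e
    let b : (kernelOf G).isoModSerre.Q.obj f'.right ≅ Y := Arrow.rightFunc.mapIso e
    have w : a.hom ≫ f = (kernelOf G).isoModSerre.Q.map f'.hom ≫ b.hom := Arrow.w e.hom
    have h₁ : (kernelOf G).isoModSerre.Q.map f'.hom = a.hom ≫ f ≫ b.inv := by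
      rw [reassoc_of% w, Iso.hom_inv_id, comp_id]
    have h₂ : (serreQuotientFunctor G).map ((kernelOf G).isoModSerre.Q.map f'.hom) = 0 := by
      rw [h₁, Functor.map_comp, Functor.map_comp, hf, zero_comp, comp_zero]
    have h₃ : G.map f'.hom = 0 := by
      rw [← NatIso.naturality_1 (serreQuotientFac G) f'.hom, Functor.comp_map, h₂, zero_comp,
        comp_zero]
    have h₄ := (ObjectProperty.SerreClassLocalization.map_eq_zero_iff
      (kernelOf G).isoModSerre.Q (kernelOf G) f'.hom).2 (isZero_image_of_map_eq_zero G _ h₃)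
    rw [← cancel_epi a.hom, w, h₄, zero_comp, comp_zero]

instance [G.EssSurj] : (serreQuotientFunctor G).EssSurj :=
  have : ((kernelOf G).isoModSerre.Q ⋙ serreQuotientFunctor G).EssSurj :=
    Functor.essSurj_of_iso (serreQuotientFac G).symm
  ⟨fun N => ⟨_, ⟨((kernelOf G).isoModSerre.Q ⋙ serreQuotientFunctor G).objObjPreimageIso N⟩⟩⟩

/-- All objects of the quotient come from `A`, so fullness of `G` suffices. -/
instance [G.Full] : (serreQuotientFunctor G).Full := by
  have : ((kernelOf G).isoModSerre.Q ⋙ serreQuotientFunctor G).Full :=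
    Functor.Full.of_iso (serreQuotientFac G).symm
  have := Localization.essSurj (kernelOf G).isoModSerre.Q (kernelOf G).isoModSerre
  refine ⟨fun {X Y} h => ?_⟩
  let a := (kernelOf G).isoModSerre.Q.objObjPreimageIso X
  let b := (kernelOf G).isoModSerre.Q.objObjPreimageIso Y
  obtain ⟨g, hg⟩ := ((kernelOf G).isoModSerre.Q ⋙ serreQuotientFunctor G).map_surjective
    ((serreQuotientFunctor G).map a.hom ≫ h ≫ (serreQuotientFunctor G).map b.inv)
  refine ⟨a.inv ≫ (kernelOf G).isoModSerre.Q.map g ≫ b.hom, ?_⟩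
  rw [Functor.comp_map] at hg
  rw [Functor.map_comp, Functor.map_comp, hg, assoc, assoc, ← Functor.map_comp_assoc,
    ← Functor.map_comp, Iso.inv_hom_id, Iso.inv_hom_id, CategoryTheory.Functor.map_id,
    CategoryTheory.Functor.map_id, comp_id, id_comp]

instance [G.Full] [G.EssSurj] : (serreQuotientFunctor G).IsEquivalence where

lemma exact_of_comp_equivalence {T L N : Type*} [Category* T] [Category* L] [Category* N]
    (E : L ⥤ N) [E.IsEquivalence] {P : T ⥤ L} {R : T ⥤ N} (e : P ⋙ E ≅ R)
    [PreservesFiniteLimits R] [PreservesFiniteColimits R] :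
    PreservesFiniteLimits P ∧ PreservesFiniteColimits P := by
  let e' : R ⋙ E.inv ≅ P := Functor.isoWhiskerRight e.symm E.inv ≪≫ Functor.associator _ _ _ ≪≫
    Functor.isoWhiskerLeft P E.asEquivalence.unitIso.symm ≪≫ P.rightUnitor
  exact ⟨preservesFiniteLimits_of_natIso e', preservesFiniteColimits_of_natIso e'⟩

variable {k : Type*} [Field k] [Linear k A] [Linear k B] {T : Type*} [Category* T] [Preadditive T]
  [Linear k T] [MonoidalCategory T] [MonoidalLeftAction T A] [MonoidalLeftAction T B]

/-- The action is transported from `B` along the equivalence, so exactness comes from `B`.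
Bilinearity comes from `A` through the linear functor `Q`, because the action on `B` and the functor
`G` need not be linear here. -/
lemma exists_action_serreQuotient [G.Full] [G.EssSurj] (sG : ModuleFunctorOver (𝟭 T) G)
    (hA : IsBilinearAction k T A) (hB : IsBiexactAction T B) :
    ∃ (_ : MonoidalLeftAction T (kernelOf G).isoModSerre.Localization)
      (sQ : ModuleFunctorOver (𝟭 T) (kernelOf G).isoModSerre.Q)
      (E : (kernelOf G).isoModSerre.Localization ≌ B)
      (sE : ModuleFunctorOver (𝟭 T) E.functor)
      (κ : (kernelOf G).isoModSerre.Q ⋙ E.functor ≅ G),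
      IsBiexactAction T (kernelOf G).isoModSerre.Localization ∧
      IsBilinearAction k T (kernelOf G).isoModSerre.Localization ∧
      (∀ (X : T) (M : A),
        κ.hom.app (X ⊙ₗ M) ≫ (sG.iso X M).hom =
          E.functor.map (sQ.iso X M).hom ≫
            (sE.iso X ((kernelOf G).isoModSerre.Q.obj M)).hom ≫ X ⊴ₗ κ.hom.app M) ∧
      (G.Linear k → E.functor.Linear k) := by
  let E := serreQuotientFunctor G
  let Q := (kernelOf G).isoModSerre.Q
  let κ : Q ⋙ E ≅ G := serreQuotientFac G
  let e (X : T) (M) := E.objObjPreimageIso (X ⊙ₗ E.obj M)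
  let _ := inducedAction (𝟭 T) E (fun X M => E.objPreimage (X ⊙ₗ E.obj M)) e
  let sE : ModuleFunctorOver (𝟭 T) E :=
    inducedModuleFunctor (𝟭 T) E (fun X M => E.objPreimage (X ⊙ₗ E.obj M)) e
  let sQ : ModuleFunctorOver (𝟭 T) Q := sE.lift sG κ.symm
  have := Localization.essSurj Q (kernelOf G).isoModSerre
  refine ⟨inferInstance, sQ, E.asEquivalence, sE, κ, ⟨fun X => ?_, fun M => ?_⟩,
    ⟨fun X => ?_, fun M => ?_⟩, fun X M => ?_, fun _ => ?_⟩
  · have := (hB.1 X).1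
    have := (hB.1 X).2
    exact exact_of_comp_equivalence E (R := E ⋙ MonoidalLeftAction.actionLeft B X) (sE.leftIso X)
  · have := (hB.2 (E.obj M)).1
    have := (hB.2 (E.obj M)).2
    exact exact_of_comp_equivalence E (R := MonoidalLeftAction.actionRight T (E.obj M))
      (sE.rightIso M)
  · have := (hA.1 X).1
    have := (hA.1 X).2
    have h : (Q ⋙ MonoidalLeftAction.actionLeft _ X).Additive :=
      Functor.additive_of_iso (sQ.leftIso X)
    have h' : (Q ⋙ MonoidalLeftAction.actionLeft _ X).Linear k :=
      Functor.linear_of_iso k (sQ.leftIso X)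
    -- Additivity and linearity of a functor on the localization can be checked after composition
    -- with `Q`.
    let : Localization.Lifting Q (kernelOf G).isoModSerre
      (Q ⋙ MonoidalLeftAction.actionLeft _ X) (MonoidalLeftAction.actionLeft _ X) := ⟨Iso.refl _⟩
    exact ⟨(Localization.functor_additive_iff Q (kernelOf G).isoModSerre _).2 h,
      (Localization.functor_linear_iff Q (kernelOf G).isoModSerre k
        (Q ⋙ MonoidalLeftAction.actionLeft _ X) _).1 h'⟩
  -- In the first variable nothing is localized; `M` is replaced by the image of an object of `A`.
  · let M' := Q.objPreimage M
    have := (hA.2 M').1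
    have := (hA.2 M').2
    let i : MonoidalLeftAction.actionRight T M' ⋙ Q ≅ MonoidalLeftAction.actionRight T M :=
      sQ.rightIso M' ≪≫ Functor.leftUnitor _ ≪≫ actionRightMapIso (Q.objObjPreimageIso M)
    exact ⟨Functor.additive_of_iso i, Functor.linear_of_iso k i⟩
  · exact sE.lift_symm_iso sG κ X M
  · exact (Localization.functor_linear_iff Q (kernelOf G).isoModSerre k G E).1 inferInstance

end SerreQuotient


/-! ### The module structure on the restricted functor -/

section Restriction

variable {C D A B : Type*} [Category* C] [Category* D] [Category* A] [Category* B]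
  [MonoidalCategory C] [MonoidalCategory D] [MonoidalLeftAction C A] [MonoidalLeftAction D B]
  {ι : A ⥤ C} {ι' : B ⥤ D} [ι'.Faithful] (jA : ModuleFunctorOver (𝟭 C) ι)
  (jB : ModuleFunctorOver (𝟭 D) ι') (F : C ⥤ D) [F.Monoidal] {Ψ : A ⥤ B}
  (φ : ι ⋙ F ≅ Ψ ⋙ ι')
  (s : ∀ (X : C) (M : A), Ψ.obj (X ⊙ₗ M) ≅ F.obj X ⊙ₗ Ψ.obj M)
  (hs : ∀ X M, ι'.map (s X M).hom = (restrictionIso jA jB F φ X M).hom)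

/-- The module functor structure on the restriction of a monoidal functor. -/
noncomputable def restrictionModuleFunctor : ModuleFunctorOver F Ψ :=
  ModuleFunctorOver.ofFaithful jB
    (((jA.comp (ModuleFunctorOver.self F)).ofIso φ).changeBase
      -- The composite is a module functor over `𝟭 C ⋙ F`, whereas `ofFaithful` expects `F ⋙ 𝟭 D`.
      (F.leftUnitor ≪≫ F.rightUnitor.symm) (by simp) (by simp)) s (fun X M => by
        rw [hs]
        simp [restrictionIso])

end Restriction

/-! ### The degenerate case -/

section Zero

open scoped ZeroObject

variable {A B : Type*} [Category* A] [Category* B] [Abelian A] [Abelian B]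
  [HasDerivedCategory A] [HasDerivedCategory B]

/-- If `Ψ` kills the heart, it restricts there to the zero functor. Commutation with cohomology then
makes it zero on all of `Db A`, and density leaves only zero objects in `B`. -/
lemma isZero_of_essSurj (Ψ : Db A ⥤ Db B) [Ψ.CommShift ℤ] [Ψ.IsTriangulated] [Ψ.EssSurj]
    (h : ∀ M, IsZero (Ψ.obj ((singleDb A).obj M))) (N : B) : IsZero N := by
  let Z : A ⥤ B := (Functor.const A).obj 0
  have hZ : ∀ M, IsZero ((singleDb B).obj (Z.obj M)) := fun M =>
    (singleDb B).map_isZero (isZero_zero B)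
  let θ : singleDb A ⋙ Ψ ≅ Z ⋙ singleDb B :=
    NatIso.ofComponents (fun M => (h M).iso (hZ M)) (fun _ => (h _).eq_of_src _ _)
  exact isZero_of_faithful (singleDb B) (((isZero_map_iff Ψ θ _).2 fun _ => isZero_zero B).of_iso
    (Ψ.objObjPreimageIso ((singleDb B).obj N)).symm)

lemma essImage_singleDb_of_isZero (h : ∀ N : B, IsZero N) (K : Db B) :
    (singleDb B).essImage K :=
  (essImage_singleDb_iff K).2 fun _ _ => h _

end Zero

end DerivedModule

/-! ### The main theorem -/

theorem theorem4p4 {k : Type*} [Field k] [IsAlgClosed k]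
    {C : Type*} [Category* C] [Abelian C] [Linear k C] [MonoidalCategory C]
    [MonoidalPreadditive C] [MonoidalLinear k C] [RigidCategory C] [IsTensorCategory k C]
    {D : Type*} [Category* D] [Abelian D] [Linear k D] [MonoidalCategory D]
    [MonoidalPreadditive D] [MonoidalLinear k D] [RigidCategory D] [IsTensorCategory k D]
    {A : Type*} [Category* A] [Abelian A] [Linear k A]
    {B : Type*} [Category* B] [Abelian B] [Linear k B]
    (hA : HasFinitelyManySimples A) (hB : HasFinitelyManySimples B)
    [HasDerivedCategory C] [HasDerivedCategory D] [HasDerivedCategory A] [HasDerivedCategory B]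
    (iA : A ⥤ C) [iA.Faithful] [iA.Additive] [iA.Linear k]
    [PreservesFiniteLimits iA] [PreservesFiniteColimits iA]
    (iB : B ⥤ D) [iB.Faithful] [iB.Additive] [iB.Linear k]
    [PreservesFiniteLimits iB] [PreservesFiniteColimits iB]
    [(mapDb iA).Faithful] [MonoidalLeftAction (Db C) (Db A)]
    (jA : ModuleFunctorOver (𝟭 (Db C)) (mapDb iA))
    [(mapDb iB).Faithful] [MonoidalLeftAction (Db D) (Db B)]
    (jB : ModuleFunctorOver (𝟭 (Db D)) (mapDb iB))
    (F : Db C ⥤ Db D) [F.Monoidal] [F.CommShift ℤ] [F.IsTriangulated]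
    (FA : Db A ⥤ Db B) [FA.CommShift ℤ] [FA.IsTriangulated] [FA.Full] [FA.EssSurj]
    (φ : mapDb iA ⋙ F ≅ FA ⋙ mapDb iB)
    (s : ∀ (X : Db C) (M : Db A), FA.obj (X ⊙ₗ M) ≅ F.obj X ⊙ₗ FA.obj M)
    (hs : ∀ X M, (mapDb iB).map (s X M).hom = (restrictionIso jA jB F φ X M).hom) :
    ∃ (_ : MonoidalLeftAction C A) (_ : MonoidalLeftAction C B)
      (sA : ModuleFunctorOver (singleDb C) (singleDb A))
      (sB : ModuleFunctorOver (singleDb C ⋙ F) (singleDb B))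
      (G : A ⥤ B) (θ : singleDb A ⋙ FA ≅ G ⋙ singleDb B)
      (sG : ModuleFunctorOver (𝟭 C) G)
      (_ : PreservesFiniteLimits G) (_ : PreservesFiniteColimits G),
      IsBiexactAction C A ∧ IsBilinearAction k C A ∧ IsBiexactAction C B ∧
      (∀ (X : C) (M : A),
        θ.hom.app (X ⊙ₗ M) ≫ (singleDb B).map (sG.iso X M).hom ≫ (sB.iso X (G.obj M)).hom =
          FA.map (sA.iso X M).hom ≫ (s ((singleDb C).obj X) ((singleDb A).obj M)).hom ≫
            F.obj ((singleDb C).obj X) ⊴ₗ θ.hom.app M) ∧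
      (F.Linear k → IsBilinearAction k C B ∧ G.Linear k) ∧
      (∃ (_ : MonoidalLeftAction C (kernelOf G).isoModSerre.Localization)
        (sQ : ModuleFunctorOver (𝟭 C) (kernelOf G).isoModSerre.Q)
        (E : (kernelOf G).isoModSerre.Localization ≌ B)
        (sE : ModuleFunctorOver (𝟭 C) E.functor)
        (κ : (kernelOf G).isoModSerre.Q ⋙ E.functor ≅ G),
        IsBiexactAction C (kernelOf G).isoModSerre.Localization ∧
        IsBilinearAction k C (kernelOf G).isoModSerre.Localization ∧
        (∀ (X : C) (M : A),
          κ.hom.app (X ⊙ₗ M) ≫ (sG.iso X M).hom =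
            E.functor.map (sQ.iso X M).hom ≫
              (sE.iso X ((kernelOf G).isoModSerre.Q.obj M)).hom ≫ X ⊴ₗ κ.hom.app M) ∧
        (F.Linear k → E.functor.Linear k)) ∧
      (∀ K : Db A, kernelOf FA K ↔ ∀ n : ℤ, kernelOf G ((cohomologyDb A n).obj K)) := by
  have hN (X : A) : IsNoetherianObject X :=
    have := IsTensorCategory.noetherian k (iA.obj X)
    isNoetherianObject_of_faithful iA X
  have hA' (X : A) : IsArtinianObject X :=
    have := IsTensorCategory.artinian k (iA.obj X)
    isArtinianObject_of_faithful iA X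
  -- Either the tensor category goes to the heart, or `B` is zero and every condition on it is
  -- vacuous.
  have key : (∀ X, (singleDb D).essImage (F.obj ((singleDb C).obj X))) ∨ (∀ N : B, IsZero N) := by
    by_cases h : ∃ M, ¬ IsZero (FA.obj ((singleDb A).obj M))
    · exact Or.inl (essImage_singleDb_map (k := k) iA iB jA F FA φ hA hN hA' h)
    · push Not at h
      exact Or.inr (isZero_of_essSurj FA h)
  have hFA (M : A) : (singleDb B).essImage (FA.obj ((singleDb A).obj M)) := by
    rcases key with key | key
    -- In `Db D` the complex `FA(M)` becomes `F` of an object of `C`, and the inclusion of `B`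
    -- detects the heart.
    · exact essImage_singleDb_of_mapDb iB ((singleDb D).essImage.prop_of_iso
        ((F.mapIso ((singleDbCompMapDb iA).symm.app M)) ≪≫ φ.app ((singleDb A).obj M))
          (key (iA.obj M)))
    · exact essImage_singleDb_of_isZero key _
  have hoA (X : C) (M : A) := essImage_singleDb_action iA jA ⟨X, ⟨Iso.refl _⟩⟩ M
  have hoB (X : C) (N : B) :
      (singleDb B).essImage (F.obj ((singleDb C).obj X) ⊙ₗ (singleDb B).obj N) := by
    rcases key with key | key
    · exact essImage_singleDb_action iB jB (key X) N
    · exact essImage_singleDb_of_isZero key _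
  let actA := inducedAction (singleDb C) (singleDb A) _ (fun X M => (hoA X M).getIso)
  let sA : ModuleFunctorOver (singleDb C) (singleDb A) :=
    inducedModuleFunctor (singleDb C) (singleDb A) _ (fun X M => (hoA X M).getIso)
  let actB := inducedAction (singleDb C ⋙ F) (singleDb B) _ (fun X N => (hoB X N).getIso)
  let sB : ModuleFunctorOver (singleDb C ⋙ F) (singleDb B) :=
    inducedModuleFunctor (singleDb C ⋙ F) (singleDb B) _ (fun X N => (hoB X N).getIso)
  let G : A ⥤ B := Functor.essImage.liftFunctor (singleDb A ⋙ FA) (singleDb B) hFA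
  let θ : singleDb A ⋙ FA ≅ G ⋙ singleDb B :=
    (Functor.essImage.liftFunctorCompIso (singleDb A ⋙ FA) (singleDb B) hFA).symm
  let sF := restrictionModuleFunctor jA jB F φ s hs
  let sG : ModuleFunctorOver (𝟭 C) G := sB.lift (sA.comp sF) θ
  obtain ⟨hG, hG'⟩ := exact_of_singleDb_comp FA θ
  have : G.Full :=
    have : (G ⋙ singleDb B).Full := Functor.Full.of_iso θ
    Functor.Full.of_comp_faithful G (singleDb B)
  -- Density of `FA` gives only a complex `K` over `N`; taking `H^0` replaces it by an object of
  -- `A`.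
  have : G.EssSurj := ⟨fun N => by
    obtain ⟨e⟩ := cohomologyDb_map FA θ (FA.objPreimage ((singleDb B).obj N)) 0
    exact ⟨_, ⟨e.symm ≪≫ (cohomologyDb B 0).mapIso (FA.objObjPreimageIso _) ≪≫
      singleDbCompCohomologyDb.app N⟩⟩⟩
  have biexactA : IsBiexactAction C A :=
    isBiexactAction_of_singleDb iA jA sA (Ω₀ := 𝟭 C) (Functor.leftUnitor _).symm
  have bilinearA : IsBilinearAction k C A :=
    isBilinearAction_of_singleDb iA jA sA (Ω₀ := 𝟭 C) (Functor.leftUnitor _).symm k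
  have biexactB : IsBiexactAction C B ∧ (F.Linear k → IsBilinearAction k C B) := by
    rcases key with key | key
    · let Ω₀ : C ⥤ D := Functor.essImage.liftFunctor (singleDb C ⋙ F) (singleDb D) key
      let ω : singleDb C ⋙ F ≅ Ω₀ ⋙ singleDb D :=
        (Functor.essImage.liftFunctorCompIso (singleDb C ⋙ F) (singleDb D) key).symm
      -- `F` preserves the hearts of `Db C` and `Db D`, so its restriction `Ω₀` is exact; this makes
      -- the action on `B` exact in the variable from `C`.
      obtain ⟨h, h'⟩ := exact_of_singleDb_comp F ω
      refine ⟨isBiexactAction_of_singleDb iB jB sB ω, fun _ => ?_⟩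
      have : Ω₀.Linear k := linear_of_comp_faithful (singleDb D) ω.symm
      exact isBilinearAction_of_singleDb iB jB sB ω k
    · exact ⟨⟨fun _ => exact_of_isZero key _, fun _ => exact_of_isZero key _⟩,
        fun _ => ⟨fun _ => linear_of_isZero key _, fun _ => linear_of_isZero key _⟩⟩
  have linearG (_ : F.Linear k) : G.Linear k :=
    -- Linearity is given for `F`, not for `FA`, so `G` is compared with `F` inside `Db D`, where
    -- the faithful linear functor `iB ⋙ singleDb D` detects it.
    linear_of_comp_faithful (iB ⋙ singleDb D) (R := iA ⋙ singleDb C ⋙ F)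
      (Functor.isoWhiskerLeft G (singleDbCompMapDb iB).symm ≪≫
        Functor.isoWhiskerRight θ.symm (mapDb iB) ≪≫
          Functor.isoWhiskerLeft (singleDb A) φ.symm ≪≫
            Functor.isoWhiskerRight (singleDbCompMapDb iA) F)
  obtain ⟨actQ, sQ, E, sE, κ, h₁, h₂, h₃, h₄⟩ :=
    exists_action_serreQuotient G (k := k) sG bilinearA biexactB.1
  refine ⟨actA, actB, sA, sB, G, θ, sG, hG, hG', biexactA, bilinearA, biexactB.1, fun X M => ?_,
    fun hF => ⟨biexactB.2 hF, linearG hF⟩,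
    ⟨actQ, sQ, E, sE, κ, h₁, h₂, h₃, fun hF => h₄ (linearG hF)⟩, isZero_map_iff FA θ⟩
  exact (sB.lift_iso (sA.comp sF) θ X M).trans (assoc _ _ _)
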